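/- Consider the randomized Congested Clique model: the $n\ge 1$ vertices of the input graph $G$ are machines with distinct identifiers $1,\dots,n$ (which know $n$), each initially knowing its own neighbors in $G$ and having private, independent fair coins; in each synchronous round every machine may send an $O(\log n)$-bit message, possibly a different one, to every other machine; local computation is unrestricted. Let $d(G)$ denote the average degree and $\Delta(H)$ the maximum degree of a graph ($\Delta(H)=0$ if $H$ has no vertices), for a set $S$ of vertices let $\Gamma(S)$ be the set of vertices that lie in $S$ or have a neighbor in $S$, and for a matching $M$ let $V(M)$ be the set of vertices matched by $M$. For every $c>0$ there is a constant $C=C(c)>0$ such that for every real $r\ge 1$ the following hold. (i) There is a randomized Congested Clique algorithm that, on every $n$-vertex graph $G=(V,E)$, runs for at most $C\,r$ rounds with messages of at most $C\log n$ bits and always computes an independent set $S$ of $G$ (each vertex learns whether it is in $S$) such that, with probability at least $1-n^{-c}$, the residual graph $H=G[V\setminus\Gamma(S)]$ satisfies $$\Delta(H)\le C\, d(G)^{1/2^r}\log^2 n .$$ (ii) There is a randomized Congested Clique algorithm that, on every $n$-vertex graph $G=(V,E)$, runs for at most $C\,r$ rounds with messages of at most $C\log n$ bits and always computes a matching $M$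 of $G$ (each vertex learns its partner in $M$, if any) such that, with probability at least $1-n^{-c}$, the residual graph $H=G[V\setminus V(M)]$ satisfies $$\Delta(H)\le C\, d(G)^{1/2^r}\log^2 n .$$ The constant $C$ depends neither on $r$ nor on $n$ nor on $G$; in particular $r$ may depend on $n$. -/

import Mathlib

/-- A randomized algorithm for the Congested Clique on the `n` nodes `Fin n`, in which every node
has to output an element of `Out`.

Node `v` starts from its identifier `v`, the set of its neighbors in the input graph and its own
private string of `coins` fair coin tosses. There are `rounds` synchronous rounds. In each round
every node sends to every node a message of `bandwidth` bits (one message for each addressee, which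
may all differ), and then updates its state from the messages received. Local memory and local
computation are unrestricted: `State` is any type and the local maps are any functions. -/
structure CongestedCliqueAlgorithm (n : ℕ) (Out : Type) where
  /-- length of the private random string of a node -/
  coins : ℕ
  /-- number of communication rounds -/
  rounds : ℕ
  /-- number of bits of a message -/
  bandwidth : ℕ
  /-- the local states of a node -/
  State : Type
  /-- initial state, from the identifier, the set of neighbors and the private coins -/
  init : Fin n → Set (Fin n) → (Fin coins → Bool) → State
  /-- the message sent in round `t` by a node in the given state to the given addressee -/
  send : (t : ℕ) → State → Fin n → (Fin bandwidth → Bool)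
  /-- the state after round `t`, from the state before it and the message of each sender -/
  receive : (t : ℕ) → State → (Fin n → (Fin bandwidth → Bool)) → State
  /-- the output of a node, from its final state -/
  output : State → Out

namespace CongestedCliqueAlgorithm

/-- The outcomes of all coin tosses: one private string for each node. -/
abbrev Coins {n : ℕ} {Out : Type} (A : CongestedCliqueAlgorithm n Out) : Type :=
  Fin n → Fin A.coins → Bool

/-- The state of each node after `t` rounds on input graph `G` with coin tosses `ω`. -/
def stateAfter {n : ℕ} {Out : Type} (A : CongestedCliqueAlgorithm n Out)
    (G : SimpleGraph (Fin n)) (ω : A.Coins) : ℕ → Fin n → A.State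
  | 0 => fun v => A.init v (G.neighborSet v) (ω v)
  | t + 1 => fun v => A.receive t (A.stateAfter G ω t v)
      (fun u => A.send t (A.stateAfter G ω t u) v)

/-- The output of each node on input graph `G` with coin tosses `ω`. -/
def result {n : ℕ} {Out : Type} (A : CongestedCliqueAlgorithm n Out)
    (G : SimpleGraph (Fin n)) (ω : A.Coins) (v : Fin n) : Out :=
  A.output (A.stateAfter G ω A.rounds v)

/-- The probability of an event when all coins of all nodes are fair and independent, that is, under
the uniform distribution on the finite set `A.Coins`. -/
noncomputable def prob {n : ℕ} {Out : Type} (A : CongestedCliqueAlgorithm n Out)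
    (E : Set A.Coins) : ℝ :=
  (E.ncard : ℝ) / (Nat.card A.Coins : ℝ)

/-- The set of nodes that output `true`. -/
def selected {n : ℕ} (A : CongestedCliqueAlgorithm n Bool)
    (G : SimpleGraph (Fin n)) (ω : A.Coins) : Set (Fin n) :=
  {v | A.result G ω v = true}

end CongestedCliqueAlgorithm

/-- The average degree `d(G)`. -/
noncomputable def avgDegree {n : ℕ} (G : SimpleGraph (Fin n)) : ℝ :=
  (∑ v : Fin n, ((G.neighborSet v).ncard : ℝ)) / (n : ℝ)

/-- `Γ(S)`: the vertices that are in `S` or have a neighbor in `S`. -/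
def coveredBy {n : ℕ} (G : SimpleGraph (Fin n)) (S : Set (Fin n)) : Set (Fin n) :=
  {v | v ∈ S ∨ ∃ u ∈ S, G.Adj u v}

open Classical in
/-- The maximum degree of the subgraph `G[V \ X]` induced by the complement of `X`
(zero if that subgraph has no vertices). -/
noncomputable def residualMaxDegree {n : ℕ} (G : SimpleGraph (Fin n)) (X : Set (Fin n)) : ℕ :=
  (G.induce Xᶜ).maxDegree

/-! Let τ be a suitable multiple of log n. A phase of O(1) rounds turns a bound x on the size of the
residual degrees into a bound K√x with K = O(τ). The numbers K² d^{1/2^i} satisfy this recursion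
exactly, so after about r phases the only loss is the factor K² = O(log² n). Every estimate fails
with probability at most e^{-τ} times a polynomial in n, and a union bound over the steps suffices.

Independent set. Let D be the residual degree sum. Keep each vertex with probability 1/k, where k is
of order √(D/n) + τ. A Chernoff argument bounds the degree sum of the sampled graph by n, so a
single node can collect it and run the greedy algorithm (`pr_exists_class_degSum_gt`). A vertex that
ends uncovered with τk uncovered neighbours has had τk chances, each of probability 1/k, to be
covered; the exponential potential of `expect_exp_blockedCount_le` bounds this event by e^{-τ}. Thus
the average degree x becomes a maximum degree of order τ(√x + τ) (`pr_misStep_le`).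

Matching. Vertex sampling does not suffice, as a matched neighbour does not remove a vertex. Two
kinds of steps alternate. An edge sampling step samples edges at rate of order n/D and matches
greedily at one node; the same potential turns average degree x into maximum degree O(τ(x + 1))
(`pr_edgeStep_le`). A partition step colours the vertices with k classes, k as above, and matches
each class maximally at its own node (`pr_partStep_le`). The surviving vertices of a class are
independent, so only edges between classes survive. For two given classes their expected number is
at most n/k: exchanging the two colours one vertex at a time deforms an expression that vanishes
into the desired one, and each exchange costs at most 1/k, because changing one vertex of the input
of greedy matching changes the set of free vertices in at most one vertex
(`expect_classFree_form_le`). Summed over all pairs of classes this leaves degree sum at most nk, of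
order n(√x + τ). McDiarmid's inequality gives concentration; its error is proportional to the
maximum degree, which the preceding edge sampling step keeps small.

Routing. If every group of nodes has at most n items for its destination, balancing the items over
all nodes delivers them in a constant number of rounds (`CliqueRealizes.groupCompute`). Announced
counts reveal an overload to everyone, and the step is then skipped, so the output is always valid
and only the degree bound is probabilistic. -/

open scoped BigOperators

/-! ### Uniform probability on finite types, resampling and pushforward -/

section FiniteProbability

open Classical in
/-- The probability of `p` under the uniform distribution on a finite type. -/
noncomputable def pr {Ω : Type*} [Fintype Ω] (p : Ω → Prop) : ℝ :=
  𝔼 ω, if p ω then (1 : ℝ) else 0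

variable {Ω : Type*} [Fintype Ω]

theorem pr_mono {p q : Ω → Prop} (h : ∀ ω, p ω → q ω) : pr p ≤ pr q := by
  classical
  refine Finset.expect_le_expect fun ω _ => ?_
  by_cases hp : p ω
  · simp [hp, h ω hp]
  · simp only [hp, if_false]; split_ifs <;> norm_num

theorem pr_or_le (p q : Ω → Prop) : pr (fun ω => p ω ∨ q ω) ≤ pr p + pr q := by
  classical
  unfold pr
  rw [← Finset.expect_add_distrib]
  refine Finset.expect_le_expect fun ω _ => ?_
  by_cases hp : p ω <;> by_cases hq : q ω <;> simp [hp, hq]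

theorem pr_exists_le {α : Type*} (s : Finset α) (p : α → Ω → Prop) :
    pr (fun ω => ∃ a ∈ s, p a ω) ≤ ∑ a ∈ s, pr (p a) := by
  classical
  induction s using Finset.induction_on with
  | empty => simp [pr]
  | insert a s ha ih =>
    rw [Finset.sum_insert ha]
    have : pr (fun ω => ∃ b ∈ insert a s, p b ω) ≤ pr (fun ω => p a ω ∨ ∃ b ∈ s, p b ω) :=
      pr_mono fun ω h => by simpa using h
    exact this.trans ((pr_or_le _ _).trans (by gcongr))

theorem pr_exists_le_card_mul {α : Type*} [Fintype α] (p : α → Ω → Prop) {ε : ℝ}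
    (h : ∀ a, pr (p a) ≤ ε) : pr (fun ω => ∃ a, p a ω) ≤ Fintype.card α * ε := by
  have h1 := pr_exists_le Finset.univ p
  simp only [Finset.mem_univ, true_and] at h1
  refine h1.trans ((Finset.sum_le_sum fun a _ => h a).trans ?_)
  simp

theorem pr_not [Nonempty Ω] (p : Ω → Prop) : pr (fun ω => ¬ p ω) = 1 - pr p := by
  classical
  unfold pr
  rw [eq_sub_iff_add_eq, ← Finset.expect_add_distrib]
  rw [Finset.expect_congr rfl (g := fun _ => (1 : ℝ)) (fun ω _ => by by_cases h : p ω <;> simp [h])]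
  exact Fintype.expect_const 1

/-- Markov's inequality in exponential form. -/
theorem pr_le_exp_of_expect_exp_le {p : Ω → Prop} {f : Ω → ℝ} {t M : ℝ} (hf : ∀ ω, 0 ≤ f ω)
    (hp : ∀ ω, p ω → Real.exp t ≤ f ω) (hM : 𝔼 ω, f ω ≤ M) : pr p ≤ M * Real.exp (-t) := by
  classical
  have h1 : pr p ≤ 𝔼 ω, f ω * Real.exp (-t) := by
    refine Finset.expect_le_expect fun ω _ => ?_
    have := hf ω
    split_ifs with h
    · calc (1 : ℝ) = Real.exp t * Real.exp (-t) := by rw [← Real.exp_add]; simp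
        _ ≤ _ := by gcongr; exact hp ω h
    · positivity
  rw [← Finset.expect_mul] at h1
  exact h1.trans (by gcongr)

theorem pr_equiv {Ω' : Type*} [Fintype Ω'] (e : Ω ≃ Ω') (p : Ω' → Prop) :
    pr (fun ω => p (e ω)) = pr p := by
  classical
  exact Fintype.expect_equiv e _ _ fun _ => rfl

theorem pr_eq_ncard_div_card (p : Ω → Prop) :
    pr p = ({ω | p ω}.ncard : ℝ) / (Nat.card Ω : ℝ) := by
  classical
  unfold pr
  rw [Fintype.expect_eq_sum_div_card, Finset.sum_boole, Nat.card_eq_fintype_card,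
    Set.ncard_eq_toFinset_card']
  simp

/-- Averaging over all functions is the same as averaging after resampling one value. -/
theorem expect_resample {ι X : Type*} [Fintype ι] [DecidableEq ι] [Fintype X] [Nonempty X]
    (a : ι) (f : (ι → X) → ℝ) :
    𝔼 ω, f ω = 𝔼 ω, 𝔼 x, f (Function.update ω a x) := by
  -- Exchanging the value at `a` with the fresh value is an involution, hence preserves the uniform
  -- distribution.
  let e : ((ι → X) × X) ≃ ((ι → X) × X) :=
    { toFun := fun p => (Function.update p.1 a p.2, p.1 a)
      invFun := fun p => (Function.update p.1 a p.2, p.1 a)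
      left_inv := fun p => by simp
      right_inv := fun p => by simp }
  have h1 : 𝔼 ω, 𝔼 x, f (Function.update ω a x) =
      𝔼 p : (ι → X) × X, f (Function.update p.1 a p.2) := by
    rw [← Finset.univ_product_univ, Finset.expect_product]
  have h2 : 𝔼 p : (ι → X) × X, f (Function.update p.1 a p.2) = 𝔼 p : (ι → X) × X, f p.1 :=
    Fintype.expect_equiv e _ _ fun _ => rfl
  rw [h1, h2, ← Finset.univ_product_univ, Finset.expect_product]
  refine Finset.expect_congr rfl fun ω _ => ?_
  exact (Fintype.expect_const _).symm

theorem pr_resample {ι X : Type*} [Fintype ι] [DecidableEq ι] [Fintype X] [Nonempty X]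
    (a : ι) (p : (ι → X) → Prop) :
    pr p = 𝔼 ω, pr fun x => p (Function.update ω a x) :=
  expect_resample a _

/-- A bound on the conditional probability given all values but one is a bound on the
probability. -/
theorem pr_le_of_forall_resample {ι X : Type*} [Fintype ι] [DecidableEq ι] [Fintype X] [Nonempty X]
    (a : ι) (p : (ι → X) → Prop) {ε : ℝ}
    (h : ∀ ω, pr (fun x => p (Function.update ω a x)) ≤ ε) : pr p ≤ ε := by
  rw [pr_resample a]
  exact (Finset.expect_le_expect fun ω _ => h ω).trans_eq (Fintype.expect_const ε)

/-- Pushing the uniform distribution forward along a map that is the first projection of a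
bijection with a product. -/
theorem expect_comp_of_equiv_prod {Y Z : Type*} [Fintype Y] [Fintype Z] [Nonempty Z]
    (e : Ω ≃ Y × Z) (f : Y → ℝ) : 𝔼 ω, f (e ω).1 = 𝔼 y, f y := by
  rw [Fintype.expect_equiv e (fun ω => f (e ω).1) (fun p => f p.1) (fun _ => rfl),
    ← Finset.univ_product_univ, Finset.expect_product]
  exact Finset.expect_congr rfl fun y _ => Fintype.expect_const (f y)

/-- The residues modulo `k` of independent uniform numbers below `m * k` are independent and
uniform. -/
theorem pr_comp_modNat {ι : Type*} [Fintype ι] [DecidableEq ι] {m k : ℕ} (hm : 0 < m)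
    (p : (ι → Fin k) → Prop) :
    pr (fun ω : ι → Fin (m * k) => p fun i => (ω i).modNat) = pr p := by
  classical
  have : Nonempty (Fin m) := ⟨⟨0, hm⟩⟩
  let e : (ι → Fin (m * k)) ≃ (ι → Fin k) × (ι → Fin m) :=
    (Equiv.arrowCongr (Equiv.refl ι) (finProdFinEquiv.symm.trans (Equiv.prodComm _ _))).trans
      (Equiv.arrowProdEquivProdArrow ι (fun _ => Fin k) (fun _ => Fin m))
  exact expect_comp_of_equiv_prod e (fun y => if p y then (1 : ℝ) else 0)

/-- Uniform distribution on a product: averaging over the functions restricted along an injection. -/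
theorem pr_comp_injective {ι κ X : Type*} [Fintype ι] [Fintype κ] [DecidableEq ι] [DecidableEq κ]
    [Fintype X] [Nonempty X] {g : κ → ι} (hg : Function.Injective g) (p : (κ → X) → Prop) :
    pr (fun ω : ι → X => p fun k => ω (g k)) = pr p := by
  classical
  let e : (ι → X) ≃ (κ → X) × ({i // i ∉ Set.range g} → X) :=
    (Equiv.piEquivPiSubtypeProd (fun i => i ∈ Set.range g) (fun _ => X)).trans
      (Equiv.prodCongr
        (Equiv.arrowCongr (Equiv.ofInjective g hg).symm (Equiv.refl X)) (Equiv.refl _))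
  have he : ∀ ω, (e ω).1 = fun k => ω (g k) := fun ω => by
    funext k; rfl
  have := expect_comp_of_equiv_prod e (fun y => if p y then (1 : ℝ) else 0)
  simp only [he] at this
  exact this

theorem expect_fin_ite_eq {k : ℕ} (a : Fin k) (u v : ℝ) :
    𝔼 x : Fin k, (if x = a then u else v) = v + (u - v) / k := by
  have hk : (k : ℝ) ≠ 0 := by have := a.pos; positivity
  have h : ∀ x : Fin k, (if x = a then u else v) = v + if x = a then u - v else 0 := fun x => by
    split_ifs <;> ring
  rw [Fintype.expect_eq_sum_div_card]
  simp_rw [h]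
  rw [Finset.sum_add_distrib]
  simp
  field_simp

end FiniteProbability

/-! ### Greedy selection, covering both independent sets and matchings, and its tail bound -/

section Greedy

variable {ι V : Type*} (req rem : ι → Set V)

open Classical in
/-- The greedy process: go through the items of a list, starting with a set of free vertices; an
active item all of whose required vertices are free is chosen, and blocks the vertices that it
removes. The result is the set of vertices that are still free at the end. -/
noncomputable def greedyFree (act : ι → Prop) : List ι → Set V → Set V
  | [], F => F
  | i :: l, F => greedyFree act l (if act i ∧ req i ⊆ F then F \ rem i else F)

open Classical in
/-- The set of items chosen by the greedy process. -/
noncomputable def greedyChosen (act : ι → Prop) : List ι → Set V → Set ι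
  | [], _ => ∅
  | i :: l, F => if act i ∧ req i ⊆ F then insert i (greedyChosen act l (F \ rem i))
      else greedyChosen act l F

variable {req rem} {act : ι → Prop}

theorem greedyFree_eq (l : List ι) (F : Set V) :
    greedyFree req rem act l F = {v | v ∈ F ∧ ∀ i ∈ greedyChosen req rem act l F, v ∉ rem i} := by
  induction l generalizing F with
  | nil => simp [greedyFree, greedyChosen]
  | cons i l ih =>
    ext v
    by_cases h : act i ∧ req i ⊆ F
    · simp only [greedyFree, greedyChosen, if_pos h, ih, Set.mem_sdiff, Set.mem_ofPred_eq,
        Set.mem_insert_iff, forall_eq_or_imp, and_assoc]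
    · simp only [greedyFree, greedyChosen, if_neg h, ih]

theorem greedyFree_subset (l : List ι) (F : Set V) : greedyFree req rem act l F ⊆ F := by
  rw [greedyFree_eq]; exact fun v hv => hv.1

theorem greedyChosen_spec (l : List ι) (F : Set V) {i : ι}
    (hi : i ∈ greedyChosen req rem act l F) : i ∈ l ∧ act i ∧ req i ⊆ F := by
  induction l generalizing F with
  | nil => simp [greedyChosen] at hi
  | cons j l ih =>
    by_cases h : act j ∧ req j ⊆ F
    · simp only [greedyChosen, if_pos h, Set.mem_insert_iff] at hi
      rcases hi with rfl | hi
      · exact ⟨by simp, h⟩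
      · have := ih _ hi
        exact ⟨List.mem_cons_of_mem _ this.1, this.2.1, this.2.2.trans Set.sdiff_subset⟩
    · simp only [greedyChosen, if_neg h] at hi
      have := ih _ hi
      exact ⟨List.mem_cons_of_mem _ this.1, this.2⟩

/-- Of two chosen items the later one was still available after the removals of the earlier one.
With `req u = {u}` and `rem u` the closed neighbourhood this is independence; with both equal to the
ends of a pair it is disjointness of edges. -/
theorem greedyChosen_disjoint (l : List ι) (F : Set V) {i j : ι}
    (hi : i ∈ greedyChosen req rem act l F) (hj : j ∈ greedyChosen req rem act l F) (hij : i ≠ j) :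
    Disjoint (req j) (rem i) ∨ Disjoint (req i) (rem j) := by
  induction l generalizing F with
  | nil => simp [greedyChosen] at hi
  | cons a l ih =>
    by_cases h : act a ∧ req a ⊆ F
    · simp only [greedyChosen, if_pos h, Set.mem_insert_iff] at hi hj
      rcases hi with rfl | hi <;> rcases hj with rfl | hj
      · exact absurd rfl hij
      · left
        exact Set.disjoint_left.2 fun v hv hv' => ((greedyChosen_spec _ _ hj).2.2 hv).2 hv'
      · right
        exact Set.disjoint_left.2 fun v hv hv' => ((greedyChosen_spec _ _ hi).2.2 hv).2 hv'
      · exact ih _ hi hj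
    · simp only [greedyChosen, if_neg h] at hi hj
      exact ih _ hi hj

/-- An active item that meets its own removed set is not available at the end. -/
theorem greedy_maximal (l : List ι) (F : Set V) {i : ι} (hi : i ∈ l) (ha : act i)
    (hr : (req i ∩ rem i).Nonempty) : ¬ req i ⊆ greedyFree req rem act l F := by
  induction l generalizing F with
  | nil => simp at hi
  | cons a l ih =>
    intro hsub
    rcases List.mem_cons.1 hi with rfl | hi
    · by_cases h : act i ∧ req i ⊆ F
      · simp only [greedyFree, if_pos h] at hsub
        obtain ⟨v, hv, hv'⟩ := hr
        exact (greedyFree_subset _ _ (hsub hv)).2 hv'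
      · simp only [greedyFree, if_neg h] at hsub
        exact h ⟨ha, hsub.trans (greedyFree_subset _ _)⟩
    · exact ih _ hi hsub

theorem greedyFree_congr {act' : ι → Prop} (l : List ι) (F : Set V)
    (h : ∀ i ∈ l, act i ↔ act' i) : greedyFree req rem act l F = greedyFree req rem act' l F := by
  induction l generalizing F with
  | nil => rfl
  | cons i l ih =>
    simp only [greedyFree, ih _ fun j hj => h j (List.mem_cons_of_mem _ hj)]
    rw [show act i = act' i from propext (h i (by simp))]

open Classical in
/-- The number of items of the list that remove `v` and would still be available at the end. -/
noncomputable def blockedCount (req rem : ι → Set V) (p : ι → Prop) (v : V) (l : List ι)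
    (F : Set V) : ℕ :=
  l.countP fun i => decide (p i ∧ v ∈ rem i ∧ req i ⊆ F)

/-- If every item is active with probability `1 / k`, independently, then a vertex can stay free
only with small probability as long as many items that remove it stay available. -/
theorem expect_exp_blockedCount_le [Fintype ι] [DecidableEq ι] {k : ℕ} [NeZero k]
    (p : ι → Prop) (v : V) (l : List ι) (hl : l.Nodup) (F : Set V) :
    𝔼 ω : ι → Fin k, (greedyFree req rem (fun i => p i ∧ ω i = 0) l F).indicator
      (fun _ => Real.exp ((1 / k : ℝ) * blockedCount req rem p v l
        (greedyFree req rem (fun i => p i ∧ ω i = 0) l F))) v ≤ 1 := by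
  classical
  induction l generalizing F with
  | nil =>
    simp only [greedyFree, blockedCount, List.countP_nil]
    refine (Finset.expect_le_expect (g := fun _ => (1 : ℝ)) fun ω _ => ?_).trans_eq
      (Fintype.expect_const 1)
    by_cases h : v ∈ F <;> simp [h]
  | cons i l ih =>
    have hil : i ∉ l := (List.nodup_cons.1 hl).1
    replace ih := ih (List.nodup_cons.1 hl).2
    set φ : Set V → (ι → Fin k) → ℝ := fun F ω =>
      (greedyFree req rem (fun i => p i ∧ ω i = 0) l F).indicator
      (fun _ => Real.exp ((1 / k : ℝ) * blockedCount req rem p v l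
        (greedyFree req rem (fun i => p i ∧ ω i = 0) l F))) v with hφ
    have hφ0 : ∀ F ω, 0 ≤ φ F ω := fun F ω =>
      Set.indicator_nonneg (fun _ _ => (Real.exp_pos _).le) _
    have hfree : ∀ (F : Set V) (ω : ι → Fin k) x,
        greedyFree req rem (fun j => p j ∧ Function.update ω i x j = 0) l F =
          greedyFree req rem (fun j => p j ∧ ω j = 0) l F := fun F ω x =>
      greedyFree_congr l F fun j hj => by
        rw [Function.update_of_ne (by rintro rfl; exact hil hj)]
    by_cases hp : p i ∧ req i ⊆ F
    · rw [expect_resample i]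
      -- Only the coin `x` of the first item is averaged; the rest of the process does not read it,
      -- since the list has no duplicates.
      have key : ∀ (ω : ι → Fin k) (x : Fin k),
          (greedyFree req rem (fun j => p j ∧ Function.update ω i x j = 0) (i :: l) F).indicator
            (fun _ => Real.exp ((1 / k : ℝ) * blockedCount req rem p v (i :: l)
            (greedyFree req rem (fun j => p j ∧ Function.update ω i x j = 0) (i :: l) F))) v ≤
          if x = 0 then (if v ∈ rem i then 0 else φ (F \ rem i) ω) else
            (if v ∈ rem i then Real.exp (1 / k : ℝ) else 1) * φ F ω := by
        intro ω x
        by_cases hx : x = 0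
        · have hc : (p i ∧ Function.update ω i x i = 0) ∧ req i ⊆ F := by simp [hx, hp]
          simp only [greedyFree, if_pos hc, hfree, if_pos hx]
          by_cases hv : v ∈ rem i
          · rw [if_pos hv, Set.indicator_of_notMem]
            exact fun h => (greedyFree_subset _ _ h).2 hv
          · rw [if_neg hv]
            simp [hφ, blockedCount, hv]
        · have hc : ¬ ((p i ∧ Function.update ω i x i = 0) ∧ req i ⊆ F) := by simp [hx]
          simp only [greedyFree, if_neg hc, hfree, if_neg hx, hφ]
          by_cases hvF : v ∈ greedyFree req rem (fun j => p j ∧ ω j = 0) l F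
          · rw [Set.indicator_of_mem hvF, Set.indicator_of_mem hvF]
            by_cases hv : v ∈ rem i
            · rw [if_pos hv, ← Real.exp_add]
              refine Real.exp_le_exp.2 ?_
              have : blockedCount req rem p v (i :: l)
                  (greedyFree req rem (fun j => p j ∧ ω j = 0) l F) ≤
                  blockedCount req rem p v l (greedyFree req rem (fun j => p j ∧ ω j = 0) l F)
                    + 1 := by
                unfold blockedCount
                rw [List.countP_cons]; split_ifs <;> simp
              have h2 : (blockedCount req rem p v (i :: l)
                  (greedyFree req rem (fun j => p j ∧ ω j = 0) l F) : ℝ) ≤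
                  blockedCount req rem p v l (greedyFree req rem (fun j => p j ∧ ω j = 0) l F)
                    + 1 := by exact_mod_cast this
              calc _ ≤ (1 / k : ℝ) * (blockedCount req rem p v l
                    (greedyFree req rem (fun j => p j ∧ ω j = 0) l F) + 1) := by gcongr
                _ = _ := by ring
            · simp [blockedCount, hv]
          · simp [Set.indicator_of_notMem hvF]
      refine (Finset.expect_le_expect fun ω _ => Finset.expect_le_expect fun x _ => key ω x).trans ?_
      simp_rw [expect_fin_ite_eq]
      have hk : (1 : ℝ) ≤ k := by exact_mod_cast NeZero.one_le
      have hq1 : (1 / k : ℝ) ≤ 1 := by rw [div_le_one (by linarith)]; exact hk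
      have hq0 : (0 : ℝ) ≤ 1 / k := by positivity
      -- An item that removes `v` raises the exponent by at most 1/k but makes the indicator vanish
      -- with probability 1/k, and (1 - 1/k)e^{1/k} ≤ 1. An item that does not remove `v` gives a
      -- convex combination of two instances of the induction hypothesis.
      by_cases hv : v ∈ rem i
      · simp only [if_pos hv]
        have h1 : ∀ ω, Real.exp (1 / k : ℝ) * φ F ω + (0 - Real.exp (1 / k : ℝ) * φ F ω) / k =
            ((1 - 1 / k) * Real.exp (1 / k : ℝ)) * φ F ω := fun ω => by ring
        simp_rw [h1]
        rw [← Finset.mul_expect]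
        have h2 : (1 - 1 / k : ℝ) * Real.exp (1 / k : ℝ) ≤ 1 := by
          have := Real.one_sub_le_exp_neg (1 / k : ℝ)
          calc (1 - 1 / k : ℝ) * Real.exp (1 / k : ℝ)
              ≤ Real.exp (-(1 / k : ℝ)) * Real.exp (1 / k : ℝ) := by gcongr
            _ = 1 := by rw [← Real.exp_add]; simp
        exact mul_le_one₀ h2 (Finset.expect_nonneg fun ω _ => hφ0 F ω) (ih F)
      · simp only [if_neg hv, one_mul]
        have h1 : ∀ ω, φ F ω + (φ (F \ rem i) ω - φ F ω) / k =
            (1 - 1 / k) * φ F ω + (1 / k) * φ (F \ rem i) ω := fun ω => by ring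
        simp_rw [h1]
        rw [Finset.expect_add_distrib, ← Finset.mul_expect, ← Finset.mul_expect]
        have h3 := ih F
        have h4 := ih (F \ rem i)
        nlinarith
    -- Free sets only shrink, so an item that is unavailable now is neither chosen nor counted at
    -- the end; the same holds if `p` fails.
    · refine le_trans (Finset.expect_le_expect (g := φ F) fun ω _ => ?_) (ih F)
      have hc : ¬ ((p i ∧ ω i = 0) ∧ req i ⊆ F) := fun h => hp ⟨h.1.1, h.2⟩
      have hn : ¬ (p i ∧ v ∈ rem i ∧ req i ⊆ greedyFree req rem (fun j => p j ∧ ω j = 0) l F) :=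
        fun h => hp ⟨h.1, h.2.2.trans (greedyFree_subset _ _)⟩
      simp only [greedyFree, if_neg hc, hφ, blockedCount, List.countP_cons, hn]
      simp

theorem pr_blockedCount_le [Fintype ι] [DecidableEq ι] {k : ℕ} [NeZero k]
    (p : ι → Prop) (v : V) (l : List ι) (hl : l.Nodup) (F : Set V) (τ : ℝ) :
    pr (fun ω : ι → Fin k => v ∈ greedyFree req rem (fun i => p i ∧ ω i = 0) l F ∧
      τ * k ≤ blockedCount req rem p v l (greedyFree req rem (fun i => p i ∧ ω i = 0) l F))
      ≤ Real.exp (-τ) := by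
  have hk : (0 : ℝ) < k := by exact_mod_cast NeZero.pos k
  have := pr_le_exp_of_expect_exp_le (p := fun ω : ι → Fin k =>
      v ∈ greedyFree req rem (fun i => p i ∧ ω i = 0) l F ∧
      τ * k ≤ blockedCount req rem p v l (greedyFree req rem (fun i => p i ∧ ω i = 0) l F))
    (t := τ) (fun ω => Set.indicator_nonneg (fun _ _ => (Real.exp_pos _).le) _)
    (fun ω h => by
      rw [Set.indicator_of_mem h.1]
      refine Real.exp_le_exp.2 ?_
      rw [one_div, inv_mul_eq_div, le_div_iff₀ hk]
      exact h.2) (expect_exp_blockedCount_le (req := req) (rem := rem) p v l hl F)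
  simpa using this

end Greedy

/-! ### A Chernoff bound for weighted colour classes -/

section Chernoff

theorem expect_prod_eq_prod_expect {ι X : Type*} [Fintype ι] [DecidableEq ι] [Fintype X]
    (g : ι → X → ℝ) : 𝔼 ω : ι → X, ∏ v, g v (ω v) = ∏ v, 𝔼 x, g v x := by
  simp_rw [Fintype.expect_eq_sum_div_card]
  rw [Finset.prod_div_distrib, Finset.prod_univ_sum]
  simp

/-- A Chernoff bound for the total weight of one class of a uniformly random colouring. -/
theorem pr_class_weight_le {ι : Type*} [Fintype ι] [DecidableEq ι] {k : ℕ} (i : Fin k)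
    (x : ι → ℝ) (hx0 : ∀ v, 0 ≤ x v) (hx1 : ∀ v, x v ≤ 1) (τ : ℝ) :
    pr (fun h : ι → Fin k => 2 * (∑ v, x v) / k + τ < ∑ v, if h v = i then x v else 0)
      ≤ Real.exp (-τ) := by
  have hk : (0 : ℝ) < k := by exact_mod_cast i.pos
  -- The exponential parameter is 1. Subtracting twice the mean gives each factor expectation at
  -- most 1, because e^x ≤ 1 + 2x on [0, 1]; this is the source of the factor 2 in the bound.
  let g : ι → Fin k → ℝ := fun v y => Real.exp ((if y = i then x v else 0) - 2 * x v / k)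
  have hg : ∀ v, 𝔼 y, g v y ≤ 1 := by
    intro v
    have h1 : ∀ y, g v y = Real.exp (-(2 * x v / k)) * if y = i then Real.exp (x v) else 1 := by
      intro y
      simp only [g]
      split_ifs
      · rw [← Real.exp_add]; ring_nf
      · rw [zero_sub, mul_one]
    simp_rw [h1]
    rw [← Finset.mul_expect, expect_fin_ite_eq]
    have h2 : Real.exp (x v) ≤ 1 + 2 * x v := by
      have := Real.abs_exp_sub_one_sub_id_le (x := x v) (by rw [abs_of_nonneg (hx0 v)]; exact hx1 v)
      have h3 := abs_le.1 this
      nlinarith [hx0 v, hx1 v]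
    have h3 : 1 + (Real.exp (x v) - 1) / k ≤ Real.exp (2 * x v / k) := by
      have h4 : (Real.exp (x v) - 1) / k ≤ 2 * x v / k := by gcongr; linarith
      have h5 := Real.add_one_le_exp (2 * x v / k)
      linarith
    calc _ ≤ Real.exp (-(2 * x v / k)) * Real.exp (2 * x v / k) := by gcongr
      _ = 1 := by rw [← Real.exp_add]; simp
  have hE : 𝔼 h : ι → Fin k, ∏ v, g v (h v) ≤ 1 := by
    rw [expect_prod_eq_prod_expect]
    exact Finset.prod_le_one (fun v _ => Finset.expect_nonneg fun y _ => (Real.exp_pos _).le)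
      fun v _ => hg v
  have := pr_le_exp_of_expect_exp_le
    (p := fun h : ι → Fin k => 2 * (∑ v, x v) / k + τ < ∑ v, if h v = i then x v else 0)
    (t := τ) (fun h => Finset.prod_nonneg fun v _ => (Real.exp_pos _).le) (fun h hh => by
      rw [← Real.exp_sum]
      refine Real.exp_le_exp.2 ?_
      rw [Finset.sum_sub_distrib, ← Finset.sum_div, ← Finset.mul_sum]
      linarith) hE
  simpa using this

end Chernoff

/-! ### Degree sums of induced subgraphs and of random colour classes -/

section Restrict

variable {V : Type*}

/-- The graph on the same vertices that keeps the edges inside `F`. -/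
def restrictTo (G : SimpleGraph V) (F : Set V) : SimpleGraph V where
  Adj u v := G.Adj u v ∧ u ∈ F ∧ v ∈ F
  symm := ⟨fun _ _ h => ⟨h.1.symm, h.2.2, h.2.1⟩⟩
  loopless := ⟨fun _ h => G.loopless.irrefl _ h.1⟩

variable [Fintype V]

/-- The sum of all degrees. -/
noncomputable def degSum (G : SimpleGraph V) : ℕ := ∑ v, (G.neighborSet v).ncard

theorem ncard_le_card (s : Set V) : s.ncard ≤ Fintype.card V := by
  rw [← Nat.card_eq_fintype_card]
  exact Set.ncard_le_card s

theorem ncard_eq_sum (s : Set V) [DecidablePred (· ∈ s)] : (s.ncard : ℝ) = ∑ u, if u ∈ s then (1 : ℝ) else 0 := by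
  rw [Finset.sum_boole, Set.ncard_eq_toFinset_card']
  congr 2
  ext; simp

theorem degSum_le (G : SimpleGraph V) {Δ : ℕ} (h : ∀ v, (G.neighborSet v).ncard ≤ Δ) :
    degSum G ≤ Fintype.card V * Δ := by
  refine (Finset.sum_le_sum fun v _ => h v).trans ?_
  simp

theorem degSum_mono {G G' : SimpleGraph V} (h : G ≤ G') : degSum G ≤ degSum G' :=
  Finset.sum_le_sum fun _ _ => Set.ncard_le_ncard (fun _ hu => h hu) (Set.toFinite _)

/-- In a random colouring no class spans many more edges than expected. -/
theorem pr_exists_class_degSum_gt [DecidableEq V] (H : SimpleGraph V) {k : ℕ} {τ : ℝ} (hτ : 0 ≤ τ) :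
    pr (fun h : V → Fin k => ∃ i, 4 * (degSum H : ℝ) / k ^ 2 + 4 * Fintype.card V * τ / k + τ ^ 2 <
      degSum (restrictTo H {v | h v = i})) ≤ k * ((Fintype.card V + 2) * Real.exp (-τ)) := by
  classical
  set n := Fintype.card V with hn
  have key : ∀ i : Fin k, pr (fun h : V → Fin k =>
      4 * (degSum H : ℝ) / k ^ 2 + 4 * n * τ / k + τ ^ 2 <
      degSum (restrictTo H {v | h v = i})) ≤ (n + 2) * Real.exp (-τ) := by
    intro i
    have hk : (0 : ℝ) < k := by exact_mod_cast i.pos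
    -- Three Chernoff events control class `i`: the number of neighbours of each vertex in the class
    -- (`A`), the total degree of the class, divided by n to obtain weights in [0, 1] (`B`), and its
    -- size (`B'`). Off these events the degree sum is at most (2/k)(2D/k + nτ) + τ(2n/k + τ).
    let A : V → (V → Fin k) → Prop := fun v h =>
      2 * (∑ u, if u ∈ H.neighborSet v then (1 : ℝ) else 0) / k + τ <
        ∑ u, if h u = i then (if u ∈ H.neighborSet v then (1 : ℝ) else 0) else 0
    let B : (V → Fin k) → Prop := fun h =>
      2 * (∑ u, ((H.neighborSet u).ncard : ℝ) / n) / k + τ <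
        ∑ u, if h u = i then ((H.neighborSet u).ncard : ℝ) / n else 0
    let B' : (V → Fin k) → Prop := fun h =>
      2 * (∑ _u : V, (1 : ℝ)) / k + τ < ∑ u, if h u = i then (1 : ℝ) else 0
    have hA : ∀ v, pr (A v) ≤ Real.exp (-τ) := fun v =>
      pr_class_weight_le i _ (fun u => by split_ifs <;> norm_num)
        (fun u => by split_ifs <;> norm_num) τ
    have hB : pr B ≤ Real.exp (-τ) :=
      pr_class_weight_le i _ (fun u => by positivity)
        (fun u => div_le_one_of_le₀ (by exact_mod_cast ncard_le_card _) (by positivity)) τ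
    have hB' : pr B' ≤ Real.exp (-τ) :=
      pr_class_weight_le i _ (fun _ => zero_le_one) (fun _ => le_rfl) τ
    have hsub : pr (fun h : V → Fin k =>
      4 * (degSum H : ℝ) / k ^ 2 + 4 * n * τ / k + τ ^ 2 <
      degSum (restrictTo H {v | h v = i})) ≤ pr (fun h => (∃ v, A v h) ∨ (B h ∨ B' h)) := by
      refine pr_mono fun h hh => ?_
      by_contra hcon
      simp only [not_or, not_exists] at hcon
      obtain ⟨hA, hB, hB'⟩ := hcon
      refine absurd hh (not_lt.2 ?_)
      have h1 : ∀ v, ((restrictTo H {v | h v = i}).neighborSet v).ncard ≤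
          if h v = i then (2 / k * ((H.neighborSet v).ncard : ℝ) + τ) else 0 := by
        intro v
        split_ifs with hv
        · have := not_lt.1 (hA v)
          rw [← ncard_eq_sum] at this
          calc _ = _ := ncard_eq_sum ((restrictTo H {v | h v = i}).neighborSet v)
            _ ≤ ∑ u, if h u = i then (if u ∈ H.neighborSet v then (1 : ℝ) else 0) else 0 := by
              refine Finset.sum_le_sum fun u _ => ?_
              simp only [restrictTo, SimpleGraph.mem_neighborSet, Set.mem_ofPred_eq]
              by_cases hu : h u = i <;> by_cases hu' : H.Adj v u <;> simp [hu, hu', hv]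
            _ ≤ _ := this
            _ = _ := by ring
        · have : (restrictTo H {v | h v = i}).neighborSet v = ∅ := by
            ext u; simp [restrictTo, hv]
          simp [this]
      have h2 : (degSum (restrictTo H {v | h v = i}) : ℝ) ≤
          2 / k * (∑ u, if h u = i then ((H.neighborSet u).ncard : ℝ) else 0) +
          τ * ∑ u, if h u = i then (1 : ℝ) else 0 := by
        unfold degSum
        push_cast
        refine (Finset.sum_le_sum fun v _ => h1 v).trans_eq ?_
        rw [Finset.mul_sum, Finset.mul_sum, ← Finset.sum_add_distrib]
        refine Finset.sum_congr rfl fun v _ => ?_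
        split_ifs <;> ring
      have h3 : (∑ u, if h u = i then ((H.neighborSet u).ncard : ℝ) else 0) ≤
          2 * degSum H / k + n * τ := by
        have := not_lt.1 hB
        rcases Nat.eq_zero_or_pos n with h0 | h0
        · have : IsEmpty V := Fintype.card_eq_zero_iff.1 h0
          simp [degSum, h0]
        · have hn0 : (0 : ℝ) < n := by exact_mod_cast h0
          have h4 : ∀ u, (if h u = i then ((H.neighborSet u).ncard : ℝ) / n else 0) =
              (if h u = i then ((H.neighborSet u).ncard : ℝ) else 0) / n := fun u => by
            split_ifs <;> simp
          simp_rw [h4] at this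
          rw [← Finset.sum_div, ← Finset.sum_div, div_le_iff₀ hn0] at this
          unfold degSum
          push_cast
          refine this.trans_eq ?_
          field_simp
      have h5 : (∑ u, if h u = i then (1 : ℝ) else 0) ≤ 2 * n / k + τ := by
        have := not_lt.1 hB'
        simpa [hn] using this
      calc _ ≤ _ := h2
        _ ≤ 2 / k * (2 * degSum H / k + n * τ) + τ * (2 * n / k + τ) := by gcongr
        _ = _ := by field_simp; ring
    refine hsub.trans ((pr_or_le _ _).trans ?_)
    have h6 := pr_exists_le_card_mul A hA
    have h7 := pr_or_le B B'
    have : ((n : ℝ) + 2) * Real.exp (-τ) =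
      n * Real.exp (-τ) + (Real.exp (-τ) + Real.exp (-τ)) := by ring
    rw [this]
    gcongr
    exact h7.trans (by gcongr)
  have := pr_exists_le_card_mul _ key
  simpa using this

end Restrict

/-! ### McDiarmid's inequality by exponential moments -/

section BoundedDifferences

/-- Hoeffding's lemma in a weak form: the centred variable lies in [-L, L], where convexity puts the
exponential below its chord. The linear part of the chord averages to 0, and cosh t ≤ e^{t²/2}. -/
theorem expect_exp_sub_expect_le {X : Type*} [Fintype X] [Nonempty X] (g : X → ℝ) {L : ℝ}
    (hL : 0 < L) (hg : ∀ x y, g x - g y ≤ L) (s : ℝ) :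
    𝔼 x, Real.exp (s * (g x - 𝔼 y, g y)) ≤ Real.exp (s ^ 2 * L ^ 2 / 2) := by
  set m := 𝔼 y, g y with hm
  have h0 : 𝔼 x, (g x - m) = 0 := by
    rw [Finset.expect_sub_distrib, Fintype.expect_const]; simp [hm]
  have hb : ∀ x, |(g x - m) / L| ≤ 1 := by
    intro x
    rw [abs_div, abs_of_pos hL, div_le_one hL, abs_le]
    constructor
    · have : m ≤ g x + L := by
        rw [hm]
        exact (Finset.expect_le_expect fun y _ => (by linarith [hg y x] : g y ≤ g x + L)).trans_eq
          (Fintype.expect_const _)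
      linarith
    · have : g x - L ≤ m := by
        rw [hm]
        exact (Fintype.expect_const (g x - L)).symm.trans_le
          (Finset.expect_le_expect fun y _ => (by linarith [hg x y] : g x - L ≤ g y))
      linarith
  calc 𝔼 x, Real.exp (s * (g x - m))
      ≤ 𝔼 x, (Real.cosh (s * L) + (g x - m) * (Real.sinh (s * L) / L)) := by
        refine Finset.expect_le_expect fun x _ => ?_
        have := Real.exp_mul_le_cosh_add_mul_sinh (hb x) (s * L)
        calc _ = Real.exp ((g x - m) / L * (s * L)) := by congr 1; field_simp
          _ ≤ _ := this
          _ = _ := by ring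
    _ = Real.cosh (s * L) := by
        rw [Finset.expect_add_distrib, Fintype.expect_const, ← Finset.expect_mul, h0]; simp
    _ ≤ Real.exp ((s * L) ^ 2 / 2) := Real.cosh_le_exp_half_sq _
    _ = _ := by rw [mul_pow]

/-- The exponential moment bound behind McDiarmid's inequality. -/
theorem expect_exp_sub_expect_le_of_bounded_differences {ι X : Type*} [Fintype ι] [DecidableEq ι]
    [Fintype X] [Nonempty X] {L : ℝ} (hL : 0 < L) (s : ℝ) (S : Finset ι) (f : (ι → X) → ℝ)
    (hf : ∀ ω a x y, f (Function.update ω a x) - f (Function.update ω a y) ≤ L)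
    (hS : ∀ ω, ∀ a ∉ S, ∀ x, f (Function.update ω a x) = f ω) :
    𝔼 ω, Real.exp (s * (f ω - 𝔼 ω', f ω')) ≤ Real.exp (s ^ 2 * L ^ 2 / 2 * S.card) := by
  induction S using Finset.induction_on generalizing f with
  | empty =>
    have hc : ∀ ω ω', f ω = f ω' := by
      intro ω ω'
      have : ∀ T : Finset ι, f (T.piecewise ω' ω) = f ω := by
        intro T
        induction T using Finset.induction_on with
        | empty => simp
        | insert a T ha ih =>
          rw [Finset.piecewise_insert, hS _ a (by simp), ih]
      have h := this Finset.univ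
      rw [Finset.piecewise_univ] at h
      exact h.symm
    have : ∀ ω, f ω - 𝔼 ω', f ω' = 0 := by
      intro ω
      rw [Finset.expect_congr rfl fun ω' _ => hc ω' ω, Fintype.expect_const, sub_self]
    simp [this]
  | insert a S ha ih =>
    -- Averaging out the coordinate `a` gives one step of the Doob martingale. The increment `f -
    -- f₁` is handled by the one-variable bound, and `f₁` inherits the bounded differences while
    -- depending on one coordinate fewer.
    set f₁ : (ι → X) → ℝ := fun ω => 𝔼 x, f (Function.update ω a x) with hf₁
    have hE : 𝔼 ω, f₁ ω = 𝔼 ω, f ω := (expect_resample a f).symm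
    have h1 := ih f₁ (fun ω b x y => by
      simp only [hf₁]
      rw [← Finset.expect_sub_distrib]
      refine (Finset.expect_le_expect (g := fun _ => L) fun z _ => ?_).trans_eq
        (Fintype.expect_const L)
      by_cases hb : b = a
      · subst hb; simp [hL.le]
      · rw [Function.update_comm hb, Function.update_comm hb]
        exact hf _ _ _ _)
      (fun ω b hb x => by
        simp only [hf₁]
        refine Finset.expect_congr rfl fun z _ => ?_
        by_cases hba : b = a
        · subst hba; simp
        · rw [Function.update_comm hba]
          exact hS _ b (by simp [hba, hb]) _)
    rw [hE] at h1
    set m := 𝔼 ω', f ω' with hm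
    have hup : ∀ ω x, f₁ (Function.update ω a x) = f₁ ω := fun ω x => by simp [hf₁]
    rw [expect_resample a]
    calc 𝔼 ω, 𝔼 x, Real.exp (s * (f (Function.update ω a x) - m))
        = 𝔼 ω, (𝔼 x, Real.exp (s * (f (Function.update ω a x) - f₁ ω))) *
            Real.exp (s * (f₁ ω - m)) := by
          refine Finset.expect_congr rfl fun ω _ => ?_
          rw [Finset.expect_mul]
          refine Finset.expect_congr rfl fun x _ => ?_
          rw [← Real.exp_add]; congr 1; ring
      _ ≤ 𝔼 ω, Real.exp (s ^ 2 * L ^ 2 / 2) * Real.exp (s * (f₁ ω - m)) := by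
          refine Finset.expect_le_expect fun ω _ => ?_
          gcongr
          exact expect_exp_sub_expect_le (fun x => f (Function.update ω a x)) hL
            (fun x y => hf ω a x y) s
      _ ≤ Real.exp (s ^ 2 * L ^ 2 / 2) * Real.exp (s ^ 2 * L ^ 2 / 2 * S.card) := by
          rw [← Finset.mul_expect]; gcongr
      _ = _ := by
          rw [← Real.exp_add, Finset.card_insert_of_notMem ha]; congr 1; push_cast; ring

/-- McDiarmid's bounded differences inequality (with a slightly worse constant). -/
theorem pr_gt_expect_add_le {ι X : Type*} [Fintype ι] [DecidableEq ι] [Nonempty ι]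
    [Fintype X] [Nonempty X] {L : ℝ} (hL : 0 < L) (f : (ι → X) → ℝ)
    (hf : ∀ ω a x y, f (Function.update ω a x) - f (Function.update ω a y) ≤ L) {τ : ℝ}
    (hτ : 0 ≤ τ) :
    pr (fun ω => 𝔼 ω', f ω' + L * Real.sqrt (2 * Fintype.card ι * τ) < f ω) ≤ Real.exp (-τ) := by
  set n : ℝ := (Fintype.card ι : ℝ) with hn
  have hn0 : 0 < n := by rw [hn]; exact_mod_cast Fintype.card_pos
  set q := Real.sqrt (2 * n * τ) with hq
  have hq2 : q ^ 2 = 2 * n * τ := Real.sq_sqrt (by positivity)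
  have hq0 : 0 ≤ q := Real.sqrt_nonneg _
  -- This choice makes the moment bound e^τ, while the deviation L·q contributes the exponent 2τ.
  set s := q / (n * L) with hs
  have hs0 : 0 ≤ s := by positivity
  have h1 := expect_exp_sub_expect_le_of_bounded_differences hL s Finset.univ f hf
    (fun ω a ha => absurd (Finset.mem_univ a) ha)
  rw [Finset.card_univ, ← hn] at h1
  have h2 : s ^ 2 * L ^ 2 / 2 * n = τ := by
    rw [hs]; field_simp; rw [hq2]; ring
  rw [h2] at h1
  have := pr_le_exp_of_expect_exp_le (p := fun ω => 𝔼 ω', f ω' + L * q < f ω) (t := 2 * τ)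
    (fun ω => (Real.exp_pos _).le) (fun ω h => by
      refine Real.exp_le_exp.2 ?_
      have h3 : s * (L * q) = 2 * τ := by
        rw [hs]; field_simp; rw [hq2]; ring
      rw [← h3]
      gcongr
      linarith) h1
  refine this.trans_eq ?_
  rw [← Real.exp_add]; congr 1; ring

end BoundedDifferences

/-! ### Edges left between colour classes after greedy matching in each class -/

section Partition

set_option linter.unusedSectionVars false

variable {V : Type*}

/-- The two ends of a pair of vertices. -/
def pairEnds (e : V × V) : Set V := {e.1, e.2}

/-- Two initial sets that differ in at most one vertex lead to sets of free vertices that differ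
in at most one vertex. -/
theorem greedyFree_pairEnds_lipschitz (act : V × V → Prop) (l : List (V × V)) (F F' : Set V)
    (h : ∃ y, ∀ u, u ≠ y → (u ∈ F ↔ u ∈ F')) :
    ∃ y, ∀ u, u ≠ y → (u ∈ greedyFree pairEnds pairEnds act l F ↔
      u ∈ greedyFree pairEnds pairEnds act l F') := by
  classical
  induction l generalizing F F' with
  | nil => exact h
  | cons e l ih =>
    simp only [greedyFree]
    apply ih
    obtain ⟨y, hy⟩ := h
    obtain ⟨b, c⟩ := e
    have hsub : ∀ S : Set V, pairEnds (b, c) ⊆ S ↔ b ∈ S ∧ c ∈ S := fun S => by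
      simp [pairEnds, Set.insert_subset_iff]
    have hmem : ∀ u, u ∈ pairEnds (b, c) ↔ u = b ∨ u = c := fun u => by simp [pairEnds]
    simp only [hsub]
    by_cases ha : act (b, c)
    swap
    · exact ⟨y, fun u hu => by simp only [ha, false_and, if_false]; exact hy u hu⟩
    by_cases h1 : b ∈ F ∧ c ∈ F <;> by_cases h2 : b ∈ F' ∧ c ∈ F'
    · exact ⟨y, fun u hu => by simp [ha, h1, h2, hy u hu]⟩
    -- Only one of the two runs takes the pair. The other run must lack the end at which the sets
    -- differed, so after the removal the sets agree there and the discrepancy has moved to the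
    -- other end.
    · refine ⟨if y = b then c else b, fun u hu => ?_⟩
      simp only [ha, h1, h2, and_self, if_true, and_false, if_false, Set.mem_sdiff, hmem]
      have := hy b; have := hy c; have := hy u
      grind
    · refine ⟨if y = b then c else b, fun u hu => ?_⟩
      simp only [ha, h1, h2, and_self, if_true, and_false, if_false, Set.mem_sdiff, hmem]
      have := hy b; have := hy c; have := hy u
      grind
    · exact ⟨y, fun u hu => by simp only [ha, h1, h2, and_false, if_false]; exact hy u hu⟩

variable [Fintype V] [DecidableEq V]

section Flip

variable {k : ℕ} (i i' : Fin k)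

/-- Exchange the colours `i` and `i'` on the vertices of `T`. -/
def flipOn (T : Finset V) (h : V → Fin k) : V → Fin k :=
  fun v => if v ∈ T then Equiv.swap i i' (h v) else h v

theorem flipOn_flipOn (T : Finset V) (h : V → Fin k) : flipOn i i' T (flipOn i i' T h) = h := by
  funext v; simp only [flipOn]; split_ifs <;> simp

theorem expect_flipOn (T : Finset V) (f : (V → Fin k) → ℝ) :
    𝔼 h, f (flipOn i i' T h) = 𝔼 h, f h :=
  Fintype.expect_equiv ⟨flipOn i i' T, flipOn i i' T, flipOn_flipOn i i' T, flipOn_flipOn i i' T⟩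
    _ _ fun _ => rfl

theorem flipOn_singleton_comp {a : V} {T : Finset V} (ha : a ∉ T) (h : V → Fin k) :
    flipOn i i' T (flipOn i i' {a} h) = flipOn i i' (insert a T) h := by
  funext v
  simp only [flipOn, Finset.mem_insert, Finset.mem_singleton]
  by_cases hv : v = a
  · subst hv; simp [ha]
  · simp [hv]

theorem flipOn_insert_comp {a : V} {T : Finset V} (ha : a ∉ T) (h : V → Fin k) :
    flipOn i i' (insert a T) (flipOn i i' {a} h) = flipOn i i' T h := by
  rw [← flipOn_singleton_comp i i' ha, flipOn_flipOn]

end Flip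

/-- Two functions that vanish off one vertex and are bounded by one have small product along the
edges of a graph. -/
theorem edge_form_le_one (H : SimpleGraph V) [DecidableRel H.Adj] {x z : V → ℝ}
    (hx : ∃ y, ∀ u, u ≠ y → x u = 0) (hz : ∃ y, ∀ u, u ≠ y → z u = 0)
    (hx1 : ∀ u, |x u| ≤ 1) (hz1 : ∀ u, |z u| ≤ 1) :
    ∑ u, ∑ v, (if H.Adj u v then x u * z v else 0) ≤ 1 := by
  obtain ⟨y, hy⟩ := hx
  obtain ⟨y', hy'⟩ := hz
  rw [Finset.sum_eq_single y, Finset.sum_eq_single y']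
  · split_ifs
    · have h := mul_le_one₀ (hx1 y) (abs_nonneg _) (hz1 y')
      rw [← abs_mul] at h
      exact (le_abs_self _).trans h
    · exact zero_le_one
  · intro v _ hv; simp [hy' v hv]
  · simp
  · intro u _ hu; simp [hy u hu]
  · simp

variable (H : SimpleGraph V) [DecidableRel H.Adj] (U : Set V → Set V)

open Classical in
/-- Indicator of the free vertices in a colour class. -/
noncomputable def classFree {k : ℕ} (i : Fin k) (h : V → Fin k) (u : V) : ℝ :=
  if u ∈ U {v | h v = i} then 1 else 0

variable {U}

theorem classFree_abs_sub_le {k : ℕ} (i : Fin k) (h h' : V → Fin k) (u : V) :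
    |classFree U i h u - classFree U i h' u| ≤ 1 := by
  unfold classFree; split_ifs <;> simp

theorem classFree_sub_eq_zero (hU : ∀ W W' : Set V, (∃ y, ∀ u, u ≠ y → (u ∈ W ↔ u ∈ W')) →
      ∃ y, ∀ u, u ≠ y → (u ∈ U W ↔ u ∈ U W')) {k : ℕ} (i : Fin k) {h h' : V → Fin k} {a : V}
    (ha : ∀ v, v ≠ a → h v = h' v) :
    ∃ y, ∀ u, u ≠ y → classFree U i h u - classFree U i h' u = 0 := by
  obtain ⟨y, hy⟩ := hU {v | h v = i} {v | h' v = i} ⟨a, fun u hu => by simp [ha u hu]⟩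
  classical
  refine ⟨y, fun u hu => ?_⟩
  unfold classFree
  rw [sub_eq_zero]
  exact if_congr (hy u hu) rfl rfl

/-- An interpolation argument. Exchanging the colours `i` and `i'` on a set T preserves the
distribution of the colouring. For T empty the form compares class `i` with itself and vanishes by
independence; for T everything it is the form to be bounded. Enlarging T by one vertex raises the
expectation by at most 1/k. -/
theorem expect_classFree_form_le (hU : ∀ W W' : Set V, (∃ y, ∀ u, u ≠ y → (u ∈ W ↔ u ∈ W')) →
      ∃ y, ∀ u, u ≠ y → (u ∈ U W ↔ u ∈ U W'))
    (hind : ∀ W, ∀ u ∈ U W, ∀ v ∈ U W, ¬ H.Adj u v) {k : ℕ} {i i' : Fin k} (hii : i ≠ i') :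
    𝔼 h : V → Fin k, ∑ u, ∑ v, (if H.Adj u v then classFree U i h u * classFree U i' h v else 0)
      ≤ Fintype.card V / k := by
  classical
  have : NeZero k := ⟨i.pos.ne'⟩
  have hk : (0 : ℝ) < k := by exact_mod_cast i.pos
  let p : (V → Fin k) → V → ℝ := classFree U i
  let B : (V → ℝ) → (V → ℝ) → ℝ := fun x z => ∑ u, ∑ v, if H.Adj u v then x u * z v else 0
  have hBl : ∀ x x' z, B x z - B x' z = B (fun u => x u - x' u) z := fun x x' z => by
    simp only [B, ← Finset.sum_sub_distrib]
    refine Finset.sum_congr rfl fun u _ => Finset.sum_congr rfl fun v _ => ?_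
    split_ifs <;> ring
  have hBr : ∀ x z z', B x z - B x z' = B x (fun u => z u - z' u) := fun x x' z => by
    simp only [B, ← Finset.sum_sub_distrib]
    refine Finset.sum_congr rfl fun u _ => Finset.sum_congr rfl fun v _ => ?_
    split_ifs <;> ring
  let fl := flipOn (V := V) i i'
  let Ψ : Finset V → ℝ := fun T => 𝔼 h, B (p h) (p (fl T h))
  have hflip : ∀ (a : V) (h : V → Fin k), h a ≠ i → h a ≠ i' → fl {a} h = h := by
    intro a h h1 h2
    funext v
    simp only [fl, flipOn, Finset.mem_singleton]
    split_ifs with hv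
    · subst hv; exact Equiv.swap_apply_of_ne_of_ne h1 h2
    · rfl
  have hstep : ∀ (T : Finset V) (a : V), a ∉ T → Ψ (insert a T) ≤ Ψ T + 1 / k := by
    intro T a ha
    have h1 : Ψ (insert a T) - Ψ T =
        𝔼 h, B (p h) (fun u => p (fl (insert a T) h) u - p (fl T h) u) := by
      simp only [Ψ, ← Finset.expect_sub_distrib, hBr]
    have h2 : Ψ (insert a T) - Ψ T =
        𝔼 h, B (p (fl {a} h)) (fun u => p (fl T h) u - p (fl (insert a T) h) u) := by
      rw [h1, ← expect_flipOn i i' {a}]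
      simp only [fl, flipOn_singleton_comp i i' ha, flipOn_insert_comp i i' ha]
    -- The increment is written twice, the second time after the substitution exchanging the colours
    -- at `a`. The sum is a form in differences in both arguments, each supported on one vertex by
    -- the Lipschitz property, so it is at most 1. It vanishes unless `a` has one of the two
    -- colours, which has probability 2/k.
    have h3 : 2 * (Ψ (insert a T) - Ψ T) = 𝔼 h, B (fun u => p h u - p (fl {a} h) u)
        (fun u => p (fl (insert a T) h) u - p (fl T h) u) := by
      rw [two_mul]
      nth_rewrite 1 [h1]
      rw [h2, ← Finset.expect_add_distrib]
      refine Finset.expect_congr rfl fun h _ => ?_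
      rw [← hBl, sub_eq_add_neg]
      congr 1
      simp only [B, ← Finset.sum_neg_distrib]
      refine Finset.sum_congr rfl fun u _ => Finset.sum_congr rfl fun v _ => ?_
      split_ifs <;> ring
    have h4 : ∀ h : V → Fin k, B (fun u => p h u - p (fl {a} h) u)
        (fun u => p (fl (insert a T) h) u - p (fl T h) u) ≤
        (if h a = i then (1 : ℝ) else 0) + (if h a = i' then (1 : ℝ) else 0) := by
      intro h
      by_cases hc : h a = i ∨ h a = i'
      · have h5 : B (fun u => p h u - p (fl {a} h) u)
            (fun u => p (fl (insert a T) h) u - p (fl T h) u) ≤ 1 := by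
          refine edge_form_le_one H ?_ ?_ (fun u => classFree_abs_sub_le _ _ _ _)
            (fun u => classFree_abs_sub_le _ _ _ _)
          · exact classFree_sub_eq_zero hU i (a := a) fun v hv => by simp [fl, flipOn, hv]
          · exact classFree_sub_eq_zero hU i (a := a) fun v hv => by simp [fl, flipOn, hv]
        rcases hc with hc | hc
        · simpa [hc, hii] using h5
        · simpa [hc, hii.symm] using h5
      · rw [not_or] at hc
        rw [hflip a h hc.1 hc.2]
        simp [B, hc.1, hc.2]
    have h6 : ∀ j : Fin k, 𝔼 h : V → Fin k, (if h a = j then (1 : ℝ) else 0) = 1 / k := by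
      intro j
      rw [expect_resample a]
      simp only [Function.update_self, expect_fin_ite_eq]
      rw [Fintype.expect_const]; ring
    have h7 : 2 * (Ψ (insert a T) - Ψ T) ≤ 1 / k + 1 / k := by
      rw [h3]
      refine (Finset.expect_le_expect fun h _ => h4 h).trans_eq ?_
      rw [Finset.expect_add_distrib, h6, h6]
    linarith
  have hΨ : ∀ T : Finset V, Ψ T ≤ T.card / k := by
    intro T
    induction T using Finset.induction_on with
    | empty =>
      have : ∀ h : V → Fin k, B (p h) (p (fl ∅ h)) = 0 := by
        intro h
        have : fl ∅ h = h := by funext v; simp [fl, flipOn]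
        rw [this]
        refine Finset.sum_eq_zero fun u _ => Finset.sum_eq_zero fun v _ => ?_
        split_ifs with huv
        · simp only [p, classFree]
          split_ifs with hu hv
          · exact absurd huv (hind _ u hu v hv)
          all_goals simp
        · rfl
      simp [Ψ, this]
    | insert a T ha ih =>
      rw [Finset.card_insert_of_notMem ha]
      refine (hstep T a ha).trans ?_
      push_cast
      rw [add_div]
      gcongr
  have hlast := hΨ Finset.univ
  rw [Finset.card_univ] at hlast
  refine le_trans (le_of_eq ?_) hlast
  refine Finset.expect_congr rfl fun h _ => ?_
  have : p (fl Finset.univ h) = classFree U i' h := by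
    funext u
    simp only [p, classFree, fl, flipOn, Finset.mem_univ, if_true]
    have : {v | Equiv.swap i i' (h v) = i} = {v | h v = i'} := by
      ext v
      simp only [Set.mem_ofPred_eq]
      rw [Equiv.swap_apply_eq_iff, Equiv.swap_apply_left]
    rw [this]
  rw [this]

/-- The vertices that are free within their colour class. -/
def freeInClass (U : Set V → Set V) {k : ℕ} (h : V → Fin k) : Set V := {v | v ∈ U {u | h u = h v}}

theorem degSum_restrictTo_eq (F : Set V) [DecidablePred (· ∈ F)] :
    (degSum (restrictTo H F) : ℝ) = ∑ u, ∑ v, if H.Adj u v then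
      (if u ∈ F then (1 : ℝ) else 0) * (if v ∈ F then 1 else 0) else 0 := by
  classical
  unfold degSum
  push_cast
  refine Finset.sum_congr rfl fun u _ => ?_
  rw [ncard_eq_sum]
  refine Finset.sum_congr rfl fun v _ => ?_
  by_cases h1 : H.Adj u v <;> by_cases h2 : u ∈ F <;> by_cases h3 : v ∈ F <;>
    simp [restrictTo, h1, h2, h3]

/-- Few edges are expected between vertices that are free within the classes of a random
colouring. -/
theorem expect_degSum_freeInClass_le (hU : ∀ W W' : Set V, (∃ y, ∀ u, u ≠ y → (u ∈ W ↔ u ∈ W')) →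
      ∃ y, ∀ u, u ≠ y → (u ∈ U W ↔ u ∈ U W'))
    (hind : ∀ W, ∀ u ∈ U W, ∀ v ∈ U W, ¬ H.Adj u v) {k : ℕ} :
    𝔼 h : V → Fin k, (degSum (restrictTo H (freeInClass U h)) : ℝ) ≤ Fintype.card V * k := by
  classical
  rcases Nat.eq_zero_or_pos k with hk | hk
  · subst hk
    rcases isEmpty_or_nonempty V with hV | hV
    · simp [degSum]
    · have : IsEmpty (V → Fin 0) := ⟨fun f => (f hV.some).elim0⟩
      simp
  have hk0 : (0 : ℝ) < k := by exact_mod_cast hk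
  -- An edge between two free vertices is counted at the pair of colours of its ends. There are k²
  -- pairs of colours, each contributing at most n/k.
  have h1 : ∀ h : V → Fin k, (degSum (restrictTo H (freeInClass U h)) : ℝ) ≤ ∑ i, ∑ i',
      ∑ u, ∑ v, (if H.Adj u v then classFree U i h u * classFree U i' h v else 0) := by
    intro h
    have hnn : ∀ i u, 0 ≤ classFree U i h u := fun i u => by
      unfold classFree; split_ifs <;> norm_num
    have hmem : ∀ u, (if u ∈ freeInClass U h then (1 : ℝ) else 0) = classFree U (h u) h u :=
      fun u => by unfold classFree; exact if_congr Iff.rfl rfl rfl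
    rw [degSum_restrictTo_eq]
    have hcomm : ∑ i, ∑ i', ∑ u, ∑ v,
        (if H.Adj u v then classFree U i h u * classFree U i' h v else 0) =
        ∑ u, ∑ v, ∑ i, ∑ i',
          (if H.Adj u v then classFree U i h u * classFree U i' h v else 0) := by
      simp_rw [Finset.sum_comm (s := (Finset.univ : Finset (Fin k))) (t := (Finset.univ : Finset V))]
    rw [hcomm]
    refine Finset.sum_le_sum fun u _ => Finset.sum_le_sum fun v _ => ?_
    by_cases huv : H.Adj u v
    · simp only [huv, if_true, hmem]
      have h3 := Finset.single_le_sum (f := fun i' => classFree U (h u) h u * classFree U i' h v)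
        (fun i' _ => mul_nonneg (hnn _ _) (hnn _ _)) (Finset.mem_univ (h v))
      have h4 := Finset.single_le_sum
        (f := fun i => ∑ i', classFree U i h u * classFree U i' h v)
        (fun i _ => Finset.sum_nonneg fun i' _ => mul_nonneg (hnn _ _) (hnn _ _))
        (Finset.mem_univ (h u))
      exact h3.trans h4
    · simp [huv]
  refine (Finset.expect_le_expect fun h _ => h1 h).trans ?_
  rw [Finset.expect_sum_comm]
  simp_rw [Finset.expect_sum_comm Finset.univ (Finset.univ : Finset (Fin k))]
  have h2 : ∀ i i' : Fin k, 𝔼 h : V → Fin k, ∑ u, ∑ v,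
      (if H.Adj u v then classFree U i h u * classFree U i' h v else 0) ≤
      (Fintype.card V : ℝ) / k := by
    intro i i'
    by_cases hii : i = i'
    · subst hii
      refine (Finset.expect_le_expect (g := fun _ => (0 : ℝ)) fun h _ => ?_).trans ?_
      · refine (Finset.sum_eq_zero fun u _ => Finset.sum_eq_zero fun v _ => ?_).le
        split_ifs with huv
        · simp only [classFree]
          split_ifs with hu hv
          · exact absurd huv (hind _ u hu v hv)
          all_goals simp
        · rfl
      · rw [Finset.expect_const_zero]; positivity
    · exact expect_classFree_form_le H hU hind hii
  refine (Finset.sum_le_sum fun i _ => Finset.sum_le_sum fun i' _ => h2 i i').trans_eq ?_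
  simp
  field_simp

end Partition

/-! ### Composable protocols and their compilation to algorithms -/

section CongestedClique

variable {n b : ℕ}

/-- `CliqueComputable n b T F`: a `T`-round protocol with messages of `b` bits transforms local
states according to `F`. -/
inductive CliqueComputable (n b : ℕ) :
    ℕ → {S S' : Type} → ((Fin n → S) → (Fin n → S')) → Prop
  | locally {S S' : Type} (g : Fin n → S → S') :
      CliqueComputable n b 0 (fun (s : Fin n → S) v => g v (s v))
  | round {S S' S'' : Type} {T : ℕ} (send : Fin n → S → Fin n → (Fin b → Bool))
      (recv : Fin n → S → (Fin n → (Fin b → Bool)) → S'') {F : (Fin n → S'') → (Fin n → S')}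
      (h : CliqueComputable n b T F) :
      CliqueComputable n b (T + 1)
        (fun (s : Fin n → S) => F fun v => recv v (s v) fun u => send u (s u) v)

theorem CliqueComputable.comp_locally {S S' S'' : Type} {T : ℕ} (g : Fin n → S → S')
    {F : (Fin n → S') → (Fin n → S'')} (h : CliqueComputable n b T F) :
    CliqueComputable n b T (fun s => F fun v => g v (s v)) := by
  cases h with
  | locally g' => exact .locally fun v s => g' v (g v s)
  | round send recv h => exact .round (fun v s => send v (g v s)) (fun v s => recv v (g v s)) h

theorem CliqueComputable.comp {S S' S'' : Type} {T T' : ℕ} {F : (Fin n → S) → (Fin n → S')}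
    {F' : (Fin n → S') → (Fin n → S'')} (h : CliqueComputable n b T F)
    (h' : CliqueComputable n b T' F') : CliqueComputable n b (T + T') (fun s => F' (F s)) := by
  induction h with
  | locally g => rw [Nat.zero_add]; exact h'.comp_locally g
  | round send recv _ ih => rw [Nat.succ_add]; exact .round send recv (ih h')

/-- A uniform state machine run by all nodes. -/
structure CliqueMachine (n b : ℕ) (S Out : Type) where
  State : Type
  enc : Fin n → S → State
  send : ℕ → State → Fin n → (Fin b → Bool)
  receive : ℕ → State → (Fin n → (Fin b → Bool)) → State
  output : State → Out

namespace CliqueMachine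

variable {S S' S'' Out : Type}

/-- The states after some rounds. -/
def run (m : CliqueMachine n b S Out) (s : Fin n → S) : ℕ → Fin n → m.State
  | 0 => fun v => m.enc v (s v)
  | t + 1 => fun v => m.receive t (m.run s t v) fun u => m.send t (m.run s t u) v

/-- The machine that executes one more round before the given one. -/
def prepend (m : CliqueMachine n b S'' Out) (send : Fin n → S → Fin n → (Fin b → Bool))
    (recv : Fin n → S → (Fin n → (Fin b → Bool)) → S'') : CliqueMachine n b S Out where
  State := (Fin n × S) ⊕ m.State
  enc v s := .inl (v, s)
  send t st := match t, st with
    | 0, .inl (v, s) => send v s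
    | t + 1, .inr st => m.send t st
    | _, _ => fun _ _ => false
  receive t st msg := match t, st with
    | 0, .inl (v, s) => .inr (m.enc v (recv v s msg))
    | t + 1, .inr st => .inr (m.receive t st msg)
    | _, st => st
  output st := match st with
    | .inl (v, s) => m.output (m.enc v (recv v s fun _ _ => false))
    | .inr st => m.output st

theorem run_prepend (m : CliqueMachine n b S'' Out) (send : Fin n → S → Fin n → (Fin b → Bool))
    (recv : Fin n → S → (Fin n → (Fin b → Bool)) → S'') (s : Fin n → S) (t : ℕ) :
    (m.prepend send recv).run s (t + 1) =
      fun v => .inr (m.run (fun v => recv v (s v) fun u => send u (s u) v) t v) := by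
  induction t with
  | zero => rfl
  | succ t ih =>
    funext v
    rw [run, ih]
    rfl

/-- The algorithm that runs a machine for a number of rounds. -/
def toAlgorithm (m : CliqueMachine n b S Out) (coins T : ℕ)
    (init : Fin n → Set (Fin n) → (Fin coins → Bool) → S) : CongestedCliqueAlgorithm n Out where
  coins := coins
  rounds := T
  bandwidth := b
  State := m.State
  init v N c := m.enc v (init v N c)
  send := m.send
  receive := m.receive
  output := m.output

theorem toAlgorithm_stateAfter (m : CliqueMachine n b S Out) (coins T : ℕ)
    (init : Fin n → Set (Fin n) → (Fin coins → Bool) → S) (G : SimpleGraph (Fin n))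
    (ω : Fin n → Fin coins → Bool) (t : ℕ) :
    (m.toAlgorithm coins T init).stateAfter G ω t =
      m.run (fun v => init v (G.neighborSet v) (ω v)) t := by
  induction t with
  | zero => rfl
  | succ t ih =>
    funext v
    change m.receive t ((m.toAlgorithm coins T init).stateAfter G ω t v)
      (fun u => m.send t ((m.toAlgorithm coins T init).stateAfter G ω t u) v) = _
    rw [ih]
    rfl

end CliqueMachine

/-- Protocols change their state type from round to round and use maps depending on the node,
whereas the model has a single state type and uniform maps. Sum types and storing the identifier in
the state bridge the difference. -/
theorem CliqueComputable.exists_machine {S Out : Type} {T : ℕ} {F : (Fin n → S) → (Fin n → Out)}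
    (h : CliqueComputable n b T F) :
    ∃ m : CliqueMachine n b S Out, ∀ s v, m.output (m.run s T v) = F s v := by
  induction h with
  | @locally S S' g =>
    exact ⟨⟨Fin n × S, fun v s => (v, s), fun _ _ _ _ => false, fun _ st _ => st,
      fun st => g st.1 st.2⟩, fun s v => rfl⟩
  | round send recv _ ih =>
    obtain ⟨m, hm⟩ := ih
    refine ⟨m.prepend send recv, fun s v => ?_⟩
    rw [CliqueMachine.run_prepend]
    exact hm _ v

/-- `CliqueRealizes n b T Φ`: starting from private inputs `x` and a state `s` known to all nodes,
`T` rounds suffice to let all nodes know `Φ x s`. -/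
def CliqueRealizes (n b T : ℕ) {P σ σ' : Type} (Φ : (Fin n → P) → σ → σ') : Prop :=
  ∃ F : (Fin n → P × σ) → (Fin n → P × σ'), CliqueComputable n b T F ∧
    ∀ x s, F (fun v => (x v, s)) = fun v => (x v, Φ x s)

/-- Apply the maps `Φ 0, …, Φ (N - 1)` in turn. -/
def iterateSteps {σ : Type} (Φ : ℕ → σ → σ) : ℕ → σ → σ
  | 0, s => s
  | N + 1, s => Φ N (iterateSteps Φ N s)

namespace CliqueRealizes

variable {P σ σ' σ'' : Type}

theorem comp {T T' : ℕ} {Φ : (Fin n → P) → σ → σ'} {Φ' : (Fin n → P) → σ' → σ''}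
    (h : CliqueRealizes n b T Φ) (h' : CliqueRealizes n b T' Φ') :
    CliqueRealizes n b (T + T') (fun x s => Φ' x (Φ x s)) := by
  obtain ⟨F, hF, hF'⟩ := h
  obtain ⟨E, hE, hE'⟩ := h'
  exact ⟨_, hF.comp hE, fun x s => by rw [hF', hE']⟩

theorem map (g : σ → σ') : CliqueRealizes n b 0 (fun (_ : Fin n → P) s => g s) :=
  ⟨_, .locally fun _ p => (p.1, g p.2), fun _ _ => rfl⟩

theorem iterate {T : ℕ} {Φ : ℕ → (Fin n → P) → σ → σ} (h : ∀ i, CliqueRealizes n b T (Φ i))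
    (N : ℕ) : CliqueRealizes n b (T * N)
      (fun x s => iterateSteps (fun i => Φ i x) N s) := by
  induction N with
  | zero => exact map id
  | succ N ih => exact ih.comp (h N)

end CliqueRealizes

theorem exists_encoding (α : Type) [Fintype α] [Nonempty α] (h : Fintype.card α ≤ 2 ^ b) :
    ∃ (enc : α → (Fin b → Bool)) (dec : (Fin b → Bool) → α), ∀ a, dec (enc a) = a := by
  have : Fintype.card α ≤ Fintype.card (Fin b → Bool) := by simpa using h
  obtain ⟨e⟩ := Function.Embedding.nonempty_of_card_le this
  exact ⟨e, Function.invFun e, Function.leftInverse_invFun e.injective⟩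

/-- One round of messages of a finite type that fits into the bandwidth. -/
theorem CliqueComputable.typed_round {S S' α : Type} [Fintype α] [Nonempty α]
    (hα : Fintype.card α ≤ 2 ^ b) (send : Fin n → S → Fin n → α)
    (recv : Fin n → S → (Fin n → α) → S') :
    CliqueComputable n b 1
      (fun (s : Fin n → S) v => recv v (s v) fun u => send u (s u) v) := by
  obtain ⟨enc, dec, hed⟩ := exists_encoding α hα
  have := CliqueComputable.round (n := n) (b := b) (fun v s w => enc (send v s w))
    (fun v s msg => recv v s fun u => dec (msg u)) (.locally fun _ s => s)
  simpa only [hed] using this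

theorem CliqueRealizes.broadcast {P σ α : Type} [Fintype α] [Nonempty α]
    (hα : Fintype.card α ≤ 2 ^ b) (m : Fin n → P → σ → α) :
    CliqueRealizes n b 1 (fun (x : Fin n → P) s => (s, fun v => m v (x v) s)) :=
  ⟨_, CliqueComputable.typed_round hα (fun v p _ => m v p.1 p.2)
    (fun _ p msg => (p.1, (p.2, msg))), fun _ _ => rfl⟩

/-! ### Routing the items of each group to its destination -/

section Groups

/-- The nodes are split into groups by their destinations; every destination collects the items of
its group, provided that no group has more than `n` items, and computes a result for every member
of the group. -/
noncomputable def groupCompute {β : Type} (dest : Fin n → Fin n) (items : Fin n → Finset (Fin n))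
    (comp : (Fin n → Finset (Fin n)) → Fin n → β) : Option (Fin n → β) :=
  if ∀ i, ∑ v with dest v = i, (items v).card ≤ n then
    some fun v => comp (fun u => if dest u = dest v then items u else ∅) v
  else none

/-- The first slot of a node among the slots of its group. -/
def slotOffset (dest : Fin n → Fin n) (cnt : Fin n → ℕ) (v : Fin n) : ℕ :=
  ∑ u with dest u = dest v ∧ u < v, cnt u

theorem slotOffset_add_le {dest : Fin n → Fin n} {cnt : Fin n → ℕ} {v v' : Fin n}
    (hd : dest v = dest v') (h : v < v') :
    slotOffset dest cnt v + cnt v ≤ slotOffset dest cnt v' := by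
  unfold slotOffset
  rw [add_comm, ← Finset.sum_insert (s := Finset.univ.filter fun u => dest u = dest v ∧ u < v)
    (by simp)]
  refine Finset.sum_le_sum_of_subset fun u hu => ?_
  simp only [Finset.mem_insert, Finset.mem_filter, Finset.mem_univ, true_and] at hu ⊢
  rcases hu with rfl | hu
  · exact ⟨hd, h⟩
  · exact ⟨hu.1.trans hd, hu.2.trans h⟩

theorem slotOffset_add_le_total {dest : Fin n → Fin n} {cnt : Fin n → ℕ} (v : Fin n) :
    slotOffset dest cnt v + cnt v ≤ ∑ u with dest u = dest v, cnt u := by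
  unfold slotOffset
  rw [add_comm, ← Finset.sum_insert (s := Finset.univ.filter fun u => dest u = dest v ∧ u < v)
    (by simp)]
  refine Finset.sum_le_sum_of_subset fun u hu => ?_
  simp only [Finset.mem_insert, Finset.mem_filter, Finset.mem_univ, true_and] at hu ⊢
  rcases hu with rfl | hu
  · rfl
  · exact hu.1

/-- The item that a node sends to slot `q`. -/
noncomputable def slotItem (dest : Fin n → Fin n) (cnt : Fin n → ℕ) (A : Finset (Fin n))
    (v q : Fin n) : Option (Fin n) :=
  if slotOffset dest cnt v ≤ q then A.toList[(q : ℕ) - slotOffset dest cnt v]? else none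

open Classical in
/-- What the holder of a slot forwards to destination `i`. -/
noncomputable def slotForward (dest : Fin n → Fin n) (inbox : Fin n → Option (Fin n))
    (i : Fin n) : Option (Fin n × Fin n) :=
  if h : ∃ p : Fin n × Fin n, dest p.1 = i ∧ inbox p.1 = some p.2 then some h.choose else none

/-- The members of a group occupy consecutive disjoint intervals of slots, and the total is at most
n, so every item has a slot below n and each slot holds at most one item of each group. Hence the
choice made in `slotForward` is forced and no item is lost. -/
theorem exists_slotForward_iff {dest : Fin n → Fin n} {cnt : Fin n → ℕ}
    {items : Fin n → Finset (Fin n)} (hcnt : ∀ v, cnt v = (items v).card)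
    (hok : ∀ i, ∑ v with dest v = i, cnt v ≤ n) (i v u : Fin n) :
    (∃ q, slotForward dest (fun w => slotItem dest cnt (items w) w q) i = some (v, u)) ↔
      dest v = i ∧ u ∈ items v := by
  have hmem : ∀ {v q u : Fin n}, slotItem dest cnt (items v) v q = some u →
      u ∈ items v ∧ slotOffset dest cnt v ≤ q ∧ (q : ℕ) < slotOffset dest cnt v + cnt v := by
    intro v q u h
    unfold slotItem at h
    split_ifs at h with hq
    obtain ⟨hlt, heq⟩ := List.getElem?_eq_some_iff.1 h
    refine ⟨?_, hq, ?_⟩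
    · rw [← heq]; exact Finset.mem_toList.1 (List.getElem_mem hlt)
    · rw [Finset.length_toList, ← hcnt] at hlt; omega
  constructor
  · rintro ⟨q, hq⟩
    unfold slotForward at hq
    split_ifs at hq with h
    have h1 := h.choose_spec
    rw [Option.some.inj hq] at h1
    exact ⟨h1.1, (hmem h1.2).1⟩
  · rintro ⟨hd, hu⟩
    obtain ⟨r, hr, hru⟩ := List.getElem_of_mem (Finset.mem_toList.2 hu)
    have hr' : r < cnt v := by rwa [Finset.length_toList, ← hcnt] at hr
    have htot := (slotOffset_add_le_total (dest := dest) (cnt := cnt) v).trans (hok (dest v))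
    refine ⟨⟨slotOffset dest cnt v + r, by omega⟩, ?_⟩
    set q : Fin n := ⟨slotOffset dest cnt v + r, by omega⟩ with hq
    have hitem : slotItem dest cnt (items v) v q = some u := by
      simp [slotItem, hq, List.getElem?_eq_getElem hr, hru]
    have hex : ∃ p : Fin n × Fin n, dest p.1 = i ∧
        slotItem dest cnt (items p.1) p.1 q = some p.2 := ⟨(v, u), hd, hitem⟩
    unfold slotForward
    rw [dif_pos hex]
    have h1 := hex.choose_spec
    set p := hex.choose with hp
    have h2 := hmem h1.2
    have h3 := hmem hitem
    have hpv : p.1 = v := by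
      rcases lt_trichotomy p.1 v with h | h | h
      · have := slotOffset_add_le (cnt := cnt) (h1.1.trans hd.symm) h; omega
      · exact h
      · have := slotOffset_add_le (cnt := cnt) (hd.trans h1.1.symm) h; omega
    have h4 := h1.2
    rw [hpv, hitem] at h4
    exact congrArg some (Prod.ext hpv (Option.some.inj h4).symm)

theorem CliqueRealizes.groupCompute {P σ β : Type} [Fintype β] [Nonempty β]
    (hn : (n + 1) ^ 2 ≤ 2 ^ b) (hβ : Fintype.card β ≤ 2 ^ b) (dest : σ → Fin n → Fin n)
    (items : Fin n → P → σ → Finset (Fin n))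
    (comp : σ → (Fin n → Finset (Fin n)) → Fin n → β) :
    CliqueRealizes n b 5 (fun (x : Fin n → P) s =>
      (s, groupCompute (dest s) (fun v => items v (x v) s) (comp s))) := by
  classical
  have hle : ∀ {A : Finset (Fin n)}, A.card < n + 1 := fun {A} =>
    Nat.lt_succ_of_le ((Finset.card_le_univ A).trans_eq (Fintype.card_fin n))
  have c1 : Fintype.card (Fin (n + 1)) ≤ 2 ^ b := by
    rw [Fintype.card_fin]; nlinarith
  have c2 : Fintype.card (Option (Fin n)) ≤ 2 ^ b := by
    rw [Fintype.card_option, Fintype.card_fin]; nlinarith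
  have c3 : Fintype.card (Option (Fin n × Fin n)) ≤ 2 ^ b := by
    rw [Fintype.card_option, Fintype.card_prod, Fintype.card_fin]; nlinarith
  let Q : Type := P × σ × (Fin n → ℕ)
  -- The five rounds: counts are announced, which makes the slots and any overload known to all;
  -- items go to the node holding their slot; the holders forward them, labelled with their origin,
  -- to the destinations; the destinations return the results; every node announces its result.
  have r1 := CliqueComputable.typed_round (n := n) (S := P × σ) (S' := Q) c1
    (fun v p _ => ⟨(items v p.1 p.2).card, hle⟩)
    (fun _ p msg => (p.1, p.2, fun v => (msg v : ℕ)))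
  have r2 := CliqueComputable.typed_round (n := n) (S := Q) (S' := Q × (Fin n → Option (Fin n))) c2
    (fun v p q => slotItem (dest p.2.1) p.2.2 (items v p.1 p.2.1) v q)
    (fun _ p msg => (p, msg))
  have r3 := CliqueComputable.typed_round (n := n) (S := Q × (Fin n → Option (Fin n)))
    (S' := Q × (Fin n → Finset (Fin n))) c3
    (fun _ p i => slotForward (dest p.1.2.1) p.2 i)
    (fun _ p msg => (p.1, fun v => Finset.univ.filter fun u => ∃ q, msg q = some (v, u)))
  have r4 := CliqueComputable.typed_round (n := n) (S := Q × (Fin n → Finset (Fin n)))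
    (S' := Q × β) hβ
    (fun _ p v => comp p.1.2.1 p.2 v)
    (fun v p msg => (p.1, msg (dest p.1.2.1 v)))
  have r5 := CliqueComputable.typed_round (n := n) (S := Q × β)
    (S' := P × σ × Option (Fin n → β)) hβ
    (fun _ p _ => p.2)
    (fun _ p msg => (p.1.1, p.1.2.1,
      if ∀ i, ∑ v with dest p.1.2.1 v = i, p.1.2.2 v ≤ n then some msg else none))
  refine ⟨_, (((r1.comp r2).comp r3).comp r4).comp r5, fun x s => ?_⟩
  funext v
  unfold _root_.groupCompute
  simp only [Prod.mk.injEq, true_and]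
  by_cases hok : ∀ i, ∑ v with dest s v = i, (items v (x v) s).card ≤ n
  · rw [if_pos hok, if_pos hok]
    congr 1
    funext w
    congr 1
    funext u
    ext a
    rw [Finset.mem_filter]
    simp only [Finset.mem_univ, true_and]
    rw [exists_slotForward_iff (fun _ => rfl) hok]
    split_ifs with h <;> simp [h]
  · rw [if_neg hok, if_neg hok]

end Groups

end CongestedClique

/-! ### The sampling and partition steps as protocols -/

section Steps

variable {n L : ℕ}

/-- What all nodes know before the edges of a step are collected: the common state, which nodes are
alive, their residual degrees, and a public random colour of every node. -/
structure CliqueInfo (n L : ℕ) (σ : Type) where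
  state : σ
  alive : Fin n → Bool
  degree : Fin n → ℕ
  colour : Fin n → Fin (2 ^ L)

/-- The information gathered at the start of a step, from the neighbourhoods `N`. -/
noncomputable def gatherInfo {σ : Type} (N : Fin n → Set (Fin n)) (z : Fin n → Fin (2 ^ L))
    (alive : Fin n → Bool) (s : σ) : CliqueInfo n L σ where
  state := s
  alive := alive
  degree v := if alive v then {u | alive u ∧ u ∈ N v}.ncard else 0
  colour := z

/-- Three broadcasts (alive bits, residual degrees, colours) and the five rounds of `groupCompute`.
The degrees are broadcast so that all nodes derive the same sampling rate from the degree sum. -/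
theorem cliqueRealizes_step {b : ℕ} {P σ σ' β : Type} [Fintype β] [Nonempty β] (hn0 : 1 ≤ n)
    (hn : (n + 1) ^ 2 ≤ 2 ^ b) (hL : L ≤ b) (hβ : Fintype.card β ≤ 2 ^ b)
    (nb : P → Set (Fin n)) (col : Fin n → P → Fin (2 ^ L)) (alive : Fin n → P → σ → Bool)
    (dest : CliqueInfo n L σ → Fin n → Fin n)
    (items : Fin n → P → CliqueInfo n L σ → Finset (Fin n))
    (comp : CliqueInfo n L σ → (Fin n → Finset (Fin n)) → Fin n → β)
    (fin : CliqueInfo n L σ → Option (Fin n → β) → σ') :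
    CliqueRealizes n b 8 (fun (x : Fin n → P) s =>
      let I := gatherInfo (fun v => nb (x v)) (fun v => col v (x v)) (fun v => alive v (x v) s) s
      fin I (groupCompute (dest I) (fun v => items v (x v) I) (comp I))) := by
  have c0 : Fintype.card Bool ≤ 2 ^ b := by rw [Fintype.card_bool]; nlinarith
  have c1 : Fintype.card (Fin (n + 1)) ≤ 2 ^ b := by rw [Fintype.card_fin]; nlinarith
  have c2 : Fintype.card (Fin (2 ^ L)) ≤ 2 ^ b := by
    rw [Fintype.card_fin]; exact Nat.pow_le_pow_right (by norm_num) hL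
  have r1 := CliqueRealizes.broadcast c0 alive
  have r2 := CliqueRealizes.broadcast (n := n) (P := P) (σ := σ × (Fin n → Bool)) c1
    (fun v p s => ⟨if s.2 v then {u | s.2 u ∧ u ∈ nb p}.ncard else 0, by
      have := ncard_le_card {u | s.2 u ∧ u ∈ nb p}
      rw [Fintype.card_fin] at this
      split_ifs <;> omega⟩)
  have r3 := CliqueRealizes.broadcast (n := n) (P := P)
    (σ := (σ × (Fin n → Bool)) × (Fin n → Fin (n + 1))) c2 (fun v p _ => col v p)
  have r4 := CliqueRealizes.map (n := n) (b := b) (P := P)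
    (σ := ((σ × (Fin n → Bool)) × (Fin n → Fin (n + 1))) × (Fin n → Fin (2 ^ L)))
    (fun s => (⟨s.1.1.1, s.1.1.2, fun v => s.1.2 v, s.2⟩ : CliqueInfo n L σ))
  have r5 := CliqueRealizes.groupCompute hn hβ dest items comp
  have r6 := CliqueRealizes.map (n := n) (b := b) (P := P)
    (σ := CliqueInfo n L σ × Option (Fin n → β)) (fun s => fin s.1 s.2)
  exact ((((r1.comp r2).comp r3).comp r4).comp r5).comp r6

/-- The exponent of the number of classes into which the alive nodes are divided. -/
def classLevel (n τ D : ℕ) : ℕ :=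
  if D ≤ n then 0 else Nat.clog 2 (8 * (Nat.sqrt (D / n) + 1) + 16 * τ)

/-- The exponent of the inverse of the probability with which edges are sampled. -/
def edgeLevel (n D : ℕ) : ℕ :=
  if D ≤ 2 * n then 0 else Nat.clog 2 (4 * (D / n + 1))

section MIS

/-- The vertices that are neither in `S` nor adjacent to `S`. -/
def uncovered (N : Fin n → Set (Fin n)) (S : Set (Fin n)) : Set (Fin n) :=
  {v | v ∉ S ∧ ∀ u ∈ S, u ∉ N v}

/-- The alive nodes in the sampled class. -/
def misSample (τ : ℕ) (I : CliqueInfo n L (Set (Fin n))) : Set (Fin n) :=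
  {v | I.alive v ∧ (I.colour v : ℕ) % 2 ^ classLevel n τ (∑ v, I.degree v) = 0}

-- Both ends report a sampled edge, so the number of items is the degree sum of the sampled graph.
open Classical in
noncomputable def misItems (τ : ℕ) (v : Fin n) (A : Set (Fin n))
    (I : CliqueInfo n L (Set (Fin n))) : Finset (Fin n) :=
  Finset.univ.filter fun u => v ∈ misSample τ I ∧ u ∈ misSample τ I ∧ u ∈ A

open Classical in
/-- The leader's computation: the greedy independent set of the sampled graph. -/
noncomputable def misCompute (τ : ℕ) (I : CliqueInfo n L (Set (Fin n)))
    (J : Fin n → Finset (Fin n)) (v : Fin n) : Bool :=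
  decide (v ∈ greedyChosen (fun u => {u}) (fun u => {u} ∪ J u) (fun u => u ∈ misSample τ I)
    Finset.univ.toList Set.univ)

/-- The value `none` signals an overload and leaves the set unchanged, which keeps it independent in
every outcome. -/
def misUpdate (S : Set (Fin n)) (r : Option (Fin n → Bool)) : Set (Fin n) :=
  match r with
  | some f => S ∪ {v | f v = true}
  | none => S

def toLeader (v : Fin n) : Fin n := ⟨0, v.pos⟩

open Classical in
noncomputable def misInfo (N : Fin n → Set (Fin n)) (z : Fin n → Fin (2 ^ L)) (S : Set (Fin n)) :
    CliqueInfo n L (Set (Fin n)) :=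
  gatherInfo N z (fun v => decide (v ∈ uncovered N S)) S

/-- One step of the independent set algorithm. -/
noncomputable def misStep (τ : ℕ) (N : Fin n → Set (Fin n)) (z : Fin n → Fin (2 ^ L))
    (S : Set (Fin n)) : Set (Fin n) :=
  misUpdate S (groupCompute toLeader (fun v => misItems τ v (N v) (misInfo N z S))
    (misCompute τ (misInfo N z S)))

theorem cliqueRealizes_misStep {b : ℕ} {P : Type} (hn0 : 1 ≤ n) (hn : (n + 1) ^ 2 ≤ 2 ^ b)
    (hL : L ≤ b) (τ : ℕ) (nb : P → Set (Fin n)) (col : Fin n → P → Fin (2 ^ L)) :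
    CliqueRealizes n b 8 (fun (x : Fin n → P) S =>
      misStep τ (fun v => nb (x v)) (fun v => col v (x v)) S) := by
  classical
  have h := cliqueRealizes_step hn0 hn hL (by rw [Fintype.card_bool]; nlinarith) nb col
    (fun v p S => decide (v ∈ uncovered (fun _ => nb p) S)) (fun _ => toLeader)
    (fun v p I => misItems τ v (nb p) I) (misCompute τ) (fun I r => misUpdate I.state r)
  unfold misStep
  exact h

end MIS

section Matching

/-- The nodes that are not matched yet. -/
def unmatched (M : Fin n → Option (Fin n)) : Set (Fin n) := {v | M v = none}

open Classical in
/-- The other end of an edge of `C` at `v`, if any. -/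
noncomputable def partnerIn {V : Type*} (C : Set (V × V)) (v : V) : Option V :=
  if h : ∃ w, (v, w) ∈ C ∨ (w, v) ∈ C then some h.choose else none

/-- The greedy matching among the pairs given by `J`. -/
noncomputable def matchChosen (J : Fin n → Finset (Fin n)) : Set (Fin n × Fin n) :=
  greedyChosen pairEnds pairEnds (fun e => e.2 ∈ J e.1) Finset.univ.toList Set.univ

noncomputable def matchCompute (J : Fin n → Finset (Fin n)) (v : Fin n) : Option (Fin n) :=
  partnerIn (matchChosen J) v

def matchUpdate (M : Fin n → Option (Fin n)) (r : Option (Fin n → Option (Fin n))) :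
    Fin n → Option (Fin n) :=
  match r with
  | some f => fun v => (M v).or (f v)
  | none => M

noncomputable def matchInfo (N : Fin n → Set (Fin n)) (z : Fin n → Fin (2 ^ L))
    (M : Fin n → Option (Fin n)) : CliqueInfo n L (Fin n → Option (Fin n)) :=
  gatherInfo N z (fun v => (M v).isNone) M

open Classical in
/-- The sampled alive edges at `v` towards larger vertices. -/
noncomputable def edgeItems (v : Fin n) (A : Set (Fin n)) (c : Fin n → Fin (2 ^ L))
    (I : CliqueInfo n L (Fin n → Option (Fin n))) : Finset (Fin n) :=
  Finset.univ.filter fun u => v < u ∧ u ∈ A ∧ I.alive v ∧ I.alive u ∧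
    (c u : ℕ) % 2 ^ edgeLevel n (∑ v, I.degree v) = 0

/-- One edge sampling step of the matching algorithm. -/
noncomputable def edgeStep (N : Fin n → Set (Fin n)) (z : Fin n × Fin n → Fin (2 ^ L))
    (M : Fin n → Option (Fin n)) : Fin n → Option (Fin n) :=
  matchUpdate M (groupCompute toLeader
    (fun v => edgeItems v (N v) (fun u => z (v, u)) (matchInfo N (fun v => z (v, v)) M))
    matchCompute)

/-- The class of a node in a partition step. -/
def partClass (τ : ℕ) (I : CliqueInfo n L (Fin n → Option (Fin n))) (v : Fin n) : ℕ :=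
  (I.colour v : ℕ) % 2 ^ classLevel n τ (∑ v, I.degree v)

open Classical in
/-- The alive edges at `v` towards larger vertices in the same class. -/
noncomputable def partItems (τ : ℕ) (v : Fin n) (A : Set (Fin n))
    (I : CliqueInfo n L (Fin n → Option (Fin n))) : Finset (Fin n) :=
  Finset.univ.filter fun u => v < u ∧ u ∈ A ∧ I.alive v ∧ I.alive u ∧
    partClass τ I v = partClass τ I u

def partDest (τ : ℕ) (I : CliqueInfo n L (Fin n → Option (Fin n))) (v : Fin n) : Fin n :=
  ⟨partClass τ I v % n, Nat.mod_lt _ v.pos⟩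

/-- One partition step of the matching algorithm. -/
noncomputable def partStep (τ : ℕ) (N : Fin n → Set (Fin n)) (z : Fin n → Fin (2 ^ L))
    (M : Fin n → Option (Fin n)) : Fin n → Option (Fin n) :=
  matchUpdate M (groupCompute (partDest τ (matchInfo N z M))
    (fun v => partItems τ v (N v) (matchInfo N z M)) matchCompute)

theorem cliqueRealizes_edgeStep {b : ℕ} {P : Type} (hn0 : 1 ≤ n) (hn : (n + 1) ^ 2 ≤ 2 ^ b)
    (hL : L ≤ b) (nb : P → Set (Fin n)) (col : P → Fin n → Fin (2 ^ L)) :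
    CliqueRealizes n b 8 (fun (x : Fin n → P) M =>
      edgeStep (fun v => nb (x v)) (fun e => col (x e.1) e.2) M) := by
  have h := cliqueRealizes_step hn0 hn hL (by rw [Fintype.card_option, Fintype.card_fin]; nlinarith) nb
    (fun v p => col p v)
    (fun v _ M => (M v).isNone) (fun _ => toLeader)
    (fun v p I => edgeItems v (nb p) (col p) I) (fun _ => matchCompute)
    (fun I r => matchUpdate I.state r)
  unfold edgeStep
  exact h

theorem cliqueRealizes_partStep {b : ℕ} {P : Type} (hn0 : 1 ≤ n) (hn : (n + 1) ^ 2 ≤ 2 ^ b)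
    (hL : L ≤ b) (τ : ℕ) (nb : P → Set (Fin n)) (col : Fin n → P → Fin (2 ^ L)) :
    CliqueRealizes n b 8 (fun (x : Fin n → P) M =>
      partStep τ (fun v => nb (x v)) (fun v => col v (x v)) M) := by
  have h := cliqueRealizes_step hn0 hn hL (by rw [Fintype.card_option, Fintype.card_fin]; nlinarith) nb
    col (fun v _ M => (M v).isNone) (partDest τ)
    (fun v p I => partItems τ v (nb p) I) (fun _ => matchCompute)
    (fun I r => matchUpdate I.state r)
  unfold partStep
  exact h

end Matching

end Steps

/-! ### Counting along the list of all items -/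

section ListCount

theorem countP_univ_toList {α : Type*} [Fintype α] (p : α → Prop) [DecidablePred p] :
    (Finset.univ : Finset α).toList.countP (fun a => decide (p a)) = {a | p a}.ncard := by
  classical
  have h1 : (Finset.univ : Finset α).toList.countP (fun a => decide (p a)) =
      Multiset.countP p (Finset.univ : Finset α).val := by
    conv_rhs => rw [← Finset.coe_toList, Multiset.coe_countP]
  rw [h1, Multiset.countP_eq_card_filter, Set.ncard_eq_toFinset_card']
  have : ({a | p a} : Set α).toFinset = Finset.univ.filter p := by ext; simp
  rw [this]
  rfl

theorem blockedCount_univ {ι V : Type*} [Fintype ι] (req rem : ι → Set V) (p : ι → Prop) (v : V)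
    (F : Set V) : blockedCount req rem p v Finset.univ.toList F =
      {i | p i ∧ v ∈ rem i ∧ req i ⊆ F}.ncard := by
  classical
  exact countP_univ_toList _

end ListCount

/-! ### Numerical bounds for the number of classes, and reduction of colours -/

section Levels

theorem classLevel_le {n τ D : ℕ} :
    (2 : ℝ) ^ classLevel n τ D ≤ 16 * (Real.sqrt ((D : ℝ) / n) + 1) + 32 * τ := by
  have h0 := Real.sqrt_nonneg ((D : ℝ) / n)
  unfold classLevel
  split_ifs with h
  · rw [pow_zero]
    have : (0 : ℝ) ≤ τ := by positivity
    linarith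
  · set x := 8 * (Nat.sqrt (D / n) + 1) + 16 * τ with hx
    have h1 : 2 ^ Nat.clog 2 x < 2 * x := by
      have hx1 : 1 < x := by omega
      have := Nat.pow_pred_clog_lt_self (b := 2) (by norm_num) hx1
      have h2 : Nat.clog 2 x ≠ 0 := (Nat.clog_pos (by norm_num) hx1).ne'
      obtain ⟨y, hy⟩ := Nat.exists_eq_succ_of_ne_zero h2
      rw [hy] at this ⊢
      simp only [Nat.pred_succ] at this
      rw [pow_succ]; omega
    have h2 : (2 : ℝ) ^ Nat.clog 2 x ≤ 2 * x := by exact_mod_cast h1.le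
    have h3 : (Nat.sqrt (D / n) : ℝ) ≤ Real.sqrt ((D : ℝ) / n) :=
      Real.nat_sqrt_le_real_sqrt.trans (Real.sqrt_le_sqrt Nat.cast_div_le)
    have h4 : (x : ℝ) = 8 * (Nat.sqrt (D / n) + 1) + 16 * τ := by rw [hx]; push_cast; ring
    rw [h4] at h2
    linarith

theorem le_classLevel {n τ D : ℕ} (hn : 0 < n) (h : ¬ D ≤ n) :
    8 * Real.sqrt ((D : ℝ) / n) + 16 * τ ≤ (2 : ℝ) ^ classLevel n τ D := by
  unfold classLevel
  rw [if_neg h]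
  set x := 8 * (Nat.sqrt (D / n) + 1) + 16 * τ with hx
  have h1 : (x : ℝ) ≤ (2 : ℝ) ^ Nat.clog 2 x := by
    exact_mod_cast Nat.le_pow_clog (by norm_num) x
  have h2 : Real.sqrt ((D : ℝ) / n) ≤ Nat.sqrt (D / n) + 1 := by
    rw [Real.sqrt_le_left (by positivity)]
    have h3 : (D : ℝ) / n ≤ ((D / n : ℕ) : ℝ) + 1 := by
      rw [div_le_iff₀ (by exact_mod_cast hn)]
      have := Nat.lt_div_mul_add (a := D) hn
      have h5 : D ≤ (D / n + 1) * n := by rw [add_mul]; omega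
      exact_mod_cast h5
    have h4 : D / n + 1 ≤ (Nat.sqrt (D / n) + 1) ^ 2 := by
      have := Nat.lt_succ_sqrt (D / n)
      rw [Nat.succ_eq_add_one, ← sq] at this
      exact this
    have h5 : ((D / n : ℕ) : ℝ) + 1 ≤ ((Nat.sqrt (D / n) : ℝ) + 1) ^ 2 := by exact_mod_cast h4
    exact h3.trans h5
  have h4 : (x : ℝ) = 8 * (Nat.sqrt (D / n) + 1) + 16 * τ := by rw [hx]; push_cast; ring
  rw [h4] at h1
  linarith

/-- With the chosen number of classes, the bound on the number of edges of a class is at most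
`n`. -/
theorem class_degSum_bound {n τ D : ℕ} (hτ : 1 ≤ τ) (hn : 4096 * τ ^ 2 ≤ n) (h : ¬ D ≤ n) :
    4 * (D : ℝ) / (2 ^ classLevel n τ D) ^ 2 + 4 * n * τ / 2 ^ classLevel n τ D + (τ : ℝ) ^ 2 ≤ n := by
  have hτ1 : (1 : ℝ) ≤ τ := by exact_mod_cast hτ
  have hn' : 4096 * (τ : ℝ) ^ 2 ≤ n := by exact_mod_cast hn
  have hn0 : 0 < n := by nlinarith
  have hn0' : (0 : ℝ) < n := by exact_mod_cast hn0
  have hk := le_classLevel (τ := τ) hn0 h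
  set k : ℝ := (2 : ℝ) ^ classLevel n τ D with hkdef
  set q := Real.sqrt ((D : ℝ) / n) with hq
  have hq0 : 0 ≤ q := Real.sqrt_nonneg _
  have hq2 : q ^ 2 = D / n := Real.sq_sqrt (by positivity)
  have hD : (D : ℝ) = q ^ 2 * n := by rw [hq2]; field_simp
  have hk0 : 0 < k := by positivity
  -- The three terms are at most n/16, n/4 and n/4096, from k ≥ 8√(D/n), k ≥ 16τ and the assumed
  -- size of n.
  have h1 : 4 * (D : ℝ) / k ^ 2 ≤ n / 16 := by
    rw [div_le_iff₀ (by positivity), hD]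
    have : (8 * q) ^ 2 ≤ k ^ 2 := by gcongr; linarith
    nlinarith
  have h2 : 4 * n * τ / k ≤ n / 4 := by
    rw [div_le_iff₀ hk0]
    have : 16 * (τ : ℝ) ≤ k := by linarith
    nlinarith
  linarith

/-- Gives every class a leader of its own and keeps the union bound over classes polynomial. Here
√(D/n) ≤ √n and 64τ ≤ √n, so k is of order √n at most. -/
theorem classLevel_le_card {n τ D : ℕ} (hτ : 1 ≤ τ) (hn : 4096 * τ ^ 2 ≤ n) (hD : D ≤ n * n) :
    2 ^ classLevel n τ D ≤ n := by
  have h := classLevel_le (n := n) (τ := τ) (D := D)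
  have hτ1 : (1 : ℝ) ≤ τ := by exact_mod_cast hτ
  have hn' : 4096 * (τ : ℝ) ^ 2 ≤ n := by exact_mod_cast hn
  have hn0 : (0 : ℝ) < n := by nlinarith
  have h1 : Real.sqrt ((D : ℝ) / n) ≤ Real.sqrt n := by
    apply Real.sqrt_le_sqrt
    rw [div_le_iff₀ hn0]
    exact_mod_cast hD
  have h2 : 64 * (τ : ℝ) ≤ Real.sqrt n := by
    apply Real.le_sqrt_of_sq_le
    nlinarith
  have h3 := Real.sq_sqrt hn0.le
  have : (2 : ℝ) ^ classLevel n τ D ≤ n := by nlinarith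
  exact_mod_cast this

theorem pr_colour_mod {ι : Type*} [Fintype ι] [DecidableEq ι] {M m k : ℕ} (hM : M = m * k)
    (hm : 0 < m) (hk : 0 < k) (p : (ι → Fin k) → Prop) :
    pr (fun ω : ι → Fin M => p fun i => ⟨(ω i : ℕ) % k, Nat.mod_lt _ hk⟩) = pr p := by
  subst hM
  exact pr_comp_modNat hm p

/-- Coins are tossed before the number of classes is known. With powers of two, reducing a uniform
`L`-bit colour to `j` bits is exactly uniform. -/
theorem pr_colour_mod_two_pow {ι : Type*} [Fintype ι] [DecidableEq ι] {L j : ℕ} (hj : j ≤ L)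
    (p : (ι → Fin (2 ^ j)) → Prop) :
    pr (fun ω : ι → Fin (2 ^ L) => p fun i => ⟨(ω i : ℕ) % 2 ^ j, Nat.mod_lt _ (by positivity)⟩) =
      pr p :=
  pr_colour_mod (by rw [← pow_add, Nat.sub_add_cancel hj]) (pow_pos two_pos (L - j))
    (by positivity) p

end Levels

/-! ### Analysis of the independent set step -/

section Analysis

variable {n L : ℕ} (G : SimpleGraph (Fin n))

theorem sum_degree_gatherInfo {σ : Type} (z : Fin n → Fin (2 ^ L)) (alive : Fin n → Bool) (s : σ)
    (F : Set (Fin n)) (hF : ∀ v, alive v = true ↔ v ∈ F) :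
    ∑ v, (gatherInfo G.neighborSet z alive s).degree v = degSum (restrictTo G F) := by
  refine Finset.sum_congr rfl fun v _ => ?_
  simp only [gatherInfo]
  simp_rw [hF]
  by_cases h : v ∈ F
  · rw [if_pos ((hF v).2 h)]
    congr 1
    ext u
    simp [restrictTo, h, and_comm]
  · rw [if_neg fun h' => h ((hF v).1 h')]
    have : (restrictTo G F).neighborSet v = ∅ := by ext u; simp [restrictTo, h]
    simp [this]

theorem degSum_le_sq (H : SimpleGraph (Fin n)) : degSum H ≤ n * n := by
  have := degSum_le H (Δ := n) fun v => by simpa using ncard_le_card (H.neighborSet v)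
  simpa using this

theorem sum_degree_misInfo (z : Fin n → Fin (2 ^ L)) (S : Set (Fin n)) :
    ∑ v, (misInfo G.neighborSet z S).degree v =
      degSum (restrictTo G (uncovered G.neighborSet S)) :=
  sum_degree_gatherInfo G z _ S _ fun v => by simp

/-- The leader knows only the edges between sampled vertices, while the analysis removes full
neighbourhoods from the uncovered set. Choices depend only on what happens to vertices that are both
active and free, so the two runs choose the same set. -/
theorem greedyChosen_congr_of_active {ι : Type*} {rem rem' : ι → Set ι} {act act' : ι → Prop}
    (l : List ι) (F F' : Set ι) (h : ∀ u, act u ∧ u ∈ F ↔ act' u ∧ u ∈ F')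
    (hr : ∀ i u, act i → i ∈ F → act u → u ∈ F → (u ∈ rem i ↔ u ∈ rem' i)) :
    greedyChosen (fun u => {u}) rem act l F = greedyChosen (fun u => {u}) rem' act' l F' := by
  induction l generalizing F F' with
  | nil => rfl
  | cons i l ih =>
    simp only [greedyChosen]
    by_cases hi : act i ∧ i ∈ F
    · rw [if_pos (by simpa using hi), if_pos (by simpa using (h i).1 hi)]
      rw [ih (F \ rem i) (F' \ rem' i)]
      · intro u
        simp only [Set.mem_sdiff]
        have h1 := h u
        have h2 := hr i u hi.1 hi.2
        tauto
      · intro j u hj hjF hu huF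
        exact hr j u hj hjF.1 hu huF.1
    · rw [if_neg (by simpa using hi), if_neg fun h' => hi ((h i).2 (by simpa using h'))]
      exact ih F F' h hr

/-- The independent set chosen from the sampled vertices in one step. -/
noncomputable def sampledMIS (F W : Set (Fin n)) : Set (Fin n) :=
  greedyChosen (fun u => {u}) (fun u => {u} ∪ G.neighborSet u) (fun u => u ∈ W)
    Finset.univ.toList F

theorem mem_misSample {τ : ℕ} {z : Fin n → Fin (2 ^ L)} {S : Set (Fin n)} {v : Fin n} :
    v ∈ misSample τ (misInfo G.neighborSet z S) ↔ v ∈ uncovered G.neighborSet S ∧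
      (z v : ℕ) % 2 ^ classLevel n τ (degSum (restrictTo G (uncovered G.neighborSet S))) = 0 := by
  simp only [misSample, sum_degree_misInfo, Set.mem_ofPred_eq]
  simp [misInfo, gatherInfo]

/-- The vertices whose colour belongs to the sampled class. -/
def sampledClass (τ : ℕ) (z : Fin n → Fin (2 ^ L)) (H : SimpleGraph (Fin n)) : Set (Fin n) :=
  {v | (z v : ℕ) % 2 ^ classLevel n τ (degSum H) = 0}

theorem misUpdate_groupCompute (τ : ℕ) (z : Fin n → Fin (2 ^ L)) (S : Set (Fin n)) :
    misStep τ G.neighborSet z S = if (∀ i, ∑ v with toLeader v = i,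
      (misItems τ v (G.neighborSet v) (misInfo G.neighborSet z S)).card ≤ n) then
        S ∪ sampledMIS G (uncovered G.neighborSet S)
          (sampledClass τ z (restrictTo G (uncovered G.neighborSet S))) else S := by
  unfold misStep groupCompute
  split_ifs with hok
  · simp only [misUpdate]
    congr 1
    ext v
    simp only [misCompute, decide_eq_true_eq, Set.mem_ofPred_eq]
    rw [sampledMIS, greedyChosen_congr_of_active (rem' := fun u => {u} ∪ G.neighborSet u)
      (act' := fun u => u ∈ sampledClass τ z (restrictTo G (uncovered G.neighborSet S)))
      (F' := uncovered G.neighborSet S)]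
    · intro u
      rw [mem_misSample]
      simp [and_comm, sampledClass]
    · intro i u hi _ hu _
      simp [misItems, hi, hu, toLeader]
  · rfl

theorem misStep_eq_of_le (τ : ℕ) (z : Fin n → Fin (2 ^ L)) (S : Set (Fin n))
    (h : degSum (restrictTo (restrictTo G (uncovered G.neighborSet S))
      (sampledClass τ z (restrictTo G (uncovered G.neighborSet S)))) ≤ n) :
    misStep τ G.neighborSet z S = S ∪ sampledMIS G (uncovered G.neighborSet S)
      (sampledClass τ z (restrictTo G (uncovered G.neighborSet S))) := by
  rw [misUpdate_groupCompute, if_pos]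
  intro i
  refine le_trans (Finset.sum_le_sum_of_subset (Finset.subset_univ _)) (le_trans ?_ h)
  refine Finset.sum_le_sum fun v _ => ?_
  rw [← Set.ncard_coe_finset]
  refine Set.ncard_le_ncard (fun u hu => ?_) (Set.toFinite _)
  simp only [misItems, Finset.coe_filter, Finset.mem_univ, true_and, Set.mem_ofPred_eq,
    mem_misSample] at hu
  exact ⟨⟨hu.2.2, hu.1.1, hu.2.1.1⟩, hu.1.2, hu.2.1.2⟩

theorem uncovered_union_sampledMIS (S W : Set (Fin n)) :
    uncovered G.neighborSet (S ∪ sampledMIS G (uncovered G.neighborSet S) W) =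
      greedyFree (fun u => {u}) (fun u => {u} ∪ G.neighborSet u) (fun u => u ∈ W)
        Finset.univ.toList (uncovered G.neighborSet S) := by
  rw [greedyFree_eq]
  ext v
  simp only [uncovered, sampledMIS, Set.mem_union, Set.mem_ofPred_eq, Set.mem_singleton_iff,
    SimpleGraph.mem_neighborSet, not_or, G.adj_comm v]
  constructor
  · rintro ⟨⟨h1, h2⟩, h3⟩
    exact ⟨⟨h1, fun u hu => h3 u (Or.inl hu)⟩, fun i hi => ⟨fun h => h2 (h ▸ hi),
      h3 i (Or.inr hi)⟩⟩
  · rintro ⟨⟨h1, h2⟩, h3⟩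
    exact ⟨⟨h1, fun h => (h3 v h).1 rfl⟩, fun u hu => hu.elim (h2 u) fun h => (h3 u h).2⟩

theorem misStep_cases (τ : ℕ) (z : Fin n → Fin (2 ^ L)) (S : Set (Fin n)) :
    misStep τ G.neighborSet z S = S ∨ ∃ W, misStep τ G.neighborSet z S =
      S ∪ sampledMIS G (uncovered G.neighborSet S) W := by
  rw [misUpdate_groupCompute]
  split_ifs
  · exact Or.inr ⟨_, rfl⟩
  · exact Or.inl rfl

theorem uncovered_misStep_subset (τ : ℕ) (z : Fin n → Fin (2 ^ L)) (S : Set (Fin n)) :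
    uncovered G.neighborSet (misStep τ G.neighborSet z S) ⊆ uncovered G.neighborSet S := by
  rcases misStep_cases G τ z S with h | ⟨W, h⟩
  · rw [h]
  · rw [h, uncovered_union_sampledMIS]
    exact greedyFree_subset _ _

/-- Holds for every outcome: new vertices are uncovered by the old set, and the greedy process keeps
them mutually non-adjacent. -/
theorem isIndepSet_misStep (τ : ℕ) (z : Fin n → Fin (2 ^ L)) {S : Set (Fin n)}
    (hS : G.IsIndepSet S) : G.IsIndepSet (misStep τ G.neighborSet z S) := by
  rcases misStep_cases G τ z S with h | ⟨W, h⟩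
  · rwa [h]
  · rw [h]
    have hF : ∀ u ∈ sampledMIS G (uncovered G.neighborSet S) W, u ∈ uncovered G.neighborSet S :=
      fun u hu => by simpa using (greedyChosen_spec _ _ hu).2.2
    intro u hu v hv huv
    rcases hu with hu | hu <;> rcases hv with hv | hv
    · exact hS hu hv huv
    · exact fun h => (hF v hv).2 u hu h.symm
    · exact fun h => (hF u hu).2 v hv h
    · intro h
      rcases greedyChosen_disjoint _ _ hu hv huv with h1 | h1
      · exact Set.disjoint_left.1 h1 rfl (Or.inr h)
      · exact Set.disjoint_left.1 h1 rfl (Or.inr h.symm)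

/-- One step leaves no edges if there were few, whatever the random choices. -/
theorem neighborSet_misStep_eq_empty (τ : ℕ) (z : Fin n → Fin (2 ^ L)) (S : Set (Fin n))
    (h : degSum (restrictTo G (uncovered G.neighborSet S)) ≤ n) (v : Fin n) :
    (restrictTo G (uncovered G.neighborSet (misStep τ G.neighborSet z S))).neighborSet v = ∅ := by
  have h1 := misStep_eq_of_le G τ z S (le_trans (degSum_mono fun _ _ h => h.1) h)
  rw [h1, uncovered_union_sampledMIS]
  ext u
  simp only [SimpleGraph.mem_neighborSet, Set.mem_empty_iff_false, iff_false]
  rintro ⟨-, hv, -⟩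
  -- The level is 0 here, so colours are taken modulo 1 and every vertex is sampled.
  have hact : v ∈ sampledClass τ z (restrictTo G (uncovered G.neighborSet S)) := by
    simp [sampledClass, classLevel, h, Nat.mod_one]
  exact greedy_maximal (req := fun u => {u}) (rem := fun u => {u} ∪ G.neighborSet u)
    (act := fun u => u ∈ sampledClass τ z (restrictTo G (uncovered G.neighborSet S)))
    Finset.univ.toList (uncovered G.neighborSet S) (i := v) (by simp) hact
    ⟨v, by simp⟩ (Set.singleton_subset_iff.2 hv)

/-- Two events are excluded: a class whose degree sum is too large for the leader (`A`), and a free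
vertex with at least τk available removers (`B`). Off both, the step is carried out, and every
neighbour that survives together with `v` is an available remover of `v`, so the degree of `v` is
below τk. -/
theorem pr_misStep_le (S : Set (Fin n)) {τ : ℕ} (hτ : 1 ≤ τ) (hn : 4096 * τ ^ 2 ≤ n)
    (hL : classLevel n τ (degSum (restrictTo G (uncovered G.neighborSet S))) ≤ L) :
    pr (fun z : Fin n → Fin (2 ^ L) => ∃ v, τ * (16 * (Real.sqrt
        ((degSum (restrictTo G (uncovered G.neighborSet S)) : ℝ) / n) + 1) + 32 * τ) <
      ((restrictTo G (uncovered G.neighborSet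
        (misStep τ G.neighborSet z S))).neighborSet v).ncard) ≤ n ^ 4 * Real.exp (-τ) := by
  classical
  set F := uncovered G.neighborSet S with hF
  set H := restrictTo G F with hH
  set D := degSum H with hD
  set j := classLevel n τ D with hj
  have hDn : D ≤ n * n := degSum_le_sq H
  have hkn : 2 ^ j ≤ n := classLevel_le_card hτ hn hDn
  have hk := classLevel_le (n := n) (τ := τ) (D := D)
  rw [← hj] at hk
  have : NeZero (2 ^ j) := ⟨by positivity⟩
  let A : (Fin n → Fin (2 ^ j)) → Prop := fun h => ∃ i,
    4 * (D : ℝ) / (2 ^ j : ℕ) ^ 2 + 4 * Fintype.card (Fin n) * τ / (2 ^ j : ℕ) + (τ : ℝ) ^ 2 <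
      degSum (restrictTo H {v | h v = i})
  let fr : (Fin n → Fin (2 ^ j)) → Set (Fin n) := fun h =>
    greedyFree (fun u => {u}) (fun u => {u} ∪ G.neighborSet u) (fun u => True ∧ h u = 0)
      Finset.univ.toList F
  let B : (Fin n → Fin (2 ^ j)) → Prop := fun h => ∃ v, v ∈ fr h ∧ (τ : ℝ) * (2 ^ j : ℕ) ≤
    blockedCount (fun u => {u}) (fun u => {u} ∪ G.neighborSet u) (fun _ => True) v
      Finset.univ.toList (fr h)
  have hA : pr A ≤ (2 ^ j : ℕ) * ((n + 2) * Real.exp (-τ)) := by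
    have := pr_exists_class_degSum_gt H (k := 2 ^ j) (τ := τ) (by positivity)
    simpa [A, hD] using this
  have hB : pr B ≤ n * Real.exp (-τ) := by
    have := pr_exists_le_card_mul (fun v h => v ∈ fr h ∧ (τ : ℝ) * (2 ^ j : ℕ) ≤
      blockedCount (fun u => {u}) (fun u => {u} ∪ G.neighborSet u) (fun _ => True) v
        Finset.univ.toList (fr h))
      (fun v => pr_blockedCount_le (fun _ => True) v _ (Finset.nodup_toList _) F τ)
    simpa [B] using this
  have hAB : pr (fun h => A h ∨ B h) ≤ n ^ 4 * Real.exp (-τ) := by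
    refine (pr_or_le A B).trans ((add_le_add hA hB).trans ?_)
    have h1 : ((2 ^ j : ℕ) : ℝ) ≤ n := by exact_mod_cast hkn
    have h2 : (2 : ℝ) ≤ n := by
      have : 2 ≤ n := by nlinarith
      exact_mod_cast this
    -- The power n⁴ is generous; it serves as a common bound for all three kinds of steps.
    calc _ ≤ (n : ℝ) * ((n + 2) * Real.exp (-τ)) + n * Real.exp (-τ) := by gcongr
      _ = (n * (n + 3)) * Real.exp (-τ) := by ring
      _ ≤ _ := by
        gcongr
        nlinarith [mul_nonneg (by linarith : (0 : ℝ) ≤ n - 2) (by linarith : (0 : ℝ) ≤ n),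
          mul_nonneg (by nlinarith : (0 : ℝ) ≤ n * n - 4) (by positivity : (0 : ℝ) ≤ n * n)]
  refine le_trans ?_ hAB
  rw [← pr_colour_mod_two_pow hL]
  refine pr_mono fun z hz => ?_
  set h : Fin n → Fin (2 ^ j) := fun i => ⟨(z i : ℕ) % 2 ^ j, Nat.mod_lt _ (by positivity)⟩ with hh
  by_contra hcon
  rw [not_or] at hcon
  obtain ⟨hA', hB'⟩ := hcon
  have hcls : sampledClass τ z H = {v | h v = 0} := by
    ext v
    simp [sampledClass, hh, Fin.ext_iff, ← hD, ← hj]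
  have hguard : degSum (restrictTo H (sampledClass τ z H)) ≤ n := by
    by_cases hDle : D ≤ n
    · exact le_trans (degSum_mono fun _ _ h => h.1) hDle
    · have h1 := not_lt.1 (not_exists.1 hA' 0)
      rw [← hcls] at h1
      have h2 := class_degSum_bound hτ hn hDle
      rw [← hj] at h2
      have h3 : (degSum (restrictTo H (sampledClass τ z H)) : ℝ) ≤ n :=
        h1.trans (by simpa using h2)
      exact_mod_cast h3
  have hstep := misStep_eq_of_le G τ z S hguard
  obtain ⟨v, hv⟩ := hz
  rw [hstep, uncovered_union_sampledMIS] at hv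
  have hfr : greedyFree (fun u => {u}) (fun u => {u} ∪ G.neighborSet u)
      (fun u => u ∈ sampledClass τ z (restrictTo G (uncovered G.neighborSet S)))
      Finset.univ.toList (uncovered G.neighborSet S) = fr h := by
    refine greedyFree_congr _ _ fun u _ => ?_
    rw [← hF, ← hH, hcls]
    simp
  rw [hfr] at hv
  have hvfr : v ∈ fr h := by
    by_contra hvn
    have : (restrictTo G (fr h)).neighborSet v = ∅ := by
      ext u
      simp only [SimpleGraph.mem_neighborSet, Set.mem_empty_iff_false, iff_false]
      exact fun h' => hvn h'.2.1
    rw [this, Set.ncard_empty] at hv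
    have h0 : (0 : ℝ) ≤ τ * (16 * (Real.sqrt ((D : ℝ) / n) + 1) + 32 * τ) := by positivity
    simp only [Nat.cast_zero] at hv
    linarith
  refine hB' ⟨v, hvfr, ?_⟩
  rw [blockedCount_univ]
  have h4 : ((restrictTo G (fr h)).neighborSet v).ncard ≤
      {i | True ∧ v ∈ ({i} ∪ G.neighborSet i : Set (Fin n)) ∧ ({i} : Set (Fin n)) ⊆ fr h}.ncard := by
    refine Set.ncard_le_ncard (fun u hu => ?_) (Set.toFinite _)
    exact ⟨trivial, Or.inr hu.1.symm, by simpa using hu.2.2⟩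
  have h5 : (((restrictTo G (fr h)).neighborSet v).ncard : ℝ) ≤ _ := Nat.cast_le.2 h4
  refine le_trans ?_ h5
  refine le_trans ?_ hv.le
  have : (0 : ℝ) ≤ τ := by positivity
  push_cast
  gcongr

end Analysis

/-! ### Consistency of partner maps under matching steps -/

section MatchingStep

variable {n L : ℕ} (G : SimpleGraph (Fin n))

/-- `M` assigns partners along the edges of `G`, consistently. -/
def IsPartnerMap (M : Fin n → Option (Fin n)) : Prop :=
  ∀ v w, M v = some w → M w = some v ∧ G.Adj v w

theorem partnerIn_eq_some_iff {V : Type*} {C : Set (V × V)}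
    (hC' : ∀ e ∈ C, ∀ e' ∈ C, e ≠ e' → Disjoint (pairEnds e) (pairEnds e')) (v w : V) :
    partnerIn C v = some w ↔ (v, w) ∈ C ∨ (w, v) ∈ C := by
  have huniq : ∀ w w', (v, w) ∈ C ∨ (w, v) ∈ C → (v, w') ∈ C ∨ (w', v) ∈ C → w = w' := by
    intro w w' h h'
    have key : ∀ e ∈ C, ∀ e' ∈ C, v ∈ pairEnds e → v ∈ pairEnds e' → e = e' := by
      intro e he e' he' hv hv'
      by_contra hne
      exact Set.disjoint_left.1 (hC' e he e' he' hne) hv hv'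
    rcases h with h | h <;> rcases h' with h' | h'
    · exact (Prod.ext_iff.1 (key _ h _ h' (by simp [pairEnds]) (by simp [pairEnds]))).2
    · have h1 := key _ h _ h' (by simp [pairEnds]) (by simp [pairEnds])
      rw [Prod.mk.injEq] at h1
      exact h1.2.trans h1.1
    · have h1 := key _ h _ h' (by simp [pairEnds]) (by simp [pairEnds])
      rw [Prod.mk.injEq] at h1
      exact h1.1.trans h1.2
    · exact (Prod.ext_iff.1 (key _ h _ h' (by simp [pairEnds]) (by simp [pairEnds]))).1
  unfold partnerIn
  constructor
  · intro h
    split_ifs at h with hex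
    have := hex.choose_spec
    rwa [Option.some.inj h] at this
  · intro h
    rw [dif_pos ⟨w, h⟩]
    exact congrArg some (huniq _ _ (Exists.choose_spec
      (p := fun w => (v, w) ∈ C ∨ (w, v) ∈ C) ⟨w, h⟩) h)

theorem partnerIn_eq_none_iff {V : Type*} {C : Set (V × V)} (v : V) :
    partnerIn C v = none ↔ ∀ e ∈ C, v ∉ pairEnds e := by
  unfold partnerIn
  split_ifs with h
  · simp only [false_iff, not_forall, not_not]
    obtain ⟨w, hw | hw⟩ := h
    · exact ⟨_, hw, by simp [pairEnds]⟩
    · exact ⟨_, hw, by simp [pairEnds]⟩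
  · simp only [true_iff]
    rintro ⟨a, b⟩ he hv
    simp only [pairEnds, Set.mem_insert_iff, Set.mem_singleton_iff] at hv
    rcases hv with rfl | rfl
    · exact h ⟨b, Or.inl he⟩
    · exact h ⟨a, Or.inr he⟩

theorem matchChosen_disjoint (J : Fin n → Finset (Fin n)) :
    ∀ e ∈ matchChosen J, ∀ e' ∈ matchChosen J, e ≠ e' → Disjoint (pairEnds e) (pairEnds e') := by
  intro e he e' he' hne
  rcases greedyChosen_disjoint _ _ he he' hne with h | h
  · exact h.symm
  · exact h

/-- The items of the group with destination `i`. -/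
def groupItems (dest : Fin n → Fin n) (items : Fin n → Finset (Fin n)) (i u : Fin n) :
    Finset (Fin n) := if dest u = i then items u else ∅

-- The ends of an item are unmatched and have the same destination, so both read their partner from
-- the same greedy matching, and edges of different groups cannot meet.
variable {G} in
theorem isPartnerMap_matchUpdate {M : Fin n → Option (Fin n)} (hM : IsPartnerMap G M)
    {dest : Fin n → Fin n} {items : Fin n → Finset (Fin n)}
    (hitems : ∀ v, ∀ u ∈ items v, v < u ∧ G.Adj v u ∧ M v = none ∧ M u = none ∧ dest u = dest v) :
    IsPartnerMap G (matchUpdate M (groupCompute dest items matchCompute)) := by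
  unfold groupCompute
  split_ifs with hok
  · simp only [matchUpdate]
    set C : Fin n → Set (Fin n × Fin n) := fun i => matchChosen (groupItems dest items i) with hC
    have hmem : ∀ i e, e ∈ C i → dest e.1 = i ∧ e.2 ∈ items e.1 := by
      intro i e he
      have := (greedyChosen_spec _ _ he).2.1
      unfold groupItems at this
      split_ifs at this with h
      · exact ⟨h, this⟩
      · simp at this
    have hsome : ∀ i v w, partnerIn (C i) v = some w ↔ (v, w) ∈ C i ∨ (w, v) ∈ C i := fun i =>
      partnerIn_eq_some_iff (matchChosen_disjoint _)
    intro v w hvw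
    change (M v).or (partnerIn (C (dest v)) v) = some w at hvw
    change (M w).or (partnerIn (C (dest w)) w) = some v ∧ _
    rcases Option.or_eq_some_iff.1 hvw with h | ⟨-, h⟩
    · have := hM v w h
      exact ⟨by rw [this.1]; rfl, this.2⟩
    · rw [hsome] at h
      rcases h with h | h
      · have h1 := hitems _ _ (hmem _ _ h).2
        refine ⟨?_, h1.2.1⟩
        rw [show M w = none from h1.2.2.2.1, Option.none_or, hsome,
          show dest w = dest v from h1.2.2.2.2]
        exact Or.inr h
      · have h1 := hitems _ _ (hmem _ _ h).2
        refine ⟨?_, h1.2.1.symm⟩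
        rw [show M w = none from h1.2.2.1, Option.none_or, hsome,
          show dest w = dest v from (hmem _ _ h).1]
        exact Or.inl h
  · exact hM

/-- The vertices left free by the greedy matching among the pairs given by `J`. -/
noncomputable def matchFree (J : Fin n → Finset (Fin n)) : Set (Fin n) :=
  greedyFree pairEnds pairEnds (fun e => e.2 ∈ J e.1) Finset.univ.toList Set.univ

theorem unmatched_matchUpdate_subset (M : Fin n → Option (Fin n))
    (r : Option (Fin n → Option (Fin n))) : unmatched (matchUpdate M r) ⊆ unmatched M := by
  cases r with
  | none => exact subset_rfl
  | some f =>
    intro v hv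
    simp only [unmatched, matchUpdate, Set.mem_ofPred_eq, Option.or_eq_none_iff] at hv
    exact hv.1

theorem mem_unmatched_matchUpdate (M : Fin n → Option (Fin n)) {dest : Fin n → Fin n}
    {items : Fin n → Finset (Fin n)} (hok : ∀ i, ∑ v with dest v = i, (items v).card ≤ n)
    (v : Fin n) : v ∈ unmatched (matchUpdate M (groupCompute dest items matchCompute)) ↔
      v ∈ unmatched M ∧ v ∈ matchFree (groupItems dest items (dest v)) := by
  unfold groupCompute
  rw [if_pos hok]
  simp only [unmatched, matchUpdate, Set.mem_ofPred_eq, Option.or_eq_none_iff]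
  refine and_congr_right fun _ => ?_
  rw [matchFree, greedyFree_eq]
  unfold matchCompute
  rw [partnerIn_eq_none_iff]
  simp only [Set.mem_univ, true_and, Set.mem_ofPred_eq]
  rfl

theorem sum_degree_matchInfo (z : Fin n → Fin (2 ^ L)) (M : Fin n → Option (Fin n)) :
    ∑ v, (matchInfo G.neighborSet z M).degree v = degSum (restrictTo G (unmatched M)) :=
  sum_degree_gatherInfo G z _ M _ fun v => by simp [unmatched]

theorem mem_edgeItems {z : Fin n × Fin n → Fin (2 ^ L)} {M : Fin n → Option (Fin n)}
    {v u : Fin n} : u ∈ edgeItems v (G.neighborSet v) (fun u => z (v, u))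
      (matchInfo G.neighborSet (fun v => z (v, v)) M) ↔
      (v < u ∧ (restrictTo G (unmatched M)).Adj v u) ∧
      (z (v, u) : ℕ) % 2 ^ edgeLevel n (degSum (restrictTo G (unmatched M))) = 0 := by
  classical
  unfold edgeItems
  rw [Finset.mem_filter, sum_degree_matchInfo]
  simp [restrictTo, matchInfo, gatherInfo, unmatched, and_assoc]

theorem mem_partItems {τ : ℕ} {z : Fin n → Fin (2 ^ L)} {M : Fin n → Option (Fin n)}
    {v u : Fin n} : u ∈ partItems τ v (G.neighborSet v) (matchInfo G.neighborSet z M) ↔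
      (v < u ∧ (restrictTo G (unmatched M)).Adj v u) ∧
      (z v : ℕ) % 2 ^ classLevel n τ (degSum (restrictTo G (unmatched M))) =
        (z u : ℕ) % 2 ^ classLevel n τ (degSum (restrictTo G (unmatched M))) := by
  classical
  unfold partItems partClass
  rw [Finset.mem_filter, sum_degree_matchInfo]
  simp [restrictTo, matchInfo, gatherInfo, unmatched, and_assoc]

theorem isPartnerMap_edgeStep {M : Fin n → Option (Fin n)} (hM : IsPartnerMap G M)
    (z : Fin n × Fin n → Fin (2 ^ L)) : IsPartnerMap G (edgeStep G.neighborSet z M) := by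
  refine isPartnerMap_matchUpdate hM fun v u hu => ?_
  rw [mem_edgeItems] at hu
  exact ⟨hu.1.1, hu.1.2.1, hu.1.2.2.1, hu.1.2.2.2, rfl⟩

theorem isPartnerMap_partStep (τ : ℕ) {M : Fin n → Option (Fin n)} (hM : IsPartnerMap G M)
    (z : Fin n → Fin (2 ^ L)) : IsPartnerMap G (partStep τ G.neighborSet z M) := by
  refine isPartnerMap_matchUpdate hM fun v u hu => ?_
  rw [mem_partItems] at hu
  refine ⟨hu.1.1, hu.1.2.1, hu.1.2.2.1, hu.1.2.2.2, ?_⟩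
  simp only [partDest, partClass, sum_degree_matchInfo]
  simp only [matchInfo, gatherInfo, hu.2]

end MatchingStep

/-! ### Analysis of the edge sampling step -/

section EdgeStep

variable {n L : ℕ} (G : SimpleGraph (Fin n))

theorem edgeLevel_le {n D : ℕ} : (2 : ℝ) ^ edgeLevel n D ≤ 8 * ((D : ℝ) / n + 1) := by
  unfold edgeLevel
  split_ifs with h
  · rw [pow_zero]
    have : (0 : ℝ) ≤ (D : ℝ) / n := by positivity
    linarith
  · set x := 4 * (D / n + 1) with hx
    have hx1 : 1 < x := lt_of_lt_of_le (by norm_num : 1 < 4)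
      (Nat.le_mul_of_pos_right 4 (Nat.succ_pos _))
    have := Nat.pow_pred_clog_lt_self (b := 2) (by norm_num) hx1
    have h2 : Nat.clog 2 x ≠ 0 := (Nat.clog_pos (by norm_num) hx1).ne'
    obtain ⟨y, hy⟩ := Nat.exists_eq_succ_of_ne_zero h2
    have h1 : 2 ^ Nat.clog 2 x < 2 * x := by
      rw [hy] at this ⊢
      simp only [Nat.pred_succ] at this
      rw [pow_succ]; omega
    have h2 : (2 : ℝ) ^ Nat.clog 2 x ≤ 2 * x := by exact_mod_cast h1.le
    have h3 : ((D / n : ℕ) : ℝ) ≤ (D : ℝ) / n := Nat.cast_div_le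
    have h4 : (x : ℝ) = 4 * ((D / n : ℕ) + 1) := by rw [hx]; push_cast; ring
    rw [h4] at h2
    linarith

theorem le_edgeLevel {n D : ℕ} (hn : 0 < n) (h : ¬ D ≤ 2 * n) :
    4 * ((D : ℝ) / n) ≤ (2 : ℝ) ^ edgeLevel n D := by
  unfold edgeLevel
  rw [if_neg h]
  have h1 : ((4 * (D / n + 1) : ℕ) : ℝ) ≤ (2 : ℝ) ^ Nat.clog 2 (4 * (D / n + 1)) := by
    exact_mod_cast Nat.le_pow_clog (by norm_num) _
  have h3 : (D : ℝ) / n ≤ ((D / n : ℕ) : ℝ) + 1 := by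
    rw [div_le_iff₀ (by exact_mod_cast hn)]
    have := Nat.lt_div_mul_add (a := D) hn
    have h5 : D ≤ (D / n + 1) * n := by rw [add_mul]; omega
    exact_mod_cast h5
  push_cast at h1
  linarith

/-- Every edge is counted once as an increasing pair. -/
theorem two_mul_sum_pairs_le {V : Type*} [Fintype V] [LinearOrder V] (H : SimpleGraph V)
    [DecidableRel H.Adj] :
    2 * ∑ e : V × V, (if e.1 < e.2 ∧ H.Adj e.1 e.2 then (1 : ℝ) else 0) ≤ degSum H := by
  classical
  have h1 : ∑ e : V × V, (if e.1 < e.2 ∧ H.Adj e.1 e.2 then (1 : ℝ) else 0) =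
      ∑ e : V × V, (if e.2 < e.1 ∧ H.Adj e.1 e.2 then (1 : ℝ) else 0) :=
    Fintype.sum_equiv (Equiv.prodComm V V) _ _ fun e => by simp [H.adj_comm]
  rw [two_mul]
  nth_rewrite 2 [h1]
  rw [← Finset.sum_add_distrib, Fintype.sum_prod_type]
  unfold degSum
  push_cast
  refine Finset.sum_le_sum fun v _ => ?_
  rw [ncard_eq_sum]
  refine Finset.sum_le_sum fun u _ => ?_
  by_cases h : H.Adj v u
  · rcases lt_or_gt_of_ne h.ne with h' | h'
    · simp [h, h', not_lt.2 h'.le]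
    · simp [h, h', not_lt.2 h'.le]
  · simp [h]

theorem mem_unmatched_edgeStep (M : Fin n → Option (Fin n)) (z : Fin n × Fin n → Fin (2 ^ L))
    (hok : ∑ v, (edgeItems v (G.neighborSet v) (fun u => z (v, u))
      (matchInfo G.neighborSet (fun v => z (v, v)) M)).card ≤ n) (v : Fin n) :
    v ∈ unmatched (edgeStep G.neighborSet z M) ↔ v ∈ unmatched M ∧
      v ∈ greedyFree pairEnds pairEnds (fun e : Fin n × Fin n => (e.1 < e.2 ∧
        (restrictTo G (unmatched M)).Adj e.1 e.2) ∧
        (z e : ℕ) % 2 ^ edgeLevel n (degSum (restrictTo G (unmatched M))) = 0)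
        Finset.univ.toList Set.univ := by
  unfold edgeStep
  rw [mem_unmatched_matchUpdate _ fun i =>
    (Finset.sum_le_sum_of_subset (Finset.subset_univ _)).trans hok]
  refine and_congr_right fun _ => ?_
  unfold matchFree
  rw [greedyFree_congr]
  intro e _
  simp only [groupItems, toLeader, if_true, mem_edgeItems]

theorem sum_edgeItems (M : Fin n → Option (Fin n)) (z : Fin n × Fin n → Fin (2 ^ L))
    [DecidableRel (restrictTo G (unmatched M)).Adj] :
    ((∑ v, (edgeItems v (G.neighborSet v) (fun u => z (v, u))
      (matchInfo G.neighborSet (fun v => z (v, v)) M)).card : ℕ) : ℝ) =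
    ∑ e : Fin n × Fin n,
      if (z e : ℕ) % 2 ^ edgeLevel n (degSum (restrictTo G (unmatched M))) = 0 then
        (if e.1 < e.2 ∧ (restrictTo G (unmatched M)).Adj e.1 e.2 then (1 : ℝ) else 0) else 0 := by
  classical
  rw [Fintype.sum_prod_type]
  push_cast
  refine Finset.sum_congr rfl fun v _ => ?_
  have hc : ∀ A : Finset (Fin n), (A.card : ℝ) = ∑ u, if u ∈ A then (1 : ℝ) else 0 :=
    fun A => by simp
  rw [hc]
  refine Finset.sum_congr rfl fun u _ => ?_
  rw [← ite_and]
  exact if_congr (by rw [mem_edgeItems, and_comm]) rfl rfl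

theorem sum_edgeItems_le_of_degSum_le (M : Fin n → Option (Fin n))
    (z : Fin n × Fin n → Fin (2 ^ L))
    (h : degSum (restrictTo G (unmatched M)) ≤ 2 * n) :
    ∑ v, (edgeItems v (G.neighborSet v) (fun u => z (v, u))
      (matchInfo G.neighborSet (fun v => z (v, v)) M)).card ≤ n := by
  classical
  have h1 := sum_edgeItems G M z
  have h2 := two_mul_sum_pairs_le (restrictTo G (unmatched M))
  have h3 : (degSum (restrictTo G (unmatched M)) : ℝ) ≤ 2 * n := by exact_mod_cast h
  have h4 : ∑ e : Fin n × Fin n,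
      (if (z e : ℕ) % 2 ^ edgeLevel n (degSum (restrictTo G (unmatched M))) = 0 then
        (if e.1 < e.2 ∧ (restrictTo G (unmatched M)).Adj e.1 e.2 then (1 : ℝ) else 0) else 0) ≤
      ∑ e : Fin n × Fin n,
        (if e.1 < e.2 ∧ (restrictTo G (unmatched M)).Adj e.1 e.2 then (1 : ℝ) else 0) :=
    Finset.sum_le_sum fun e _ => by split_ifs <;> norm_num
  have : ((∑ v, (edgeItems v (G.neighborSet v) (fun u => z (v, u))
      (matchInfo G.neighborSet (fun v => z (v, v)) M)).card : ℕ) : ℝ) ≤ n := by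
    rw [h1]; linarith
  exact_mod_cast this

/-- One step leaves no edges if there were few, whatever the random choices. -/
theorem neighborSet_edgeStep_eq_empty (M : Fin n → Option (Fin n))
    (z : Fin n × Fin n → Fin (2 ^ L)) (h : degSum (restrictTo G (unmatched M)) ≤ 2 * n)
    (v : Fin n) :
    (restrictTo G (unmatched (edgeStep G.neighborSet z M))).neighborSet v = ∅ := by
  have hmem := mem_unmatched_edgeStep G M z (sum_edgeItems_le_of_degSum_le G M z h)
  have key : ∀ a b, a < b → ¬ (restrictTo G (unmatched (edgeStep G.neighborSet z M))).Adj a b := by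
    rintro a b hab ⟨hG, ha, hb⟩
    rw [hmem] at ha hb
    refine greedy_maximal (req := pairEnds) (rem := pairEnds)
      (act := fun e : Fin n × Fin n => (e.1 < e.2 ∧
        (restrictTo G (unmatched M)).Adj e.1 e.2) ∧
        (z e : ℕ) % 2 ^ edgeLevel n (degSum (restrictTo G (unmatched M))) = 0)
      Finset.univ.toList Set.univ (i := (a, b)) (by simp)
      ⟨⟨hab, hG, ha.1, hb.1⟩, by simp [edgeLevel, h, Nat.mod_one]⟩
      ⟨a, by simp [pairEnds]⟩ ?_
    intro x hx
    simp only [pairEnds, Set.mem_insert_iff, Set.mem_singleton_iff] at hx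
    rcases hx with rfl | rfl
    · exact ha.2
    · exact hb.2
  ext u
  simp only [SimpleGraph.mem_neighborSet, Set.mem_empty_iff_false, iff_false]
  intro hvu
  rcases lt_or_gt_of_ne hvu.ne with h' | h'
  · exact key _ _ h' hvu
  · exact key _ _ h' hvu.symm

/-- The items of the greedy process are now edges, each sampled independently by its smaller end. If
`v` stays unmatched, its edges to unmatched neighbours are all still available, so their number is
below τk by the potential bound. -/
theorem pr_edgeStep_le (M : Fin n → Option (Fin n)) {τ : ℕ} (hτ : 1 ≤ τ) (hn : 4096 * τ ^ 2 ≤ n)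
    (hL : edgeLevel n (degSum (restrictTo G (unmatched M))) ≤ L) :
    pr (fun z : Fin n × Fin n → Fin (2 ^ L) => ∃ v, τ * (8 *
        ((degSum (restrictTo G (unmatched M)) : ℝ) / n + 1)) <
      ((restrictTo G (unmatched (edgeStep G.neighborSet z M))).neighborSet v).ncard) ≤
      n ^ 4 * Real.exp (-τ) := by
  classical
  set F := unmatched M with hF
  set H := restrictTo G F with hH
  set D := degSum H with hD
  set j := edgeLevel n D with hj
  have hk := edgeLevel_le (n := n) (D := D)
  rw [← hj] at hk
  have hn0 : 0 < n := by nlinarith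
  have : NeZero (2 ^ j) := ⟨by positivity⟩
  let p : Fin n × Fin n → Prop := fun e => e.1 < e.2 ∧ H.Adj e.1 e.2
  let A : (Fin n × Fin n → Fin (2 ^ j)) → Prop := fun h =>
    2 * (∑ e, if p e then (1 : ℝ) else 0) / (2 ^ j : ℕ) + τ <
      ∑ e, if h e = 0 then (if p e then (1 : ℝ) else 0) else 0
  let fr : (Fin n × Fin n → Fin (2 ^ j)) → Set (Fin n) := fun h =>
    greedyFree pairEnds pairEnds (fun e => p e ∧ h e = 0) Finset.univ.toList Set.univ
  let B : (Fin n × Fin n → Fin (2 ^ j)) → Prop := fun h => ∃ v, v ∈ fr h ∧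
    (τ : ℝ) * (2 ^ j : ℕ) ≤ blockedCount pairEnds pairEnds p v Finset.univ.toList (fr h)
  have hA : pr A ≤ Real.exp (-τ) :=
    pr_class_weight_le (0 : Fin (2 ^ j)) _ (fun e => by split_ifs <;> norm_num)
      (fun e => by split_ifs <;> norm_num) (τ : ℝ)
  have hB : pr B ≤ n * Real.exp (-τ) := by
    have := pr_exists_le_card_mul (fun v h => v ∈ fr h ∧ (τ : ℝ) * (2 ^ j : ℕ) ≤
      blockedCount pairEnds pairEnds p v Finset.univ.toList (fr h))
      (fun v => pr_blockedCount_le p v _ (Finset.nodup_toList _) Set.univ τ)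
    simpa [B] using this
  have hAB : pr (fun h => A h ∨ B h) ≤ n ^ 4 * Real.exp (-τ) := by
    refine (pr_or_le A B).trans ((add_le_add hA hB).trans ?_)
    have h2 : (2 : ℝ) ≤ n := by
      have : 2 ≤ n := by nlinarith
      exact_mod_cast this
    calc _ = ((n : ℝ) + 1) * Real.exp (-τ) := by ring
      _ ≤ _ := by
        gcongr
        nlinarith [mul_nonneg (by nlinarith : (0 : ℝ) ≤ n * n - 4)
          (by positivity : (0 : ℝ) ≤ n * n)]
  refine le_trans ?_ hAB
  rw [← pr_colour_mod_two_pow hL]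
  refine pr_mono fun z hz => ?_
  set h : Fin n × Fin n → Fin (2 ^ j) := fun i =>
    ⟨(z i : ℕ) % 2 ^ j, Nat.mod_lt _ (by positivity)⟩ with hh
  by_contra hcon
  rw [not_or] at hcon
  obtain ⟨hA', hB'⟩ := hcon
  have hh0 : ∀ e, h e = 0 ↔ (z e : ℕ) % 2 ^ j = 0 := fun e => by simp [hh, Fin.ext_iff]
  have hguard : ∑ v, (edgeItems v (G.neighborSet v) (fun u => z (v, u))
      (matchInfo G.neighborSet (fun v => z (v, v)) M)).card ≤ n := by
    by_cases hDle : D ≤ 2 * n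
    · exact sum_edgeItems_le_of_degSum_le G M z hDle
    · have h1 := not_lt.1 hA'
      simp_rw [hh0] at h1
      have h2 := sum_edgeItems G M z
      have h3 : 2 * (∑ e, if p e then (1 : ℝ) else 0) ≤ D := two_mul_sum_pairs_le H
      have h4 := le_edgeLevel hn0 hDle
      rw [← hj] at h4
      have hn0' : (0 : ℝ) < n := by exact_mod_cast hn0
      -- Twice the number of edges is at most D and k ≥ 4D/n. With τ ≤ n/4 the sampled edges number
      -- at most n/2.
      have h5 : 2 * (∑ e, if p e then (1 : ℝ) else 0) / (2 ^ j : ℕ) ≤ n / 4 := by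
        rw [div_le_iff₀ (by positivity)]
        push_cast
        have h6 : 4 * (D : ℝ) ≤ 2 ^ j * n := by
          have := mul_le_mul_of_nonneg_right h4 hn0'.le
          rwa [mul_assoc, div_mul_cancel₀ _ hn0'.ne'] at this
        linarith
      have hτn : (τ : ℝ) ≤ n / 4 := by
        have : 4 * τ ≤ n := by nlinarith
        have : 4 * (τ : ℝ) ≤ n := by exact_mod_cast this
        linarith
      have : ((∑ v, (edgeItems v (G.neighborSet v) (fun u => z (v, u))
          (matchInfo G.neighborSet (fun v => z (v, v)) M)).card : ℕ) : ℝ) ≤ n := by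
        rw [h2]
        have h7 := h1.trans (add_le_add h5 hτn)
        refine le_trans (le_of_eq ?_) (h7.trans (by linarith))
        rfl
      exact_mod_cast this
  have hmem := mem_unmatched_edgeStep G M z hguard
  have hfr : greedyFree pairEnds pairEnds (fun e : Fin n × Fin n => (e.1 < e.2 ∧
        (restrictTo G (unmatched M)).Adj e.1 e.2) ∧
        (z e : ℕ) % 2 ^ edgeLevel n (degSum (restrictTo G (unmatched M))) = 0)
        Finset.univ.toList Set.univ = fr h :=
    greedyFree_congr _ _ fun e _ => by rw [hh0]
  rw [hfr] at hmem
  obtain ⟨v, hv⟩ := hz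
  set F' := unmatched (edgeStep G.neighborSet z M) with hF'
  have hvF : v ∈ F' := by
    by_contra hvn
    have : (restrictTo G F').neighborSet v = ∅ := by
      ext u
      simp only [SimpleGraph.mem_neighborSet, Set.mem_empty_iff_false, iff_false]
      exact fun h' => hvn h'.2.1
    rw [this, Set.ncard_empty] at hv
    have h0 : (0 : ℝ) ≤ τ * (8 * ((D : ℝ) / n + 1)) := by positivity
    simp only [Nat.cast_zero] at hv
    linarith
  refine hB' ⟨v, ((hmem v).1 hvF).2, ?_⟩
  rw [blockedCount_univ]
  have h4 : ((restrictTo G F').neighborSet v).ncard ≤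
      {e | p e ∧ v ∈ pairEnds e ∧ pairEnds e ⊆ fr h}.ncard := by
    -- Edges are represented by increasing pairs, so each neighbour is sent to the ordered pair it
    -- forms with `v`.
    refine Set.ncard_le_ncard_of_injOn (fun u => if v < u then (v, u) else (u, v)) ?_ ?_
      (Set.toFinite _)
    · rintro u ⟨hG, hv', hu'⟩
      have hv'' := (hmem v).1 hv'
      have hu'' := (hmem u).1 hu'
      have hsub : ∀ x, x = v ∨ x = u → x ∈ fr h := by
        rintro x (rfl | rfl)
        exacts [hv''.2, hu''.2]
      by_cases hvu : v < u
      · simp only [hvu, if_true]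
        refine ⟨⟨hvu, hG, hv''.1, hu''.1⟩, by simp [pairEnds], fun x hx => hsub x ?_⟩
        simpa [pairEnds] using hx
      · simp only [hvu, if_false]
        refine ⟨⟨lt_of_le_of_ne (not_lt.1 hvu) hG.ne', hG.symm, hu''.1, hv''.1⟩,
          by simp [pairEnds], fun x hx => hsub x ?_⟩
        simpa [pairEnds, or_comm] using hx
    · intro u hu u' hu' heq
      have h1 : v ≠ u := hu.1.ne
      have h2 : v ≠ u' := hu'.1.ne
      simp only at heq
      split_ifs at heq <;> simp_all
  have h5 : (((restrictTo G F').neighborSet v).ncard : ℝ) ≤ _ := Nat.cast_le.2 h4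
  refine le_trans ?_ h5
  refine le_trans ?_ hv.le
  have : (0 : ℝ) ≤ τ := by positivity
  push_cast
  gcongr

end EdgeStep

/-! ### Localizing the greedy process to a class, and sensitivity of its outcome -/

section GreedyRestrict

/-- A class leader starts from all vertices but sees only edges inside the class; the analysis
starts from the class with all edges. Inside the class both evolve alike. -/
theorem greedyFree_inter {ι V : Type*} {req rem : ι → Set V} {act : ι → Prop} (l : List ι)
    (F W : Set V) : greedyFree req rem (fun i => act i ∧ req i ⊆ W) l F ∩ W =
      greedyFree req rem act l (F ∩ W) := by
  induction l generalizing F with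
  | nil => rfl
  | cons i l ih =>
    simp only [greedyFree]
    rw [ih]
    congr 1
    by_cases h : act i ∧ req i ⊆ F ∩ W
    · rw [if_pos h, if_pos ⟨⟨h.1, fun x hx => (h.2 hx).2⟩, fun x hx => (h.2 hx).1⟩]
      ext x
      simp only [Set.mem_inter_iff, Set.mem_sdiff]
      tauto
    · rw [if_neg h, if_neg fun h' => h ⟨h'.1.1, fun x hx => ⟨h'.2 hx, h'.1.2 hx⟩⟩]

/-- Removing few vertices decreases the sum of the degrees only a little. -/
theorem degSum_restrictTo_le_add {V : Type*} [Fintype V] (H : SimpleGraph V) {Δ : ℕ}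
    (hΔ : ∀ v, (H.neighborSet v).ncard ≤ Δ) (F F' : Set V) (T : Finset V)
    (hT : ∀ v, v ∉ T → v ∈ F → v ∈ F') :
    (degSum (restrictTo H F) : ℝ) ≤ degSum (restrictTo H F') + 2 * T.card * Δ := by
  classical
  have hsum : ∀ G : SimpleGraph V, (degSum G : ℝ) = ∑ v, ∑ u, if G.Adj v u then (1 : ℝ) else 0 := by
    intro G
    unfold degSum
    push_cast
    refine Finset.sum_congr rfl fun v _ => ?_
    rw [ncard_eq_sum]
    rfl
  have h1 : ∑ v, ∑ u, (if v ∈ T ∧ H.Adj v u then (1 : ℝ) else 0) ≤ T.card * Δ := by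
    have h2 : ∀ v, ∑ u, (if v ∈ T ∧ H.Adj v u then (1 : ℝ) else 0) =
        if v ∈ T then ((H.neighborSet v).ncard : ℝ) else 0 := by
      intro v
      rw [ncard_eq_sum]
      by_cases h : v ∈ T <;> simp [h]
    simp_rw [h2]
    rw [← Finset.sum_filter, Finset.filter_mem_eq_inter, Finset.univ_inter, ← nsmul_eq_mul]
    exact Finset.sum_le_card_nsmul _ _ _ fun v _ => by exact_mod_cast hΔ v
  have h2 : ∑ v, ∑ u, (if u ∈ T ∧ H.Adj v u then (1 : ℝ) else 0) ≤ T.card * Δ := by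
    rw [Finset.sum_comm]
    simp_rw [H.adj_comm] at h1 ⊢
    exact h1
  have h3 : (degSum (restrictTo H F) : ℝ) ≤ degSum (restrictTo H F') +
      (∑ v, ∑ u, (if v ∈ T ∧ H.Adj v u then (1 : ℝ) else 0) +
      ∑ v, ∑ u, (if u ∈ T ∧ H.Adj v u then (1 : ℝ) else 0)) := by
    rw [hsum, hsum]
    simp only [← Finset.sum_add_distrib]
    refine Finset.sum_le_sum fun v _ => Finset.sum_le_sum fun u _ => ?_
    by_cases h : (restrictTo H F).Adj v u
    · have ha : H.Adj v u := h.1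
      by_cases hv : v ∈ T
      · rw [if_pos h, if_pos (show v ∈ T ∧ H.Adj v u from ⟨hv, ha⟩)]
        split_ifs <;> norm_num
      · by_cases hu : u ∈ T
        · rw [if_pos h, if_pos (show u ∈ T ∧ H.Adj v u from ⟨hu, ha⟩)]
          split_ifs <;> norm_num
        · rw [if_pos h, if_pos (show (restrictTo H F').Adj v u from
            ⟨ha, hT v hv h.2.1, hT u hu h.2.2⟩)]
          split_ifs <;> norm_num
    · rw [if_neg h]
      split_ifs <;> norm_num
  linarith

/-- Recolouring one vertex changes which vertices are free for at most three vertices. -/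
theorem freeInClass_update {V : Type*} [DecidableEq V] {U : Set V → Set V}
    (hU : ∀ W W' : Set V, (∃ y, ∀ u, u ≠ y → (u ∈ W ↔ u ∈ W')) →
      ∃ y, ∀ u, u ≠ y → (u ∈ U W ↔ u ∈ U W')) {k : ℕ} (h : V → Fin k) (a : V) (x y : Fin k) :
    ∃ T : Finset V, T.card ≤ 3 ∧ ∀ v, v ∉ T → v ∈ freeInClass U (Function.update h a x) →
      v ∈ freeInClass U (Function.update h a y) := by
  have key : ∀ c, ∃ w, ∀ v, v ≠ w → (v ∈ U {u | Function.update h a x u = c} ↔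
      v ∈ U {u | Function.update h a y u = c}) := fun c => hU _ _ ⟨a, fun u hu => by
    simp [Function.update_of_ne hu]⟩
  obtain ⟨w₁, h₁⟩ := key x
  obtain ⟨w₂, h₂⟩ := key y
  -- Only the classes of colours `x` and `y` change, each by the one vertex `a`, so each changes its
  -- free set in at most one vertex; `a` is added because its own class is different.
  refine ⟨{a, w₁, w₂}, Finset.card_le_three, fun v hv hf => ?_⟩
  simp only [Finset.mem_insert, Finset.mem_singleton, not_or] at hv
  simp only [freeInClass, Set.mem_ofPred_eq, Function.update_of_ne hv.1] at hf ⊢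
  by_cases hx : h v = x
  · rw [hx] at hf ⊢
    exact (h₁ v hv.2.1).1 hf
  · by_cases hy : h v = y
    · rw [hy] at hf ⊢
      exact (h₂ v hv.2.2).1 hf
    · convert hf using 2
      ext u
      by_cases hu : u = a
      · subst hu
        simp [Ne.symm hx, Ne.symm hy]
      · simp [Function.update_of_ne hu]

end GreedyRestrict

/-! ### Analysis of the partition step -/

section PartitionStep

variable {n L : ℕ} (G : SimpleGraph (Fin n))

/-- The vertices of `W` left free by the greedy matching of the subgraph of `H` induced by `W`. -/
noncomputable def greedyMatchFree (H : SimpleGraph (Fin n)) (W : Set (Fin n)) : Set (Fin n) :=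
  greedyFree pairEnds pairEnds (fun e : Fin n × Fin n => e.1 < e.2 ∧ H.Adj e.1 e.2)
    Finset.univ.toList W

theorem greedyMatchFree_independent (H : SimpleGraph (Fin n)) (W : Set (Fin n)) :
    ∀ u ∈ greedyMatchFree H W, ∀ v ∈ greedyMatchFree H W, ¬ H.Adj u v := by
  have key : ∀ u ∈ greedyMatchFree H W, ∀ v ∈ greedyMatchFree H W, u < v → ¬ H.Adj u v := by
    intro u hu v hv huv hadj
    refine greedy_maximal (req := pairEnds) (rem := pairEnds)
      (act := fun e : Fin n × Fin n => e.1 < e.2 ∧ H.Adj e.1 e.2) Finset.univ.toList W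
      (i := (u, v)) (by simp) ⟨huv, hadj⟩ ⟨u, by simp [pairEnds]⟩ ?_
    intro x hx
    simp only [pairEnds, Set.mem_insert_iff, Set.mem_singleton_iff] at hx
    rcases hx with rfl | rfl
    exacts [hu, hv]
  intro u hu v hv hadj
  rcases lt_or_gt_of_ne hadj.ne with h | h
  exacts [key u hu v hv h hadj, key v hv u hu h hadj.symm]

/-- The class of each node in a partition step of the matching algorithm on the alive graph `H`. -/
noncomputable def partColour (τ : ℕ) (z : Fin n → Fin (2 ^ L)) (H : SimpleGraph (Fin n)) (v : Fin n) :
    Fin (2 ^ classLevel n τ (degSum H)) :=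
  ⟨(z v : ℕ) % 2 ^ classLevel n τ (degSum H), Nat.mod_lt _ (by positivity)⟩

/-- With at most n classes the reduction modulo n in `partDest` is vacuous, so distinct classes have
distinct leaders. -/
theorem partDest_eq_iff {τ : ℕ} {z : Fin n → Fin (2 ^ L)} {M : Fin n → Option (Fin n)}
    (hk : 2 ^ classLevel n τ (degSum (restrictTo G (unmatched M))) ≤ n) (u v : Fin n) :
    partDest τ (matchInfo G.neighborSet z M) u = partDest τ (matchInfo G.neighborSet z M) v ↔
      partColour τ z (restrictTo G (unmatched M)) u =
        partColour τ z (restrictTo G (unmatched M)) v := by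
  have hlt : ∀ w, (z w : ℕ) % 2 ^ classLevel n τ (degSum (restrictTo G (unmatched M))) < n :=
    fun w => (Nat.mod_lt _ (by positivity)).trans_le hk
  simp only [partDest, partClass, partColour, Fin.mk.injEq, sum_degree_matchInfo]
  simp only [matchInfo, gatherInfo, Nat.mod_eq_of_lt (hlt _)]

theorem mem_unmatched_partStep (M : Fin n → Option (Fin n)) {τ : ℕ} (z : Fin n → Fin (2 ^ L))
    (hk : 2 ^ classLevel n τ (degSum (restrictTo G (unmatched M))) ≤ n)
    (hok : ∀ c, degSum (restrictTo (restrictTo G (unmatched M))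
      {v | partColour τ z (restrictTo G (unmatched M)) v = c}) ≤ n) (v : Fin n)
    (hv : v ∈ unmatched (partStep τ G.neighborSet z M)) :
    v ∈ freeInClass (greedyMatchFree (restrictTo G (unmatched M)))
      (partColour τ z (restrictTo G (unmatched M))) := by
  classical
  set H := restrictTo G (unmatched M) with hH
  set h := partColour τ z H with hh
  have hitem : ∀ v u, u ∈ partItems τ v (G.neighborSet v) (matchInfo G.neighborSet z M) ↔
      (v < u ∧ H.Adj v u) ∧ h v = h u := by
    intro v u
    rw [mem_partItems]
    simp [hh, partColour, Fin.ext_iff, ← hH]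
  unfold partStep at hv
  rw [mem_unmatched_matchUpdate] at hv
  · have h2 := hv.2
    unfold matchFree at h2
    rw [greedyFree_congr (act' := fun e : Fin n × Fin n =>
      (e.1 < e.2 ∧ H.Adj e.1 e.2) ∧ pairEnds e ⊆ {u | h u = h v})] at h2
    · have h3 : v ∈ greedyFree pairEnds pairEnds (fun e : Fin n × Fin n =>
        (e.1 < e.2 ∧ H.Adj e.1 e.2) ∧ pairEnds e ⊆ {u | h u = h v}) Finset.univ.toList Set.univ ∩
        {u | h u = h v} := ⟨h2, rfl⟩
      rwa [greedyFree_inter, Set.univ_inter] at h3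
    · intro e _
      have hsub : pairEnds e ⊆ {u | h u = h v} ↔ h e.1 = h v ∧ h e.2 = h v := by
        simp [pairEnds, Set.insert_subset_iff]
      rw [hsub]
      unfold groupItems
      split_ifs with hd
      · rw [partDest_eq_iff G hk] at hd
        rw [hitem]
        constructor
        · rintro ⟨h4, h5⟩
          exact ⟨h4, hd, h5.symm.trans hd⟩
        · rintro ⟨h4, h5, h6⟩
          exact ⟨h4, h5.trans h6.symm⟩
      · rw [partDest_eq_iff G hk] at hd
        simp only [Finset.notMem_empty, false_iff]
        exact fun h' => hd h'.2.1
  · intro i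
    by_cases hex : ∃ w, partDest τ (matchInfo G.neighborSet z M) w = i
    · obtain ⟨w, rfl⟩ := hex
      refine le_trans ?_ (hok (h w))
      unfold degSum
      refine le_trans (Finset.sum_le_sum fun v hv => ?_)
        (Finset.sum_le_sum_of_subset (Finset.subset_univ _))
      rw [← Set.ncard_coe_finset]
      refine Set.ncard_le_ncard (fun u hu => ?_) (Set.toFinite _)
      have hv1 := (partDest_eq_iff G hk _ _).1 (Finset.mem_filter.1 hv).2
      have hu1 := (hitem _ _).1 (Finset.mem_coe.1 hu)
      exact ⟨hu1.1.2, hv1, hu1.2.symm.trans hv1⟩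
    · rw [Finset.sum_eq_zero]
      · exact Nat.zero_le _
      · intro v hv
        exact absurd ⟨v, (Finset.mem_filter.1 hv).2⟩ hex

/-- The main term is the expected degree sum nk between vertices free in their classes; the second
term is the McDiarmid deviation. The remaining failure event is an overloaded class. -/
theorem pr_partStep_le (M : Fin n → Option (Fin n)) {τ Δ : ℕ} (hτ : 1 ≤ τ)
    (hn : 4096 * τ ^ 2 ≤ n) (hL : classLevel n τ (degSum (restrictTo G (unmatched M))) ≤ L)
    (hΔ : ∀ v, ((restrictTo G (unmatched M)).neighborSet v).ncard ≤ Δ) :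
    pr (fun z : Fin n → Fin (2 ^ L) => n * (16 * (Real.sqrt
        ((degSum (restrictTo G (unmatched M)) : ℝ) / n) + 1) + 32 * τ) +
        6 * Δ * Real.sqrt (2 * n * τ) <
      degSum (restrictTo G (unmatched (partStep τ G.neighborSet z M)))) ≤
      n ^ 4 * Real.exp (-τ) := by
  classical
  set H := restrictTo G (unmatched M) with hH
  set D := degSum H with hD
  set j := classLevel n τ D with hj
  have hkn : 2 ^ j ≤ n := classLevel_le_card hτ hn (degSum_le_sq H)
  have hk := classLevel_le (n := n) (τ := τ) (D := D)
  rw [← hj] at hk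
  have hn1 : 2 ≤ n := by nlinarith
  have : NeZero (2 ^ j) := ⟨by positivity⟩
  have : NeZero n := ⟨by omega⟩
  let f : (Fin n → Fin (2 ^ j)) → ℝ := fun h =>
    degSum (restrictTo H (freeInClass (greedyMatchFree H) h))
  have hU : ∀ W W' : Set (Fin n), (∃ y, ∀ u, u ≠ y → (u ∈ W ↔ u ∈ W')) →
      ∃ y, ∀ u, u ≠ y → (u ∈ greedyMatchFree H W ↔ u ∈ greedyMatchFree H W') :=
    fun W W' h => greedyFree_pairEnds_lipschitz _ _ W W' h
  let A : (Fin n → Fin (2 ^ j)) → Prop := fun h => ∃ i,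
    4 * (D : ℝ) / (2 ^ j : ℕ) ^ 2 + 4 * Fintype.card (Fin n) * τ / (2 ^ j : ℕ) + (τ : ℝ) ^ 2 <
      degSum (restrictTo H {v | h v = i})
  let B : (Fin n → Fin (2 ^ j)) → Prop := fun h =>
    𝔼 h', f h' + (6 * Δ) * Real.sqrt (2 * Fintype.card (Fin n) * τ) < f h
  have hA : pr A ≤ (2 ^ j : ℕ) * ((n + 2) * Real.exp (-τ)) := by
    have := pr_exists_class_degSum_gt H (k := 2 ^ j) (τ := τ) (by positivity)
    simpa [A, hD] using this
  have hB : pr B ≤ Real.exp (-τ) := by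
    -- The bounded differences inequality needs a positive constant; for Δ = 0 there are no edges at
    -- all.
    rcases Nat.eq_zero_or_pos Δ with h0 | hpos
    · have hf0 : ∀ h, f h = 0 := by
        intro h
        have h1 : degSum H ≤ 0 := by
          have := degSum_le H hΔ
          rwa [h0, mul_zero] at this
        have h2 : degSum (restrictTo H (freeInClass (greedyMatchFree H) h)) ≤ 0 :=
          le_trans (degSum_mono fun _ _ h => h.1) h1
        have h3 := Nat.le_zero.1 h2
        simp only [f, h3, Nat.cast_zero]
      have : ∀ h, ¬ B h := by
        intro h
        simp [B, hf0, h0]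
      simp only [pr, this, if_false, Finset.expect_const_zero]
      positivity
    -- Recolouring a vertex affects at most three free vertices, and each of them accounts for at
    -- most 2Δ in the degree sum.
    · refine pr_gt_expect_add_le (L := 6 * Δ) (by positivity) f (fun h a x y => ?_) (by positivity)
      obtain ⟨T, hT, hT'⟩ := freeInClass_update hU h a x y
      have h1 := degSum_restrictTo_le_add H hΔ _ _ T hT'
      have h2 : (T.card : ℝ) ≤ 3 := by exact_mod_cast hT
      have h3 : (T.card : ℝ) * Δ ≤ 3 * Δ := by gcongr
      simp only [f]
      linarith
  have hE : 𝔼 h', f h' ≤ n * (2 ^ j : ℕ) := by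
    have := expect_degSum_freeInClass_le (k := 2 ^ j) H hU (greedyMatchFree_independent H)
    simpa [f] using this
  have hAB : pr (fun h => A h ∨ B h) ≤ n ^ 4 * Real.exp (-τ) := by
    refine (pr_or_le A B).trans ((add_le_add hA hB).trans ?_)
    have h1 : ((2 ^ j : ℕ) : ℝ) ≤ n := by exact_mod_cast hkn
    have h2 : (2 : ℝ) ≤ n := by exact_mod_cast hn1
    calc _ ≤ (n : ℝ) * ((n + 2) * Real.exp (-τ)) + Real.exp (-τ) := by gcongr
      _ = (n * (n + 2) + 1) * Real.exp (-τ) := by ring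
      _ ≤ _ := by
        gcongr
        nlinarith [mul_nonneg (by linarith : (0 : ℝ) ≤ n - 2) (by linarith : (0 : ℝ) ≤ n),
          mul_nonneg (by nlinarith : (0 : ℝ) ≤ n * n - 4) (by positivity : (0 : ℝ) ≤ n * n)]
  refine le_trans ?_ hAB
  rw [← pr_colour_mod_two_pow hL]
  refine pr_mono fun z hz => ?_
  have hcol : (fun i => ⟨(z i : ℕ) % 2 ^ j, Nat.mod_lt _ (by positivity)⟩ : Fin n → Fin (2 ^ j)) =
      partColour τ z H := rfl
  rw [hcol]
  by_contra hcon
  rw [not_or] at hcon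
  obtain ⟨hA', hB'⟩ := hcon
  have hguard : ∀ c, degSum (restrictTo H {v | partColour τ z H v = c}) ≤ n := by
    intro c
    by_cases hDle : D ≤ n
    · exact le_trans (degSum_mono fun _ _ h => h.1) hDle
    · have h1 := not_lt.1 (not_exists.1 hA' c)
      have h2 := class_degSum_bound hτ hn hDle
      rw [← hj] at h2
      have h3 : (degSum (restrictTo H {v | partColour τ z H v = c}) : ℝ) ≤ n :=
        h1.trans (by simpa using h2)
      exact_mod_cast h3
  have hmem := mem_unmatched_partStep G M z hkn hguard
  have hle : restrictTo G (unmatched (partStep τ G.neighborSet z M)) ≤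
      restrictTo H (freeInClass (greedyMatchFree H) (partColour τ z H)) := by
    rintro u v ⟨h1, h2, h3⟩
    exact ⟨⟨h1, unmatched_matchUpdate_subset _ _ h2, unmatched_matchUpdate_subset _ _ h3⟩,
      hmem u h2, hmem v h3⟩
  have h1 : (degSum (restrictTo G (unmatched (partStep τ G.neighborSet z M))) : ℝ) ≤
      f (partColour τ z H) := Nat.cast_le.2 (degSum_mono hle)
  have h2 := not_lt.1 hB'
  rw [Fintype.card_fin] at h2
  have h3 : (n : ℝ) * (2 ^ j : ℕ) ≤
      n * (16 * (Real.sqrt ((D : ℝ) / n) + 1) + 32 * τ) := by push_cast; gcongr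
  linarith

end PartitionStep

/-! ### Union bound along the sequence of steps -/

section Chain

theorem iterateSteps_congr {σ : Type} {Φ Φ' : ℕ → σ → σ} {N : ℕ} (h : ∀ i < N, Φ i = Φ' i)
    (s : σ) : iterateSteps Φ N s = iterateSteps Φ' N s := by
  induction N with
  | zero => rfl
  | succ N ih =>
    simp only [iterateSteps]
    rw [ih fun i hi => h i (hi.trans N.lt_succ_self), h N N.lt_succ_self]

/-- Extend a finite sequence by a default value. -/
def extendSeq {X : Type} [Inhabited X] {N : ℕ} (ω : Fin N → X) (i : ℕ) : X :=
  if h : i < N then ω ⟨i, h⟩ else default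

/-- A union bound along a random process whose steps use independent random choices. -/
theorem pr_exists_step_le {σ X : Type} [Fintype X] [Inhabited X] (Ψ : ℕ → X → σ → σ) (s₀ : σ)
    (N : ℕ) (bad : ℕ → σ → X → Prop) {ε : ℝ} (h : ∀ i s, pr (bad i s) ≤ ε) :
    pr (fun ω : Fin N → X => ∃ i : Fin N,
      bad i (iterateSteps (fun j => Ψ j (extendSeq ω j)) i s₀) (extendSeq ω i)) ≤ N * ε := by
  have := pr_exists_le_card_mul (Ω := Fin N → X) (fun (i : Fin N) ω =>
    bad i (iterateSteps (fun j => Ψ j (extendSeq ω j)) i s₀) (extendSeq ω i)) (ε := ε) fun i => ?_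
  · simpa using this
  -- The state before step `i` depends only on earlier choices, so with all the others fixed the
  -- choice at step `i` is uniform and the state is constant.
  · refine pr_le_of_forall_resample i _ fun ω => ?_
    refine le_trans (le_of_eq ?_)
      (h i (iterateSteps (fun j => Ψ j (extendSeq ω j)) i s₀))
    congr 1
    funext x
    have h1 : extendSeq (Function.update ω i x) i = x := by simp [extendSeq]
    rw [h1, iterateSteps_congr (Φ' := fun j => Ψ j (extendSeq ω j))]
    intro j hj
    have hjN : j < N := hj.trans i.2
    have hne : (⟨j, hjN⟩ : Fin N) ≠ i := fun he => by
      rw [← he] at hj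
      exact lt_irrefl _ hj
    simp [extendSeq, hjN, Function.update_of_ne hne]

end Chain

/-! ### From a sequence of steps to an algorithm with private coins -/

section Algorithm

variable {n L : ℕ}

/-- A process whose steps can be realized is carried out by an algorithm, and its random choices
are independent and uniform. -/
theorem exists_algorithm {b T : ℕ} {σ Out : Type}
    (Ψ : ℕ → (Fin n → Set (Fin n)) → (Fin n × Fin n → Fin (2 ^ L)) → σ → σ)
    (hΨ : ∀ i, CliqueRealizes n b T
      (fun (x : Fin n → Set (Fin n) × (ℕ → Fin n → Fin (2 ^ L))) s =>
        Ψ i (fun v => (x v).1) (fun e => (x e.1).2 i e.2) s))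
    (out : Fin n → σ → Out) (s₀ : σ) (N : ℕ) :
    ∃ A : CongestedCliqueAlgorithm n Out, A.rounds = T * N ∧ A.bandwidth = b ∧
      ∀ G : SimpleGraph (Fin n), ∃ z : A.Coins → ℕ → (Fin n × Fin n → Fin (2 ^ L)),
        (∀ ω v, A.result G ω v =
          out v (iterateSteps (fun i => Ψ i G.neighborSet (z ω i)) N s₀)) ∧
        ∀ (bad : ℕ → σ → (Fin n × Fin n → Fin (2 ^ L)) → Prop) (ε : ℝ),
          (∀ i s, pr (bad i s) ≤ ε) → 1 - N * ε ≤ A.prob {ω | ∀ i < N,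
            ¬ bad i (iterateSteps (fun i => Ψ i G.neighborSet (z ω i)) i s₀) (z ω i)} := by
  classical
  obtain ⟨F, hF, hF'⟩ := CliqueRealizes.iterate hΨ N
  have hF2 := (hF.comp (.locally fun v p => out v p.2)).comp_locally
    (fun _ (x : Set (Fin n) × (ℕ → Fin n → Fin (2 ^ L))) => (x, s₀))
  obtain ⟨m, hm⟩ := hF2.exists_machine
  have : Inhabited (Fin n × Fin n → Fin (2 ^ L)) := ⟨fun _ => ⟨0, by positivity⟩⟩
  have hcard : Fintype.card (Fin (L * n * N) → Bool) =
      Fintype.card (Fin N → Fin n → Fin (2 ^ L)) := by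
    simp [pow_mul]
  let dec := Fintype.equivOfCardEq hcard
  let e : (Fin n → Fin (L * n * N) → Bool) ≃ (Fin N → Fin n × Fin n → Fin (2 ^ L)) :=
    { toFun := fun ω i p => dec (ω p.1) i p.2
      invFun := fun y v => dec.symm fun i u => y i (v, u)
      left_inv := fun ω => by simp
      right_inv := fun y => by simp }
  -- The entries indexed by (v, ·) are decoded from the coins of `v` alone, so feeding copies of its
  -- own string to `e` gives `v` the correct private colours.
  let init : Fin n → Set (Fin n) → (Fin (L * n * N) → Bool) →
      Set (Fin n) × (ℕ → Fin n → Fin (2 ^ L)) := fun v S c =>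
    (S, fun i u => extendSeq (e fun _ => c) i (v, u))
  refine ⟨m.toAlgorithm (L * n * N) (T * N + 0) init, rfl, rfl, fun G =>
    ⟨fun ω => extendSeq (e ω), fun ω v => ?_, fun bad ε hbad => ?_⟩⟩
  · refine (congrArg m.output (congrFun (m.toAlgorithm_stateAfter (L * n * N) (T * N + 0) init G ω
      (T * N + 0)) v)).trans ?_
    rw [hm, hF']
    have : ∀ (i : ℕ), (fun p : Fin n × Fin n => extendSeq (e fun _ => ω p.1) i (p.1, p.2)) =
        extendSeq (e ω) i := by
      intro i
      funext p
      unfold extendSeq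
      split_ifs
      · rfl
      · rfl
    simp only [init, this]
  · have h1 := pr_exists_step_le (fun i => Ψ i G.neighborSet) s₀ N bad hbad
    rw [← pr_equiv e] at h1
    have h2 := pr_not (Ω := Fin n → Fin (L * n * N) → Bool) (fun ω => ∃ i : Fin N,
      bad i (iterateSteps (fun j => Ψ j G.neighborSet (extendSeq (e ω) j)) i s₀)
        (extendSeq (e ω) i))
    unfold CongestedCliqueAlgorithm.prob
    have h3 := pr_eq_ncard_div_card (Ω := Fin n → Fin (L * n * N) → Bool) (fun ω => ∀ i < N,
      ¬ bad i (iterateSteps (fun j => Ψ j G.neighborSet (extendSeq (e ω) j)) i s₀)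
        (extendSeq (e ω) i))
    refine le_trans ?_ (le_of_eq h3)
    have h4 : (fun ω : Fin n → Fin (L * n * N) → Bool => ∀ i < N,
      ¬ bad i (iterateSteps (fun j => Ψ j G.neighborSet (extendSeq (e ω) j)) i s₀)
        (extendSeq (e ω) i)) = fun ω => ¬ ∃ i : Fin N,
      bad i (iterateSteps (fun j => Ψ j G.neighborSet (extendSeq (e ω) j)) i s₀)
        (extendSeq (e ω) i) := by
      funext ω
      rw [eq_iff_iff, not_exists]
      exact ⟨fun h i => h i i.2, fun h i hi => h ⟨i, hi⟩⟩
    rw [h4, h2]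
    linarith

end Algorithm

/-! ### Degree recursions -/

section Recursion

/-- K² is the fixed point of x ↦ K√x, so in units of K² each phase is a plain square root. -/
theorem mul_sqrt_sq_mul_rpow {K d : ℝ} (hK : 0 ≤ K) (hd : 0 ≤ d) (i : ℕ) :
    K * Real.sqrt (K ^ 2 * d ^ ((1 : ℝ) / 2 ^ i)) = K ^ 2 * d ^ ((1 : ℝ) / 2 ^ (i + 1)) := by
  rw [Real.sqrt_mul (sq_nonneg K), Real.sqrt_sq hK, Real.sqrt_eq_rpow, ← Real.rpow_mul hd,
    ← mul_assoc, ← sq, div_mul_div_comm, one_mul, ← pow_succ]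

/-- The largest degree. -/
noncomputable def maxDeg {V : Type*} [Fintype V] (H : SimpleGraph V) : ℕ :=
  Finset.univ.sup fun v => (H.neighborSet v).ncard

theorem ncard_neighborSet_le_maxDeg {V : Type*} [Fintype V] (H : SimpleGraph V) (v : V) :
    (H.neighborSet v).ncard ≤ maxDeg H :=
  Finset.le_sup (f := fun v => (H.neighborSet v).ncard) (Finset.mem_univ v)

theorem maxDeg_le {V : Type*} [Fintype V] {H : SimpleGraph V} {x : ℝ} (hx : 0 ≤ x)
    (h : ∀ v, ((H.neighborSet v).ncard : ℝ) ≤ x) : (maxDeg H : ℝ) ≤ x :=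
  (Nat.le_floor_iff hx).1 (Finset.sup_le fun v _ => Nat.le_floor (h v))

theorem maxDeg_le_card {n : ℕ} (H : SimpleGraph (Fin n)) : maxDeg H ≤ n :=
  Finset.sup_le fun v _ => by simpa using ncard_le_card (H.neighborSet v)

theorem degSum_div_le_maxDeg {n : ℕ} (hn : 0 < n) (H : SimpleGraph (Fin n)) :
    (degSum H : ℝ) / n ≤ maxDeg H := by
  rw [div_le_iff₀ (by exact_mod_cast hn)]
  have := degSum_le H (ncard_neighborSet_le_maxDeg H)
  rw [Fintype.card_fin, mul_comm] at this
  exact_mod_cast this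

theorem maxDeg_le_of_vertex_sampling {n τ N : ℕ} (hn : 0 < n) (hτ : 1 ≤ τ) (hN : 1 ≤ N)
    (H : ℕ → SimpleGraph (Fin n)) {d : ℝ} (hd : 1 ≤ d) (h0 : (degSum (H 0) : ℝ) / n ≤ d)
    (hH : ∀ i < N, ∀ v, (((H (i + 1)).neighborSet v).ncard : ℝ) ≤
      τ * (16 * (Real.sqrt ((degSum (H i) : ℝ) / n) + 1) + 32 * τ)) :
    (maxDeg (H N) : ℝ) ≤ (64 * τ) ^ 2 * d ^ ((1 : ℝ) / 2 ^ N) := by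
  have hτ1 : (1 : ℝ) ≤ τ := by exact_mod_cast hτ
  have step : ∀ i < N, (degSum (H i) : ℝ) / n ≤ (64 * τ) ^ 2 * d ^ ((1 : ℝ) / 2 ^ i) →
      (maxDeg (H (i + 1)) : ℝ) ≤ (64 * τ) ^ 2 * d ^ ((1 : ℝ) / 2 ^ (i + 1)) := by
    intro i hi hD
    rw [← mul_sqrt_sq_mul_rpow (by positivity) (by linarith)]
    have h1 := Real.sqrt_le_sqrt hD
    -- As d ≥ 1, the additive terms 16 and 32τ are absorbed by the square root: 16 + 16 + 32 = 64.
    have h2 : (τ : ℝ) ≤ Real.sqrt ((64 * τ) ^ 2 * d ^ ((1 : ℝ) / 2 ^ i)) := by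
      apply Real.le_sqrt_of_sq_le
      have := Real.one_le_rpow hd (show (0 : ℝ) ≤ 1 / 2 ^ i by positivity)
      nlinarith
    set q := Real.sqrt ((64 * τ) ^ 2 * d ^ ((1 : ℝ) / 2 ^ i))
    refine maxDeg_le (by positivity) fun v => (hH i hi v).trans ?_
    rw [mul_assoc 64, mul_left_comm]
    gcongr
    linarith
  have all : ∀ i ≤ N, (degSum (H i) : ℝ) / n ≤ (64 * τ) ^ 2 * d ^ ((1 : ℝ) / 2 ^ i) := by
    intro i
    induction i with
    | zero =>
      intro _
      rw [pow_zero, div_one, Real.rpow_one]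
      refine h0.trans (le_mul_of_one_le_left (by linarith) ?_)
      nlinarith
    | succ i ih =>
      intro hi
      exact (degSum_div_le_maxDeg hn _).trans (step i (by omega) (ih (by omega)))
  obtain ⟨M, rfl⟩ := Nat.exists_eq_succ_of_ne_zero (by omega : N ≠ 0)
  exact step M (by omega) (all M (by omega))

/-- A partition step followed by an edge sampling step. The hypothesis on the square of the maximum
degree brings the McDiarmid error below 9n√x. The average degree is then at most 25√x + 48τ, and
8·(25 + 48 + 1) = 592. -/
theorem maxDeg_le_of_partition {n τ : ℕ} (hn : 0 < n) (hτ : 1 ≤ τ)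
    (H H' H'' : SimpleGraph (Fin n)) {x : ℝ} (hx : (τ : ℝ) ^ 2 ≤ x) (h : (maxDeg H : ℝ) ≤ x)
    (hs : (maxDeg H : ℝ) ^ 2 * τ ≤ x * n)
    (h' : (degSum H' : ℝ) ≤ n * (16 * (Real.sqrt ((degSum H : ℝ) / n) + 1) + 32 * τ) +
        6 * maxDeg H * Real.sqrt (2 * n * τ))
    (h'' : ∀ v, ((H''.neighborSet v).ncard : ℝ) ≤ τ * (8 * ((degSum H' : ℝ) / n + 1))) :
    (maxDeg H'' : ℝ) ≤ 592 * τ * Real.sqrt x := by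
  have hn0 : (0 : ℝ) < n := by exact_mod_cast hn
  have hτ1 : (1 : ℝ) ≤ τ := by exact_mod_cast hτ
  refine maxDeg_le (by positivity) fun v => (h'' v).trans ?_
  have hx0 : 0 ≤ x := (sq_nonneg _).trans hx
  have h1 : Real.sqrt ((degSum H : ℝ) / n) ≤ Real.sqrt x :=
    Real.sqrt_le_sqrt ((degSum_div_le_maxDeg hn H).trans h)
  have h2 : (τ : ℝ) ≤ Real.sqrt x := Real.le_sqrt_of_sq_le hx
  have h3 : 6 * maxDeg H * Real.sqrt (2 * n * τ) ≤ n * (9 * Real.sqrt x) := by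
    apply le_of_sq_le_sq _ (by positivity)
    rw [mul_pow, mul_pow, mul_pow, mul_pow, Real.sq_sqrt (by positivity), Real.sq_sqrt hx0]
    nlinarith
  have h4 : (degSum H' : ℝ) / n ≤ 25 * Real.sqrt x + 48 * τ := by
    rw [div_le_iff₀ hn0]
    refine h'.trans ((add_le_add_right h3 _).trans ?_)
    rw [← mul_add, mul_comm]
    refine mul_le_mul_of_nonneg_right ?_ hn0.le
    linarith
  rw [mul_comm 592, mul_assoc]
  refine mul_le_mul_of_nonneg_left ?_ (by positivity)
  linarith

theorem maxDeg_le_of_edge_sampling {n τ N : ℕ} (hτ : 1 ≤ τ) (hN : 1 ≤ N)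
    (hn : 592 ^ 4 * τ ^ 6 ≤ n) (H : ℕ → SimpleGraph (Fin n)) {d : ℝ} (hd : 1 ≤ d) (hdn : d ≤ n)
    (h0 : (degSum (H 0) : ℝ) / n ≤ d)
    (hE : ∀ i ≤ N, ∀ v, (((H (2 * i + 1)).neighborSet v).ncard : ℝ) ≤
      τ * (8 * ((degSum (H (2 * i)) : ℝ) / n + 1)))
    (hP : ∀ i < N, (degSum (H (2 * i + 2)) : ℝ) ≤
      n * (16 * (Real.sqrt ((degSum (H (2 * i + 1)) : ℝ) / n) + 1) + 32 * τ) +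
        6 * maxDeg (H (2 * i + 1)) * Real.sqrt (2 * n * τ)) :
    (maxDeg (H (2 * N + 1)) : ℝ) ≤ (592 * τ) ^ 2 * d ^ ((1 : ℝ) / 2 ^ N) := by
  have hτ1 : (1 : ℝ) ≤ τ := by exact_mod_cast hτ
  have hn' : (592 : ℝ) ^ 4 * (τ : ℝ) ^ 6 ≤ n := by exact_mod_cast hn
  have hn0' : (0 : ℝ) < n := lt_of_lt_of_le (by positivity) hn'
  have hn0 : 0 < n := by exact_mod_cast hn0'
  have hd0 : (0 : ℝ) ≤ d := by linarith
  have hsn : 592 ^ 2 * (τ : ℝ) ^ 3 ≤ Real.sqrt n := by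
    apply Real.le_sqrt_of_sq_le
    calc _ = (592 : ℝ) ^ 4 * (τ : ℝ) ^ 6 := by ring
      _ ≤ _ := hn'
  have key : ∀ i ≤ N, 1 ≤ i →
      (maxDeg (H (2 * i + 1)) : ℝ) ≤ (592 * τ) ^ 2 * d ^ ((1 : ℝ) / 2 ^ i) := by
    intro i hi h1
    induction i, h1 using Nat.le_induction with
    | base =>
      -- In the first phase d may be as large as n, so one factor of the squared maximum degree is
      -- bounded by n and the other by 16τd. This is the required inequality for x = (4τ)²d.
      have hb : (maxDeg (H 1) : ℝ) ≤ 16 * τ * d := by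
        refine maxDeg_le (by positivity) fun v => (hE 0 (by omega) v).trans ?_
        rw [mul_zero]
        nlinarith
      have hbn : (maxDeg (H 1) : ℝ) ≤ n := by exact_mod_cast maxDeg_le_card (H 1)
      have hτd : 0 ≤ (τ : ℝ) * d := by positivity
      have hb1 : 16 * τ * d ≤ (4 * τ) ^ 2 * d := by
        nlinarith [mul_nonneg (by linarith : (0 : ℝ) ≤ τ - 1) hτd]
      have hq := maxDeg_le_of_partition hn0 hτ (H 1) (H 2) (H 3) (x := (4 * τ) ^ 2 * d)
        (by nlinarith) (hb.trans hb1)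
        (by
          have : (maxDeg (H 1) : ℝ) * maxDeg (H 1) ≤ (16 * τ * d) * n := by gcongr
          nlinarith) (hP 0 (by omega)) (hE 1 (by omega))
      refine hq.trans ?_
      rw [Real.sqrt_mul (by positivity), Real.sqrt_sq (by positivity), Real.sqrt_eq_rpow, pow_one]
      have : (0 : ℝ) ≤ d ^ ((1 : ℝ) / 2) := by positivity
      have h5 : (0 : ℝ) ≤ τ ^ 2 * d ^ ((1 : ℝ) / 2) := by positivity
      nlinarith
    | succ i h1 ih =>
      have hx := ih (by omega)
      have hone := Real.one_le_rpow hd (show (0 : ℝ) ≤ 1 / 2 ^ i by positivity)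
      have hle : d ^ ((1 : ℝ) / 2 ^ i) ≤ Real.sqrt n := by
        rw [Real.sqrt_eq_rpow]
        calc d ^ ((1 : ℝ) / 2 ^ i) ≤ d ^ ((1 : ℝ) / 2) := by
              refine Real.rpow_le_rpow_of_exponent_le hd ?_
              gcongr
              calc (2 : ℝ) = 2 ^ 1 := (pow_one _).symm
                _ ≤ 2 ^ i := pow_le_pow_right₀ (by norm_num) h1
          _ ≤ (n : ℝ) ^ ((1 : ℝ) / 2) := by gcongr
      set x := (592 * (τ : ℝ)) ^ 2 * d ^ ((1 : ℝ) / 2 ^ i) with hxdef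
      -- From the second phase on, x is at most (592τ)²√n, and the lower bound on n gives xτ ≤ n.
      -- Hence the squared maximum degree times τ is at most x²τ ≤ xn.
      have hxn : x * τ ≤ n := by
        calc x * τ ≤ (592 * (τ : ℝ)) ^ 2 * Real.sqrt n * τ := by rw [hxdef]; gcongr
          _ = 592 ^ 2 * (τ : ℝ) ^ 3 * Real.sqrt n := by ring
          _ ≤ Real.sqrt n * Real.sqrt n := by gcongr
          _ = n := Real.mul_self_sqrt hn0'.le
      rw [← mul_sqrt_sq_mul_rpow (by positivity) hd0]
      refine maxDeg_le_of_partition hn0 hτ (H (2 * i + 1)) (H (2 * i + 2)) (H (2 * i + 3))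
        (by nlinarith) hx ?_ (hP i (by omega)) (hE (i + 1) hi)
      have hm0 : (0 : ℝ) ≤ maxDeg (H (2 * i + 1)) := by positivity
      have hx0 : (0 : ℝ) ≤ x := hm0.trans hx
      calc (maxDeg (H (2 * i + 1)) : ℝ) ^ 2 * τ ≤ x ^ 2 * τ := by gcongr
        _ = x * (x * τ) := by ring
        _ ≤ x * n := by gcongr
  exact key N le_rfl hN

end Recursion

/-! ### Choice of the constants and removal of the size restrictions -/

section Parameters

/-- The requirements on the number `τ`, which controls failure probabilities, and on the message
length `b`. -/
structure CliqueParams (c C : ℝ) (n τ b : ℕ) : Prop where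
  one_le : 1 ≤ τ
  sq_le : (n + 1) ^ 2 ≤ 2 ^ b
  classLevel_le : ∀ D ≤ n * n, classLevel n τ D ≤ b
  edgeLevel_le : ∀ D ≤ n * n, edgeLevel n D ≤ b
  failure : (2 * n + 1) * ((n : ℝ) ^ 4 * Real.exp (-τ)) ≤ (n : ℝ) ^ (-c)
  bandwidth : (b : ℝ) ≤ C * Real.log n
  factor : 2 * (592 * (τ : ℝ)) ^ 2 ≤ C * Real.log n ^ 2
  large_or_small : 592 ^ 4 * τ ^ 6 ≤ n ∨ (n : ℝ) ≤ C * Real.log n ^ 2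

theorem exists_cliqueParams (c : ℝ) :
    ∃ C : ℝ, 40 ≤ C ∧ ∀ n, 2 ≤ n → ∃ τ b, CliqueParams c C n τ b := by
  obtain ⟨a, ha⟩ := exists_nat_ge (c + 7)
  have hev : ∀ᶠ x : ℝ in Filter.atTop, 592 ^ 4 * ((a + 1) * 3 : ℝ) ^ 6 * Real.log x ^ 6 ≤ x := by
    have := (Real.isLittleO_pow_log_id_atTop (n := 6)).def
      (show (0 : ℝ) < (592 ^ 4 * ((a + 1) * 3 : ℝ) ^ 6)⁻¹ by positivity)
    filter_upwards [this, Filter.eventually_ge_atTop 1] with x hx hx1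
    rw [Real.norm_of_nonneg (pow_nonneg (Real.log_nonneg hx1) 6), id,
      Real.norm_of_nonneg (by linarith), ← div_eq_inv_mul, le_div_iff₀ (by positivity)] at hx
    linarith
  -- Beyond `x₀` the number n exceeds the required power of log n. Below it C ≥ 4|x₀| and log² n ≥
  -- 1/4 make C log² n at least n, so the trivial degree bound suffices.
  obtain ⟨x₀, hx₀⟩ := Filter.eventually_atTop.1 hev
  refine ⟨40 + 4 * |x₀| + 3 * (a + 11) + 18 * 592 ^ 2 * (a + 1) ^ 2, ?_, fun n hn => ?_⟩
  · have h1 := abs_nonneg x₀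
    have h2 : (0 : ℝ) ≤ 18 * 592 ^ 2 * (a + 1) ^ 2 := by positivity
    have h3 : (0 : ℝ) ≤ a := by positivity
    linarith
  set C : ℝ := 40 + 4 * |x₀| + 3 * (a + 11) + 18 * 592 ^ 2 * (a + 1) ^ 2 with hC
  have hn' : (2 : ℝ) ≤ n := by exact_mod_cast hn
  have hn0 : (0 : ℝ) < n := by linarith
  set l := Nat.clog 2 n with hl
  have hl1 : 1 ≤ l := Nat.clog_pos (by norm_num) hn
  have hnl : n ≤ 2 ^ l := Nat.le_pow_clog (by norm_num) n
  have hlog2 : (0.6931471803 : ℝ) < Real.log 2 := Real.log_two_gt_d9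
  have hlog2' : Real.log 2 < (0.6931471808 : ℝ) := Real.log_two_lt_d9
  have hlogn : Real.log 2 ≤ Real.log n := Real.log_le_log (by norm_num) hn'
  have hlog_le : Real.log n ≤ l := by
    have : Real.log n ≤ Real.log ((2 : ℝ) ^ l) := Real.log_le_log hn0 (by exact_mod_cast hnl)
    rw [Real.log_pow] at this
    have h0 : (0 : ℝ) ≤ l := by positivity
    nlinarith
  have hle_log : (l : ℝ) ≤ 3 * Real.log n := by
    have h1 := Nat.pow_pred_clog_lt_self (b := 2) (by norm_num) hn
    rw [← hl] at h1
    have h2 : Real.log ((2 : ℝ) ^ (l - 1)) ≤ Real.log n :=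
      Real.log_le_log (by positivity) (by exact_mod_cast h1.le)
    rw [Real.log_pow, Nat.cast_sub hl1] at h2
    push_cast at h2
    nlinarith
  have hpow : ∀ {x y : ℕ}, x ≤ y → 2 ^ x ≤ 2 ^ y := fun h => Nat.pow_le_pow_right (by norm_num) h
  have hτl : (((a + 1) * l : ℕ) : ℝ) ≤ (a + 1) * 3 * Real.log n := by
    push_cast
    rw [mul_assoc]
    gcongr
  have hlog0 : 0 ≤ Real.log n := by linarith
  have ha0 : (0 : ℝ) ≤ a := by positivity
  refine ⟨(a + 1) * l, (a + 11) * l, ?_, ?_, ?_, ?_, ?_, ?_, ?_, ?_⟩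
  · nlinarith
  · calc (n + 1) ^ 2 ≤ (2 ^ (l + 1)) ^ 2 := by
          gcongr
          rw [pow_succ]
          have : 1 ≤ 2 ^ l := Nat.one_le_two_pow
          omega
      _ = 2 ^ ((l + 1) * 2) := by rw [pow_mul]
      _ ≤ _ := hpow (by nlinarith)
  · intro D hD
    have h1 := _root_.classLevel_le (n := n) (τ := (a + 1) * l) (D := D)
    have h2 : Real.sqrt ((D : ℝ) / n) ≤ n := by
      rw [Real.sqrt_le_left (by positivity)]
      rw [div_le_iff₀ hn0]
      have : (D : ℝ) ≤ n * n := by exact_mod_cast hD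
      nlinarith [mul_nonneg (by linarith : (0 : ℝ) ≤ n - 1) (by positivity : (0 : ℝ) ≤ (n : ℝ) * n)]
    have h3 : (2 : ℝ) ^ classLevel n ((a + 1) * l) D ≤ (16 * (n + 1) + 32 * ((a + 1) * l) : ℕ) := by
      push_cast at h1 ⊢
      linarith
    have h4 : 2 ^ classLevel n ((a + 1) * l) D ≤ 16 * (n + 1) + 32 * ((a + 1) * l) := by
      exact_mod_cast h3
    have h5 : (a + 1) * l ≤ 2 ^ ((a + 1) * l) := Nat.lt_two_pow_self.le
    have h6 : 2 ^ l ≤ 2 ^ ((a + 1) * l) := hpow (by nlinarith)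
    refine (Nat.pow_le_pow_iff_right (by norm_num : 1 < 2)).1 (h4.trans ?_)
    calc 16 * (n + 1) + 32 * ((a + 1) * l) ≤ 2 ^ ((a + 1) * l) * 2 ^ 6 := by omega
      _ = 2 ^ ((a + 1) * l + 6) := by rw [pow_add]
      _ ≤ _ := hpow (by nlinarith)
  · intro D hD
    have h1 := _root_.edgeLevel_le (n := n) (D := D)
    have h2 : (D : ℝ) / n ≤ n := by
      rw [div_le_iff₀ hn0]
      exact_mod_cast hD
    have h3 : (2 : ℝ) ^ edgeLevel n D ≤ (8 * (n + 1) : ℕ) := by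
      push_cast
      linarith
    have h4 : 2 ^ edgeLevel n D ≤ 8 * (n + 1) := by exact_mod_cast h3
    refine (Nat.pow_le_pow_iff_right (by norm_num : 1 < 2)).1 (h4.trans ?_)
    calc 8 * (n + 1) ≤ 2 ^ l * 2 ^ 4 := by omega
      _ = 2 ^ (l + 4) := by rw [pow_add]
      _ ≤ _ := hpow (by nlinarith)
  -- The exponent 7 pays for n⁴ per step and for 2n + 1 ≤ n³ steps.
  · have h1 : Real.exp (-(((a + 1) * l : ℕ) : ℝ)) ≤ (n : ℝ) ^ (-(c + 7)) := by
      rw [Real.rpow_def_of_pos hn0]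
      apply Real.exp_le_exp.2
      push_cast
      have h2 : (c + 7) * Real.log n ≤ (a + 1) * l := by
        calc (c + 7) * Real.log n ≤ (a + 1) * Real.log n := by
              exact mul_le_mul_of_nonneg_right (by linarith) hlog0
          _ ≤ _ := by gcongr
      linarith
    calc (2 * n + 1) * ((n : ℝ) ^ 4 * Real.exp (-(((a + 1) * l : ℕ) : ℝ)))
        ≤ (n : ℝ) ^ 3 * ((n : ℝ) ^ 4 * (n : ℝ) ^ (-(c + 7))) := by
          gcongr
          nlinarith [mul_nonneg (by nlinarith : (0 : ℝ) ≤ n * n - 4) hn0.le]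
      _ = (n : ℝ) ^ (7 : ℝ) * (n : ℝ) ^ (-(c + 7)) := by
          rw [← mul_assoc, ← pow_add]
          norm_cast
      _ = _ := by
          rw [← Real.rpow_add hn0]
          congr 1
          ring
  · push_cast
    have h1 : ((a : ℝ) + 11) * l ≤ (a + 11) * (3 * Real.log n) := by gcongr
    have h2 : (a + 11) * 3 * Real.log n ≤ C * Real.log n := by
      gcongr
      have h1 := abs_nonneg x₀
      have h2 : (0 : ℝ) ≤ 18 * 592 ^ 2 * (a + 1) ^ 2 := by positivity
      rw [hC]
      linarith
    linarith
  · have h1 : (592 * (((a + 1) * l : ℕ) : ℝ)) ^ 2 ≤ (592 * ((a + 1) * 3 * Real.log n)) ^ 2 := by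
      gcongr
    have h2 : 18 * 592 ^ 2 * (a + 1) ^ 2 * Real.log n ^ 2 ≤ C * Real.log n ^ 2 := by
      gcongr
      have h1 := abs_nonneg x₀
      rw [hC]
      linarith
    linarith
  · by_cases hx : x₀ ≤ n
    · left
      have h1 := hx₀ n hx
      have h2 : (592 : ℝ) ^ 4 * (((a + 1) * l : ℕ) : ℝ) ^ 6 ≤ n := by
        calc (592 : ℝ) ^ 4 * (((a + 1) * l : ℕ) : ℝ) ^ 6
            ≤ 592 ^ 4 * ((a + 1) * 3 * Real.log n) ^ 6 := by gcongr
          _ = 592 ^ 4 * ((a + 1) * 3 : ℝ) ^ 6 * Real.log n ^ 6 := by ring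
          _ ≤ n := h1
      exact_mod_cast h2
    · right
      have h1 : (n : ℝ) ≤ |x₀| := (not_le.1 hx).le.trans (le_abs_self _)
      have h2 : (1 : ℝ) / 4 ≤ Real.log n ^ 2 := by nlinarith
      have h3 : 4 * |x₀| ≤ C := by
        have h2 : (0 : ℝ) ≤ 18 * 592 ^ 2 * (a + 1) ^ 2 := by positivity
        rw [hC]
        linarith
      have h4 := abs_nonneg x₀
      have h5 : 4 * |x₀| * (1 / 4) ≤ C * Real.log n ^ 2 := by gcongr
      linarith

/-- As r is unbounded in terms of n, the number of phases is capped at n to keep the union bound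
polynomial. Nothing is lost: d ≤ n ≤ 2^(2^n), so after n phases the power of d is at most 2. -/
theorem rpow_one_div_two_pow_min_le {n : ℕ} {d r : ℝ} (hd : 1 ≤ d) (hdn : d ≤ n) :
    d ^ ((1 : ℝ) / 2 ^ min ⌈r⌉₊ n) ≤ 2 * d ^ ((1 : ℝ) / (2 : ℝ) ^ r) := by
  have hone : 1 ≤ d ^ ((1 : ℝ) / (2 : ℝ) ^ r) := Real.one_le_rpow hd (by positivity)
  rcases le_total ⌈r⌉₊ n with h | h
  · rw [min_eq_left h]
    have h1 : d ^ ((1 : ℝ) / 2 ^ ⌈r⌉₊) ≤ d ^ ((1 : ℝ) / (2 : ℝ) ^ r) := by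
      refine Real.rpow_le_rpow_of_exponent_le hd ?_
      gcongr
      rw [← Real.rpow_natCast]
      exact Real.rpow_le_rpow_of_exponent_le (by norm_num) (Nat.le_ceil r)
    linarith
  · rw [min_eq_right h]
    have h1 : (n : ℝ) ≤ 2 ^ n := by exact_mod_cast Nat.lt_two_pow_self.le
    have h2 : d ^ ((1 : ℝ) / 2 ^ n) ≤ 2 := by
      calc d ^ ((1 : ℝ) / 2 ^ n) ≤ ((2 : ℝ) ^ (2 ^ n)) ^ ((1 : ℝ) / 2 ^ n) := by
            refine Real.rpow_le_rpow (by linarith) (hdn.trans (h1.trans ?_)) (by positivity)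
            exact pow_le_pow_right₀ (by norm_num) Nat.lt_two_pow_self.le
        _ = 2 := by
            rw [← Real.rpow_natCast, ← Real.rpow_mul (by norm_num)]
            push_cast
            rw [mul_one_div_cancel (by positivity), Real.rpow_one]
    linarith

/-- Three regimes: for d < 1 the target may be arbitrarily small, so no edge may remain; for large n
the recursion applies; for small n the bound m ≤ n suffices. -/
theorem CliqueParams.degree_le {c C : ℝ} {n τ b m : ℕ} (p : CliqueParams c C n τ b) {d r : ℝ}
    (hC : 0 ≤ C) (hd0 : 0 ≤ d) (hdn : d ≤ n) (h0 : d < 1 → m = 0) (hm : m ≤ n)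
    (h : 592 ^ 4 * τ ^ 6 ≤ n → 1 ≤ d →
      (m : ℝ) ≤ (592 * τ) ^ 2 * d ^ ((1 : ℝ) / 2 ^ min ⌈r⌉₊ n)) :
    (m : ℝ) ≤ C * d ^ ((1 : ℝ) / (2 : ℝ) ^ r) * Real.log n ^ 2 := by
  rcases lt_or_ge d 1 with hd | hd
  · rw [h0 hd, Nat.cast_zero]
    positivity
  · have hone : 1 ≤ d ^ ((1 : ℝ) / (2 : ℝ) ^ r) := Real.one_le_rpow hd (by positivity)
    have hcomm : C * d ^ ((1 : ℝ) / (2 : ℝ) ^ r) * Real.log n ^ 2 =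
        C * Real.log n ^ 2 * d ^ ((1 : ℝ) / (2 : ℝ) ^ r) := by ring
    rw [hcomm]
    rcases p.large_or_small with hl | hs
    · calc (m : ℝ) ≤ (592 * τ) ^ 2 * d ^ ((1 : ℝ) / 2 ^ min ⌈r⌉₊ n) := h hl hd
        _ ≤ (592 * τ) ^ 2 * (2 * d ^ ((1 : ℝ) / (2 : ℝ) ^ r)) := by
          gcongr
          exact rpow_one_div_two_pow_min_le hd hdn
        _ = 2 * (592 * τ) ^ 2 * d ^ ((1 : ℝ) / (2 : ℝ) ^ r) := by ring
        _ ≤ _ := mul_le_mul_of_nonneg_right p.factor (by positivity)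
    · have hm' : (m : ℝ) ≤ n := by exact_mod_cast hm
      calc (m : ℝ) ≤ C * Real.log n ^ 2 * 1 := by linarith
        _ ≤ _ := by gcongr

end Parameters

/-! ### Translation to the residual degree and matchings as subgraphs -/

section Links

variable {n : ℕ} (G : SimpleGraph (Fin n))

theorem residualMaxDegree_le (X : Set (Fin n)) :
    residualMaxDegree G X ≤ maxDeg (restrictTo G Xᶜ) := by
  classical
  unfold residualMaxDegree
  refine SimpleGraph.maxDegree_le_of_forall_degree_le _ _ fun v => ?_
  refine le_trans ?_ (ncard_neighborSet_le_maxDeg _ v.1)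
  rw [← SimpleGraph.card_neighborSet_eq_degree, ← Nat.card_eq_fintype_card,
    Nat.card_coe_set_eq]
  exact Set.ncard_le_ncard_of_injOn Subtype.val (fun u hu => ⟨hu, v.2, u.2⟩)
    Subtype.val_injective.injOn (Set.toFinite _)

theorem compl_coveredBy (S : Set (Fin n)) : (coveredBy G S)ᶜ = uncovered G.neighborSet S := by
  ext v
  simp only [coveredBy, uncovered, Set.mem_compl_iff, Set.mem_ofPred_eq, not_or, not_exists,
    not_and, SimpleGraph.mem_neighborSet]
  refine and_congr_right fun _ => forall_congr' fun u => imp_congr_right fun _ => ?_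
  rw [G.adj_comm]

theorem avgDegree_eq : avgDegree G = (degSum G : ℝ) / n := by
  simp [avgDegree, degSum]

theorem CongestedCliqueAlgorithm.prob_mono {Out : Type} (A : CongestedCliqueAlgorithm n Out)
    {E E' : Set A.Coins} (h : E ⊆ E') : A.prob E ≤ A.prob E' := by
  unfold CongestedCliqueAlgorithm.prob
  gcongr
  exact Set.toFinite _

/-- The matching described by a consistent assignment of partners. -/
def partnerSubgraph {M : Fin n → Option (Fin n)} (hM : IsPartnerMap G M) : G.Subgraph where
  verts := {v | M v ≠ none}
  Adj v w := M v = some w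
  adj_sub h := (hM _ _ h).2
  edge_vert h := by simp [h]
  symm := ⟨fun _ _ h => (hM _ _ h).1⟩

theorem partnerSubgraph_isMatching {M : Fin n → Option (Fin n)} (hM : IsPartnerMap G M) :
    (partnerSubgraph G hM).IsMatching := by
  intro v hv
  obtain ⟨w, hw⟩ := Option.ne_none_iff_exists'.1 hv
  exact ⟨w, hw, fun u hu => Option.some.inj ((show M v = some u from hu).symm.trans hw)⟩

theorem compl_verts_partnerSubgraph {M : Fin n → Option (Fin n)} (hM : IsPartnerMap G M) :
    (partnerSubgraph G hM).vertsᶜ = unmatched M := by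
  ext v
  simp [partnerSubgraph, unmatched]

end Links

/-! ### The independent set algorithm -/

section IndependentSet

/-- Requirements on an algorithm that lowers the maximum degree by an independent set. -/
def ReducesByIndependentSet (c C r : ℝ) {n : ℕ} (A : CongestedCliqueAlgorithm n Bool) : Prop :=
  (A.rounds : ℝ) ≤ C * r ∧ (A.bandwidth : ℝ) ≤ C * Real.log n ∧
  ∀ G : SimpleGraph (Fin n), (∀ ω : A.Coins, G.IsIndepSet (A.selected G ω)) ∧
    1 - (n : ℝ) ^ (-c) ≤ A.prob {ω |
      (residualMaxDegree G (coveredBy G (A.selected G ω)) : ℝ) ≤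
        C * avgDegree G ^ ((1 : ℝ) / (2 : ℝ) ^ r) * Real.log n ^ 2}

theorem exists_independentSet_algorithm {c C : ℝ} (hC : 40 ≤ C) {n τ b : ℕ} (hn : 2 ≤ n)
    (p : CliqueParams c C n τ b) {r : ℝ} (hr : 1 ≤ r) :
    ∃ A : CongestedCliqueAlgorithm n Bool, ReducesByIndependentSet c C r A := by
  classical
  set N := min ⌈r⌉₊ n with hN
  have hN1 : 1 ≤ N := le_min (Nat.one_le_ceil_iff.2 (by linarith)) (by omega)
  have hNn : (N : ℝ) ≤ n := by exact_mod_cast min_le_right _ _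
  have hNr : (N : ℝ) ≤ 2 * r := by
    have h1 : (N : ℝ) ≤ ⌈r⌉₊ := by exact_mod_cast min_le_left _ _
    have h2 := Nat.ceil_lt_add_one (by linarith : 0 ≤ r)
    linarith
  have hn0 : 0 < n := by omega
  let Ψ : ℕ → (Fin n → Set (Fin n)) → (Fin n × Fin n → Fin (2 ^ b)) → Set (Fin n) → Set (Fin n) :=
    fun _ Nb z S => misStep τ Nb (fun v => z (v, v)) S
  obtain ⟨A, hA1, hA2, hA⟩ := exists_algorithm (n := n) (L := b) (b := b) (T := 8) Ψ
    (fun i => cliqueRealizes_misStep (by omega) p.sq_le le_rfl τ Prod.fst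
      (fun v (x : Set (Fin n) × (ℕ → Fin n → Fin (2 ^ b))) => x.2 i v))
    (fun v S => decide (v ∈ S)) ∅ N
  refine ⟨A, ?_, by rw [hA2]; exact p.bandwidth, fun G => ?_⟩
  · rw [hA1]
    push_cast
    nlinarith
  obtain ⟨z, hz, hbad⟩ := hA G
  set S : A.Coins → ℕ → Set (Fin n) := fun ω i =>
    iterateSteps (fun i => Ψ i G.neighborSet (z ω i)) i ∅ with hS
  have hsel : ∀ ω, A.selected G ω = S ω N := by
    intro ω
    ext v
    simp [CongestedCliqueAlgorithm.selected, hz, hS]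
  refine ⟨fun ω => ?_, ?_⟩
  · rw [hsel]
    have : ∀ i, G.IsIndepSet (S ω i) := by
      intro i
      induction i with
      | zero => exact Set.pairwise_empty _
      | succ i ih => exact isIndepSet_misStep G τ _ ih
    exact this N
  let H : Set (Fin n) → SimpleGraph (Fin n) := fun S => restrictTo G (uncovered G.neighborSet S)
  have hD0 : degSum (H ∅) ≤ degSum G := degSum_mono fun _ _ h => h.1
  -- Including the size condition makes the event empty for small n, so its probability bound holds
  -- for every n.
  have h1 := hbad (fun _ S z => 4096 * τ ^ 2 ≤ n ∧ ∃ v,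
    τ * (16 * (Real.sqrt ((degSum (H S) : ℝ) / n) + 1) + 32 * τ) <
      ((H (misStep τ G.neighborSet (fun v => z (v, v)) S)).neighborSet v).ncard)
    (n ^ 4 * Real.exp (-τ)) fun i S => by
      by_cases hl : 4096 * τ ^ 2 ≤ n
      · simp only [hl, true_and]
        have hinj : Function.Injective fun v : Fin n => (v, v) := fun u v h => (Prod.ext_iff.1 h).1
        rw [pr_comp_injective hinj fun y : Fin n → Fin (2 ^ b) => ∃ v,
          τ * (16 * (Real.sqrt ((degSum (H S) : ℝ) / n) + 1) + 32 * τ) <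
            ((H (misStep τ G.neighborSet y S)).neighborSet v).ncard]
        exact pr_misStep_le G S p.one_le hl (p.classLevel_le _ (degSum_le_sq _))
      · simp only [hl, false_and, pr, if_false, Finset.expect_const_zero]
        positivity
  have h2 : (N : ℝ) * (n ^ 4 * Real.exp (-τ)) ≤ (n : ℝ) ^ (-c) := by
    refine le_trans ?_ p.failure
    gcongr
    linarith
  refine le_trans (by linarith) (h1.trans (A.prob_mono fun ω hω => ?_))
  simp only [Set.mem_ofPred_eq] at hω ⊢
  have hle : residualMaxDegree G (coveredBy G (A.selected G ω)) ≤ maxDeg (H (S ω N)) := by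
    have := residualMaxDegree_le G (coveredBy G (A.selected G ω))
    rw [compl_coveredBy] at this
    rw [hsel] at this ⊢
    exact this
  have hd : avgDegree G = (degSum G : ℝ) / n := avgDegree_eq G
  have hn0' : (0 : ℝ) < n := by exact_mod_cast hn0
  refine le_trans (Nat.cast_le.2 hle) (p.degree_le (by linarith) ?_ ?_ ?_ (maxDeg_le_card _) ?_)
  · rw [hd]; positivity
  · rw [hd, div_le_iff₀ hn0']
    exact_mod_cast degSum_le_sq G
  -- The degree sum never increases and is at most n, so the last step collects the whole residual
  -- graph and leaves no edge, with certainty.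
  · intro hlt
    rw [hd, div_lt_one hn0'] at hlt
    have hlt' : degSum G ≤ n := by exact_mod_cast hlt.le
    have hall : ∀ i, degSum (H (S ω i)) ≤ n := by
      intro i
      induction i with
      | zero => exact hD0.trans hlt'
      | succ i ih =>
        refine le_trans (degSum_mono ?_) ih
        rintro u v ⟨h1, h2, h3⟩
        exact ⟨h1, uncovered_misStep_subset G τ _ _ h2, uncovered_misStep_subset G τ _ _ h3⟩
    obtain ⟨N', hN'⟩ := Nat.exists_eq_succ_of_ne_zero (by omega : N ≠ 0)
    rw [hN']
    refine Nat.le_zero.1 (Finset.sup_le fun v _ => ?_)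
    have := neighborSet_misStep_eq_empty G τ (fun v => z ω N' (v, v)) _ (hall N') v
    exact (congrArg Set.ncard this).le.trans_eq (Set.ncard_empty _)
  · intro hl hd1
    have hl' : 4096 * τ ^ 2 ≤ n := by
      refine le_trans ?_ hl
      have : τ ^ 2 ≤ τ ^ 6 := Nat.pow_le_pow_right p.one_le (by norm_num)
      omega
    have hτ0 : (0 : ℝ) ≤ τ := by positivity
    have h3 := maxDeg_le_of_vertex_sampling hn0 p.one_le hN1 (fun i => H (S ω i)) hd1
      (by
        rw [hd]
        gcongr
        exact hD0)
      (fun i hi v => by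
        have := hω i hi
        simp only [hl', true_and, not_exists, not_lt] at this
        exact this v)
    refine h3.trans ?_
    gcongr
    norm_num

end IndependentSet

/-! ### The matching algorithm -/

section MatchingAlgorithm

/-- Requirements on an algorithm that lowers the maximum degree by a matching. -/
def ReducesByMatching (c C r : ℝ) {n : ℕ} (A : CongestedCliqueAlgorithm n (Option (Fin n))) :
    Prop :=
  (A.rounds : ℝ) ≤ C * r ∧ (A.bandwidth : ℝ) ≤ C * Real.log n ∧
  ∀ G : SimpleGraph (Fin n), ∃ M : A.Coins → G.Subgraph,
    (∀ ω : A.Coins, (M ω).IsMatching ∧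
      ∀ v w : Fin n, A.result G ω v = some w ↔ (M ω).Adj v w) ∧
    1 - (n : ℝ) ^ (-c) ≤ A.prob {ω |
      (residualMaxDegree G (M ω).verts : ℝ) ≤
        C * avgDegree G ^ ((1 : ℝ) / (2 : ℝ) ^ r) * Real.log n ^ 2}

theorem exists_matching_algorithm {c C : ℝ} (hC : 40 ≤ C) {n τ b : ℕ} (hn : 2 ≤ n)
    (p : CliqueParams c C n τ b) {r : ℝ} (hr : 1 ≤ r) :
    ∃ A : CongestedCliqueAlgorithm n (Option (Fin n)), ReducesByMatching c C r A := by
  classical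
  set N := min ⌈r⌉₊ n with hN
  have hN1 : 1 ≤ N := le_min (Nat.one_le_ceil_iff.2 (by linarith)) (by omega)
  have hNn : (N : ℝ) ≤ n := by exact_mod_cast min_le_right _ _
  have hNr : (N : ℝ) ≤ 2 * r := by
    have h1 : (N : ℝ) ≤ ⌈r⌉₊ := by exact_mod_cast min_le_left _ _
    have h2 := Nat.ceil_lt_add_one (by linarith : 0 ≤ r)
    linarith
  have hn0 : 0 < n := by omega
  let Ψ : ℕ → (Fin n → Set (Fin n)) → (Fin n × Fin n → Fin (2 ^ b)) →
      (Fin n → Option (Fin n)) → (Fin n → Option (Fin n)) := fun i Nb z M =>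
    if i % 2 = 0 then edgeStep Nb z M else partStep τ Nb (fun v => z (v, v)) M
  obtain ⟨A, hA1, hA2, hA⟩ := exists_algorithm (n := n) (L := b) (b := b) (T := 8) Ψ
    (fun i => by
      by_cases hi : i % 2 = 0
      · simp only [Ψ, hi, if_true]
        exact cliqueRealizes_edgeStep (by omega) p.sq_le le_rfl Prod.fst
          (fun (x : Set (Fin n) × (ℕ → Fin n → Fin (2 ^ b))) => x.2 i)
      · simp only [Ψ, hi, if_false]
        exact cliqueRealizes_partStep (by omega) p.sq_le le_rfl τ Prod.fst
          (fun v (x : Set (Fin n) × (ℕ → Fin n → Fin (2 ^ b))) => x.2 i v))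
    -- Even steps sample edges and odd steps partition. The sequence begins and ends with edge
    -- sampling, which supplies the maximum degree bounds.
    (fun v M => M v) (fun _ => none) (2 * N + 1)
  refine ⟨A, ?_, by rw [hA2]; exact p.bandwidth, fun G => ?_⟩
  -- There are 8(2N + 1) rounds, at most 40r because N ≤ 2r and r ≥ 1; this is why C ≥ 40 is
  -- required.
  · rw [hA1]
    push_cast
    nlinarith
  obtain ⟨z, hz, hbad⟩ := hA G
  set M : A.Coins → ℕ → (Fin n → Option (Fin n)) := fun ω i =>
    iterateSteps (fun i => Ψ i G.neighborSet (z ω i)) i (fun _ => none) with hMdef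
  have hstep : ∀ ω i, M ω (i + 1) = Ψ i G.neighborSet (z ω i) (M ω i) := fun ω i => rfl
  have hvalid : ∀ ω i, IsPartnerMap G (M ω i) := by
    intro ω i
    induction i with
    | zero => exact fun v w h => absurd h (by simp [hMdef, iterateSteps])
    | succ i ih =>
      rw [hstep]
      simp only [Ψ]
      split_ifs
      · exact isPartnerMap_edgeStep G ih _
      · exact isPartnerMap_partStep G τ ih _
  refine ⟨fun ω => partnerSubgraph G (hvalid ω (2 * N + 1)),
    fun ω => ⟨partnerSubgraph_isMatching G _, fun v w => by rw [hz]; rfl⟩, ?_⟩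
  let H : (Fin n → Option (Fin n)) → SimpleGraph (Fin n) := fun M => restrictTo G (unmatched M)
  have hD0 : degSum (H fun _ => none) ≤ degSum G := degSum_mono fun _ _ h => h.1
  let badE : (Fin n → Option (Fin n)) → (Fin n × Fin n → Fin (2 ^ b)) → Prop := fun M z =>
    ∃ v, τ * (8 * ((degSum (H M) : ℝ) / n + 1)) <
      ((H (edgeStep G.neighborSet z M)).neighborSet v).ncard
  let badP : (Fin n → Option (Fin n)) → (Fin n → Fin (2 ^ b)) → Prop := fun M z =>
    n * (16 * (Real.sqrt ((degSum (H M) : ℝ) / n) + 1) + 32 * τ) +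
        6 * maxDeg (H M) * Real.sqrt (2 * n * τ) < degSum (H (partStep τ G.neighborSet z M))
  have h1 := hbad (fun i M z => 4096 * τ ^ 2 ≤ n ∧
    if i % 2 = 0 then badE M z else badP M (fun v => z (v, v)))
    (n ^ 4 * Real.exp (-τ)) fun i M => by
      by_cases hl : 4096 * τ ^ 2 ≤ n
      · simp only [hl, true_and]
        by_cases hi : i % 2 = 0
        · simp only [hi, if_true]
          exact pr_edgeStep_le G M p.one_le hl (p.edgeLevel_le _ (degSum_le_sq _))
        · simp only [hi, if_false]
          have hinj : Function.Injective fun v : Fin n => (v, v) :=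
            fun u v h => (Prod.ext_iff.1 h).1
          rw [pr_comp_injective hinj (badP M)]
          exact pr_partStep_le G M p.one_le hl (p.classLevel_le _ (degSum_le_sq _))
            (ncard_neighborSet_le_maxDeg _)
      · simp only [hl, false_and, pr, if_false, Finset.expect_const_zero]
        positivity
  have h2 : ((2 * N + 1 : ℕ) : ℝ) * (n ^ 4 * Real.exp (-τ)) ≤ (n : ℝ) ^ (-c) := by
    refine le_trans ?_ p.failure
    push_cast
    gcongr
  refine le_trans (by linarith) (h1.trans (A.prob_mono fun ω hω => ?_))
  simp only [Set.mem_ofPred_eq] at hω ⊢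
  have hle : residualMaxDegree G (partnerSubgraph G (hvalid ω (2 * N + 1))).verts ≤
      maxDeg (H (M ω (2 * N + 1))) := by
    have := residualMaxDegree_le G (partnerSubgraph G (hvalid ω (2 * N + 1))).verts
    rwa [compl_verts_partnerSubgraph] at this
  have hE : ∀ i, M ω (2 * i + 1) = edgeStep G.neighborSet (z ω (2 * i)) (M ω (2 * i)) := by
    intro i
    rw [hstep]
    simp [Ψ]
  have hP : ∀ i, M ω (2 * i + 2) =
      partStep τ G.neighborSet (fun v => z ω (2 * i + 1) (v, v)) (M ω (2 * i + 1)) := by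
    intro i
    rw [hstep]
    simp [Ψ, Nat.add_mod]
  have hd : avgDegree G = (degSum G : ℝ) / n := avgDegree_eq G
  have hn0' : (0 : ℝ) < n := by exact_mod_cast hn0
  have hdn : avgDegree G ≤ n := by
    rw [hd, div_le_iff₀ hn0']
    exact_mod_cast degSum_le_sq G
  refine le_trans (Nat.cast_le.2 hle) (p.degree_le (by linarith) ?_ hdn ?_ (maxDeg_le_card _) ?_)
  · rw [hd]; positivity
  · intro hlt
    rw [hd, div_lt_one hn0'] at hlt
    have hlt' : degSum G ≤ n := by exact_mod_cast hlt.le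
    have hall : ∀ i, degSum (H (M ω i)) ≤ n := by
      intro i
      induction i with
      | zero => exact hD0.trans hlt'
      | succ i ih =>
        refine le_trans (degSum_mono ?_) ih
        have hsub : unmatched (M ω (i + 1)) ⊆ unmatched (M ω i) := by
          rw [hstep]
          simp only [Ψ]
          split_ifs
          · exact unmatched_matchUpdate_subset _ _
          · exact unmatched_matchUpdate_subset _ _
        rintro u v ⟨h1, h2, h3⟩
        exact ⟨h1, hsub h2, hsub h3⟩
    refine Nat.le_zero.1 (Finset.sup_le fun v _ => ?_)
    rw [hE]
    have := neighborSet_edgeStep_eq_empty G _ (z ω (2 * N))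
      ((hall (2 * N)).trans (by omega)) v
    exact (congrArg Set.ncard this).le.trans_eq (Set.ncard_empty _)
  · intro hl hd1
    have hl' : 4096 * τ ^ 2 ≤ n := by
      refine le_trans ?_ hl
      have : τ ^ 2 ≤ τ ^ 6 := Nat.pow_le_pow_right p.one_le (by norm_num)
      omega
    refine maxDeg_le_of_edge_sampling p.one_le hN1 hl (fun i => H (M ω i)) hd1 hdn ?_ ?_ ?_
    · rw [hd]
      gcongr
      exact hD0
    · intro i hi v
      have := hω (2 * i) (by omega)
      simp only [hl', true_and, Nat.mul_mod_right, if_true, badE, not_exists, not_lt] at this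
      simp only [hE]
      exact this v
    · intro i hi
      have := hω (2 * i + 1) (by omega)
      simp only [hl', true_and, show (2 * i + 1) % 2 ≠ 0 by omega, if_false, badP, not_lt] at this
      simp only [hP]
      exact this

end MatchingAlgorithm

/-- The algorithm without communication in which every node outputs the same value. -/
def constantAlgorithm (n : ℕ) {Out : Type} (o : Out) : CongestedCliqueAlgorithm n Out where
  coins := 0
  rounds := 0
  bandwidth := 0
  State := Unit
  init _ _ _ := ()
  send _ _ _ _ := false
  receive _ _ _ := ()
  output _ := o

theorem CongestedCliqueAlgorithm.prob_nonneg {n : ℕ} {Out : Type}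
    (A : CongestedCliqueAlgorithm n Out) (E : Set A.Coins) : 0 ≤ A.prob E := by
  unfold CongestedCliqueAlgorithm.prob
  positivity

theorem mainTheorem8 (c : ℝ) (hc : 0 < c) :
    ∃ C : ℝ, 0 < C ∧ ∀ r : ℝ, 1 ≤ r →
      -- independent set
      (∃ A : (n : ℕ) → CongestedCliqueAlgorithm n Bool, ∀ n : ℕ, 1 ≤ n →
        ((A n).rounds : ℝ) ≤ C * r ∧
        ((A n).bandwidth : ℝ) ≤ C * Real.log n ∧
        ∀ G : SimpleGraph (Fin n),
          (∀ ω : (A n).Coins, G.IsIndepSet ((A n).selected G ω)) ∧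
          1 - (n : ℝ) ^ (-c) ≤ (A n).prob {ω |
            (residualMaxDegree G (coveredBy G ((A n).selected G ω)) : ℝ) ≤
              C * avgDegree G ^ ((1 : ℝ) / (2 : ℝ) ^ r) * Real.log n ^ 2}) ∧
      -- matching: each node outputs the node that it is matched to, if any
      (∃ A : (n : ℕ) → CongestedCliqueAlgorithm n (Option (Fin n)), ∀ n : ℕ, 1 ≤ n →
        ((A n).rounds : ℝ) ≤ C * r ∧
        ((A n).bandwidth : ℝ) ≤ C * Real.log n ∧
        ∀ G : SimpleGraph (Fin n), ∃ M : (A n).Coins → G.Subgraph,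
          (∀ ω : (A n).Coins, (M ω).IsMatching ∧
            ∀ v w : Fin n, (A n).result G ω v = some w ↔ (M ω).Adj v w) ∧
          1 - (n : ℝ) ^ (-c) ≤ (A n).prob {ω |
            (residualMaxDegree G (M ω).verts : ℝ) ≤
              C * avgDegree G ^ ((1 : ℝ) / (2 : ℝ) ^ r) * Real.log n ^ 2}) := by
  obtain ⟨C, hC, hpar⟩ := exists_cliqueParams c
  refine ⟨C, by linarith, fun r hr => ⟨?_, ?_⟩⟩
  · refine (Classical.skolem (p := fun n A => 1 ≤ n → ReducesByIndependentSet c C r A)).1 fun n => ?_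
    rcases lt_or_ge n 2 with hn | hn
    -- For n = 1 the bandwidth bound is C log 1 = 0, so nothing is sent; the required probability 1
    -- - 1^{-c} is 0.
    · refine ⟨constantAlgorithm n false, fun h1 => ?_⟩
      obtain rfl : n = 1 := by omega
      refine ⟨?_, ?_, fun G => ⟨fun ω => ?_, ?_⟩⟩
      · simp only [constantAlgorithm, Nat.cast_zero]
        nlinarith
      · simp [constantAlgorithm]
      · exact fun u hu => absurd hu (by
          simp [CongestedCliqueAlgorithm.selected, CongestedCliqueAlgorithm.result,
            constantAlgorithm])
      · simpa using CongestedCliqueAlgorithm.prob_nonneg _ _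
    · obtain ⟨τ, b, p⟩ := hpar n hn
      obtain ⟨A, hA⟩ := exists_independentSet_algorithm hC hn p hr
      exact ⟨A, fun _ => hA⟩
  · refine (Classical.skolem (p := fun n A => 1 ≤ n → ReducesByMatching c C r A)).1 fun n => ?_
    rcases lt_or_ge n 2 with hn | hn
    · refine ⟨constantAlgorithm n none, fun h1 => ?_⟩
      obtain rfl : n = 1 := by omega
      refine ⟨?_, ?_, fun G => ⟨fun _ => ⊥, fun ω => ⟨?_, fun v w => ?_⟩, ?_⟩⟩
      · simp only [constantAlgorithm, Nat.cast_zero]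
        nlinarith
      · simp [constantAlgorithm]
      · exact fun v hv => absurd hv (by simp)
      · simp [CongestedCliqueAlgorithm.result, constantAlgorithm]
      · simpa using CongestedCliqueAlgorithm.prob_nonneg _ _
    · obtain ⟨τ, b, p⟩ := hpar n hn
      obtain ⟨A, hA⟩ := exists_matching_algorithm hC hn p hr
      exact ⟨A, fun _ => hA⟩
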